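/- Let $k$ be an algebraically closed field and let $(G,\Gamma)$ be a matched pair of finite groups, that is, finite groups with a right action $\lhd:\Gamma\times G\to\Gamma$ of $G$ on the set $\Gamma$ and a left action $\rhd:\Gamma\times G\to G$ of $\Gamma$ on the set $G$ such that $$s\rhd gh=(s\rhd g)\,((s\lhd g)\rhd h),\qquad st\lhd g=(s\lhd(t\rhd g))\,(t\lhd g).$$ Let $\sigma:G\times G\to(k^*)^\Gamma$ and $\tau:\Gamma\times\Gamma\to(k^*)^G$, written $\sigma_s(g,h)$ and $\tau_g(s,t)$, satisfy, for all $g,h,l\in G$ and $s,t,u\in\Gamma$, $$\sigma_{s\lhd g}(h,l)\,\sigma_s(g,hl)=\sigma_s(g,h)\,\sigma_s(gh,l),\qquad \tau_g(st,u)\,\tau_{u\rhd g}(s,t)=\tau_g(t,u)\,\tau_g(s,tu),$$ $$\sigma_s(e,g)=\sigma_s(g,e)=1,\quad \tau_g(e,s)=\tau_g(s,e)=1,\quad \sigma_e(g,h)=\tau_e(s,t)=1,$$ $$\sigma_{st}(g,h)\,\tau_{gh}(s,t)=\sigma_s(t\rhd g,(t\lhd g)\rhd h)\,\sigma_t(g,h)\,\tau_g(s,t)\,\tau_h(s\lhd(t\rhd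 g),t\lhd g).$$ Let $H=k^\Gamma\,{}^\tau\#_\sigma kG$ be the corresponding abelian extension: the Hopf algebra with basis $e_s\#g$ ($s\in\Gamma$, $g\in G$), unit $\sum_s e_s\#e$, counit $\epsilon(e_s\#g)=\delta_{s,e}$ and $$(e_s\#g)(e_t\#h)=\delta_{s\lhd g,t}\,\sigma_s(g,h)\,e_s\#gh,\qquad \Delta(e_s\#g)=\sum_{tu=s}\tau_g(t,u)\,e_t\#(u\rhd g)\otimes e_u\#g.$$ A $(G,\Gamma)$-crossed action on a tensor category $\mathcal C$ over $k$ (a $k$-linear abelian rigid monoidal category, locally finite, with bilinear tensor product and simple unit $\mathbf 1$) consists of a $\Gamma$-grading $\mathcal C=\bigoplus_{s\in\Gamma}\mathcal C_s$ with $\mathcal C_s\otimes\mathcal C_t\subseteq\mathcal C_{st}$; $k$-linear functors $\rho^g:\mathcal C\to\mathcal C$ ($g\in G$) with natural isomorphisms $\rho_2^{g,h}:\rho^g\rho^h\to\rho^{hg}$ and $\rho_0:\mathrm{id}\to\rho^e$ satisfying the associativity and unit axioms of a right action, and with $\rho^g(\mathcal C_s)=\mathcal C_{s\lhd g}$; natural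 isomorphisms $\gamma^g_{X,Y}:\rho^g(X\otimes Y)\to\rho^{t\rhd g}(X)\otimes\rho^g(Y)$ for $Y\in\mathcal C_t$; and isomorphisms $\gamma_0^g:\rho^g(\mathbf 1)\to\mathbf 1$. These are subject to coherence conditions (associativity constraints suppressed): for $Y\in\mathcal C_s$, $Z\in\mathcal C_t$, - $(\gamma^{t\rhd g}_{X,Y}\otimes\mathrm{id})\,\gamma^g_{X\otimes Y,Z}=(\mathrm{id}\otimes\gamma^g_{Y,Z})\,\gamma^g_{X,Y\otimes Z}$; - $(\mathrm{id}\otimes\gamma^g_0)\,\gamma^g_{X,\mathbf 1}=\mathrm{id}$ and $(\gamma_0^{s\rhd g}\otimes\mathrm{id})\,\gamma^g_{\mathbf 1,Y}=\mathrm{id}$; - $\gamma^{hg}_{X,Y}\,\rho_2^{g,h}=(\rho_2^{(s\lhd h)\rhd g,\;s\rhd h}\otimes\rho_2^{g,h})\,\gamma^g_{\rho^{s\rhd h}(X),\rho^h(Y)}\,\rho^g(\gamma^h_{X,Y})$; - $\gamma_0^{hg}\,\rho_2^{g,h}=\gamma_0^g\,\rho^g(\gamma_0^h)$ on $\mathbf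 1$; - $\gamma^e_{X,Y}\,\rho_0=\rho_0\otimes\rho_0$ and $\gamma^e_0\,\rho_0=\mathrm{id}_{\mathbf 1}$. The tensor category $\mathcal C^{(G,\Gamma)}$ has as objects the pairs $(X,r)$ with $X\in\mathcal C$ and isomorphisms $r^g:\rho^g(X)\to X$ such that $r^g\rho^g(r^h)=r^{hg}\rho_2^{g,h}$ and $r^e\rho_0=\mathrm{id}$. Its morphisms are the morphisms of $\mathcal C$ commuting with the $r^g$; its unit object is $(\mathbf 1,\gamma_0)$; its tensor product is $(X,r)\otimes(Y,r')=(X\otimes Y,\tilde r)$, where $\tilde r^g$ is $(r^{s\rhd g}\otimes r'^g)\,\gamma^g_{X,Y_s}$ on $\rho^g(X\otimes Y_s)$, for $Y=\bigoplus_sY_s$ with $Y_s\in\mathcal C_s$; its constraints are those of $\mathcal C$. **Theorem.** The category $\mathcal C(\Gamma)$ of finite-dimensional $\Gamma$-graded $k$-vector spaces is a fusion category, and the following data define a $(G,\Gamma)$-crossed action on it: $\mathcal C(\Gamma)_s$ consists of the graded vector spaces concentrated in degree $s$; $\rho^g(V)=V$ with grading $\rho^g(V)_{s\lhd g}=V_s$;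 $\rho_0=\mathrm{id}$; $\rho_2^{g,h}(v)=\sigma_{|v|}(h,g)^{-1}v$ for $v\in V$ homogeneous of degree $|v|$; $\gamma^g_{U,V}(u\otimes v)=\tau_g(|u|,s)^{-1}\,u\otimes v$ for $u\in U$ homogeneous of degree $|u|$ and $V\in\mathcal C(\Gamma)_s$; $\gamma_0^g=\mathrm{id}_k$. Moreover, $\mathcal C(\Gamma)^{(G,\Gamma)}$ and the category $\mathrm{Rep}\,H$ of finite-dimensional $H$-modules are tensor categories, and there is a strict equivalence of tensor categories $$\mathcal C(\Gamma)^{(G,\Gamma)}\cong\mathrm{Rep}\,H,$$ that is, a $k$-linear equivalence which, together with a quasi-inverse, preserves tensor products and unit objects on the nose and is a monoidal functor with identities as structure morphisms. (Here the standard associativity and unit constraints of vector spaces are used on both sides.) -/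

import Mathlib

open CategoryTheory MonoidalCategory Limits
open scoped TensorProduct

universe u v w v₁ u₁ v₂ u₂

noncomputable section

/-! ## Tensor categories, fusion categories, strict tensor functors -/

/-- `C`, with its given `k`-linear and monoidal structures, is a tensor category over `k`:
a `k`-linear abelian rigid monoidal category with `k`-bilinear tensor product, locally finite
and with simple unit object. The first five fields are those of Mathlib's class `Abelian`. -/
structure IsTensorCategory (k : Type u) [Field k] (C : Type u₁) [Category.{v₁} C]
    [Preadditive C] [Linear k C] [MonoidalCategory C] : Prop where
  hasFiniteProducts : HasFiniteProducts C
  hasKernels : HasKernels C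
  hasCokernels : HasCokernels C
  normalMono : IsNormalMonoCategory C
  normalEpi : IsNormalEpiCategory C
  monoidalPreadditive : MonoidalPreadditive C
  monoidalLinear : MonoidalLinear k C
  leftDual : ∀ X : C, Nonempty (HasLeftDual X)
  rightDual : ∀ X : C, Nonempty (HasRightDual X)
  noetherian : ∀ X : C, IsNoetherianObject X
  artinian : ∀ X : C, IsArtinianObject X
  finite_hom : ∀ X Y : C, Module.Finite k (X ⟶ Y)
  simple_unit : Simple (𝟙_ C)

/-- A fusion category over `k`: a tensor category which is finite (it has enough projective
objects and finitely many simple objects up to isomorphism) and semisimple (every object is a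
finite direct sum of simple objects). -/
structure IsFusionCategory (k : Type u) [Field k] (C : Type u₁) [Category.{v₁} C]
    [Preadditive C] [Linear k C] [MonoidalCategory C] : Prop extends IsTensorCategory k C where
  enoughProjectives : EnoughProjectives C
  finite_simples : ∃ (n : ℕ) (S : Fin n → C), ∀ X : C, Simple X → ∃ i, Nonempty (X ≅ S i)
  semisimple : ∀ X : C, ∃ (n : ℕ) (S : Fin n → C), (∀ i, Simple (S i)) ∧
    ∃ b : Bicone S, Nonempty b.IsBilimit ∧ Nonempty (X ≅ b.pt)

/-- A strict tensor functor: a `k`-linear exact functor which preserves tensor products and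
the unit object on the nose, and which is a monoidal functor with identities as structure
morphisms. -/
structure IsStrictTensorFunctor (k : Type u) [Field k] {C : Type u₁} [Category.{v₁} C]
    [Preadditive C] [Linear k C] [MonoidalCategory C] {D : Type u₂} [Category.{v₂} D]
    [Preadditive D] [Linear k D] [MonoidalCategory D] (F : C ⥤ D) : Prop where
  additive : F.Additive
  linear : Functor.Linear k F
  preservesFiniteLimits : PreservesFiniteLimits F
  preservesFiniteColimits : PreservesFiniteColimits F
  obj_tensor : ∀ X Y : C, F.obj X ⊗ F.obj Y = F.obj (X ⊗ Y)
  obj_unit : 𝟙_ D = F.obj (𝟙_ C)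
  strict_monoidal : ∃ m : F.Monoidal,
    (∀ X Y : C, m.μ X Y = eqToHom (obj_tensor X Y)) ∧ m.ε = eqToHom obj_unit

/-- A strict equivalence of tensor categories: an equivalence of categories which is a strict
tensor functor, with a quasi-inverse which is a strict tensor functor too. -/
def StrictlyTensorEquivalent (k : Type u) [Field k] (C : Type u₁) [Category.{v₁} C]
    [Preadditive C] [Linear k C] [MonoidalCategory C] (D : Type u₂) [Category.{v₂} D]
    [Preadditive D] [Linear k D] [MonoidalCategory D] : Prop :=
  ∃ e : C ≌ D, IsStrictTensorFunctor k e.functor ∧ IsStrictTensorFunctor k e.inverse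

/-! ## Matched pairs of groups -/

/-- A matched pair of groups `(G, Γ)`: a right action `s ◁ g` (`ract s g`) of `G` on the set `Γ`
and a left action `s ▷ g` (`lact s g`) of `Γ` on the set `G` satisfying the two
compatibility conditions. -/
structure MatchedPair (G : Type v) (Γ : Type w) [Group G] [Group Γ] where
  ract : Γ → G → Γ
  lact : Γ → G → G
  ract_one : ∀ s, ract s 1 = s
  ract_mul : ∀ s g h, ract s (g * h) = ract (ract s g) h
  one_lact : ∀ g, lact 1 g = g
  mul_lact : ∀ s t g, lact (s * t) g = lact s (lact t g)
  lact_mul : ∀ s g h, lact s (g * h) = lact s g * lact (ract s g) h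
  mul_ract : ∀ s t g, ract (s * t) g = ract s (lact t g) * ract t g

namespace MatchedPair

variable {G : Type v} {Γ : Type w} [Group G] [Group Γ] (M : MatchedPair G Γ)

theorem lact_one (s : Γ) : M.lact s 1 = 1 := by
  have h := M.lact_mul s 1 1
  rw [mul_one, M.ract_one] at h
  exact (left_eq_mul.mp h)

theorem one_ract (g : G) : M.ract 1 g = 1 := by
  have h := M.mul_ract 1 1 g
  rw [mul_one, M.one_lact] at h
  exact (left_eq_mul.mp h)

end MatchedPair

/-! ## Crossed actions of a matched pair -/

/-- The data of a `(G, Γ)`-crossed action on a monoidal category `C`. -/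
structure CrossedActionData {G : Type v} {Γ : Type w} [Group G] [Group Γ] (M : MatchedPair G Γ)
    (C : Type u₁) [Category.{v₁} C] [MonoidalCategory C] where
  /-- the homogeneous components `C_s`, as full subcategories -/
  homog : Γ → ObjectProperty C
  /-- the endofunctors `ρ^g` -/
  ρ : G → C ⥤ C
  /-- `ρ₂^{g,h} : ρ^g ρ^h → ρ^{hg}` -/
  ρ₂ : ∀ g h, ρ h ⋙ ρ g ≅ ρ (h * g)
  ρ₀ : 𝟭 C ≅ ρ 1
  /-- `γ^g_{X,Y} : ρ^g(X ⊗ Y) → ρ^{t ▷ g}(X) ⊗ ρ^g(Y)` for `Y ∈ C_t` -/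
  γ : ∀ (g : G) (t : Γ) (X Y : C), homog t Y →
    ((ρ g).obj (X ⊗ Y) ≅ (ρ (M.lact t g)).obj X ⊗ (ρ g).obj Y)
  γ₀ : ∀ g, (ρ g).obj (𝟙_ C) ≅ 𝟙_ C

namespace CrossedActionData

variable {G : Type v} {Γ : Type w} [Group G] [Group Γ] {M : MatchedPair G Γ}
  {C : Type u₁} [Category.{v₁} C] [MonoidalCategory C]

/-- The identity `ρ^g(X) = ρ^{g'}(X)` for equal group elements `g = g'`. -/
def cast (A : CrossedActionData M C) {g g' : G} (h : g = g') (X : C) :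
    (A.ρ g).obj X ⟶ (A.ρ g').obj X :=
  eqToHom (by rw [h])

theorem cast_rfl (A : CrossedActionData M C) (g : G) (X : C) :
    A.cast (rfl : g = g) X = 𝟙 _ := rfl

end CrossedActionData

open CrossedActionData in
/-- The data `A` make the monoidal category `C` into a `(G, Γ)`-crossed tensor category over `k`:
`C` is a tensor category, the components form a `Γ`-grading, `ρ` is a right action of `G` by
`k`-linear autoequivalences with `ρ^g(C_s) = C_{s ◁ g}`, and the isomorphisms `γ`, `γ₀` are natural
and satisfy the compatibility conditions of a crossed action. (Associativity and unit constraints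
of `C` are inserted where needed, and so is the identification `cast` of `ρ^g` and `ρ^{g'}` for
equal elements `g = g'`.) -/
structure IsCrossedTensorCategory (k : Type u) [Field k] {G : Type v} {Γ : Type w} [Group G]
    [Group Γ] [Fintype Γ] {M : MatchedPair G Γ} {C : Type u₁} [Category.{v₁} C] [Preadditive C]
    [Linear k C] [MonoidalCategory C] (A : CrossedActionData M C) : Prop where
  tensorCategory : IsTensorCategory k C
  -- the grading: every object is a direct sum of homogeneous objects
  decomp : ∀ X : C, ∃ (Y : Γ → C) (ι : ∀ s, Y s ⟶ X) (π : ∀ s, X ⟶ Y s),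
    (∀ s, A.homog s (Y s)) ∧ (∀ s, ι s ≫ π s = 𝟙 (Y s)) ∧
    (∀ s t, s ≠ t → ι s ≫ π t = 0) ∧ ∑ s, π s ≫ ι s = 𝟙 X
  hom_zero : ∀ (s t : Γ) (X Y : C), A.homog s X → A.homog t Y → s ≠ t → ∀ f : X ⟶ Y, f = 0
  tensor_mem : ∀ (s t : Γ) (X Y : C), A.homog s X → A.homog t Y → A.homog (s * t) (X ⊗ Y)
  unit_mem : A.homog 1 (𝟙_ C)
  -- the action
  additive : ∀ g, (A.ρ g).Additive
  linear : ∀ g, Functor.Linear k (A.ρ g)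
  ρ₂_assoc : ∀ (a b c : G) (X : C),
    (A.ρ₂ a b).hom.app ((A.ρ c).obj X) ≫ (A.ρ₂ (b * a) c).hom.app X =
      (A.ρ a).map ((A.ρ₂ b c).hom.app X) ≫ (A.ρ₂ a (c * b)).hom.app X ≫
        A.cast (mul_assoc c b a) X
  ρ₂_unit_right : ∀ (a : G) (X : C),
    (A.ρ a).map (A.ρ₀.hom.app X) ≫ (A.ρ₂ a 1).hom.app X ≫ A.cast (one_mul a) X = 𝟙 _
  ρ₂_unit_left : ∀ (a : G) (X : C),
    A.ρ₀.hom.app ((A.ρ a).obj X) ≫ (A.ρ₂ 1 a).hom.app X ≫ A.cast (mul_one a) X = 𝟙 _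
  map_homog : ∀ (g : G) (s : Γ), (A.homog s).map (A.ρ g) = A.homog (M.ract s g)
  -- naturality of `γ`
  γ_natural : ∀ (g : G) (t : Γ) (X X' Y Y' : C) (hY : A.homog t Y) (hY' : A.homog t Y')
    (f : X ⟶ X') (f' : Y ⟶ Y'),
    (A.ρ g).map (f ⊗ₘ f') ≫ (A.γ g t X' Y' hY').hom =
      (A.γ g t X Y hY).hom ≫ ((A.ρ (M.lact t g)).map f ⊗ₘ (A.ρ g).map f')
  -- compatibility with the tensor product
  γ_assoc : ∀ (g : G) (s t : Γ) (X Y Z : C) (hY : A.homog s Y) (hZ : A.homog t Z),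
    (A.γ g t (X ⊗ Y) Z hZ).hom ≫ ((A.γ (M.lact t g) s X Y hY).hom ▷ (A.ρ g).obj Z) ≫
        (α_ _ _ _).hom =
      (A.ρ g).map (α_ X Y Z).hom ≫
        (A.γ g (s * t) X (Y ⊗ Z) (tensor_mem s t Y Z hY hZ)).hom ≫
        (A.cast (M.mul_lact s t g) X ⊗ₘ (A.γ g t Y Z hZ).hom)
  -- compatibility with the unit object
  γ_unit_right : ∀ (g : G) (X : C),
    (A.γ g 1 X (𝟙_ C) unit_mem).hom ≫ (A.cast (M.one_lact g) X ⊗ₘ (A.γ₀ g).hom) ≫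
      (ρ_ _).hom = (A.ρ g).map (ρ_ X).hom
  γ_unit_left : ∀ (g : G) (s : Γ) (X : C) (hX : A.homog s X),
    (A.γ g s (𝟙_ C) X hX).hom ≫ ((A.γ₀ (M.lact s g)).hom ▷ (A.ρ g).obj X) ≫ (λ_ _).hom =
      (A.ρ g).map (λ_ X).hom
  -- compatibility with `ρ₂`
  γ_ρ₂ : ∀ (g h : G) (s : Γ) (X Y : C) (hY : A.homog s Y)
    (hY' : A.homog (M.ract s h) ((A.ρ h).obj Y)),
    (A.ρ₂ g h).hom.app (X ⊗ Y) ≫ (A.γ (h * g) s X Y hY).hom =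
      (A.ρ g).map (A.γ h s X Y hY).hom ≫
        (A.γ g (M.ract s h) ((A.ρ (M.lact s h)).obj X) ((A.ρ h).obj Y) hY').hom ≫
        (((A.ρ₂ (M.lact (M.ract s h) g) (M.lact s h)).hom.app X ≫
          A.cast (M.lact_mul s h g).symm X) ⊗ₘ (A.ρ₂ g h).hom.app Y)
  γ₀_ρ₂ : ∀ g h : G, (A.ρ₂ g h).hom.app (𝟙_ C) ≫ (A.γ₀ (h * g)).hom =
    (A.ρ g).map (A.γ₀ h).hom ≫ (A.γ₀ g).hom
  -- compatibility with `ρ₀`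
  γ_ρ₀ : ∀ (s : Γ) (X Y : C) (hY : A.homog s Y),
    A.ρ₀.hom.app (X ⊗ Y) ≫ (A.γ 1 s X Y hY).hom ≫
        (A.cast (M.lact_one s) X ⊗ₘ 𝟙 ((A.ρ 1).obj Y)) =
      (A.ρ₀.hom.app X ⊗ₘ A.ρ₀.hom.app Y)
  γ₀_ρ₀ : A.ρ₀.hom.app (𝟙_ C) ≫ (A.γ₀ 1).hom = 𝟙 _

/-! ## The tensor category of equivariant objects -/

theorem CrossedActionData.cast_comp {G : Type v} {Γ : Type w} [Group G] [Group Γ]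
    {M : MatchedPair G Γ} {C : Type u₁} [Category.{v₁} C] [MonoidalCategory C]
    {A : CrossedActionData M C} {X : C} (r : ∀ g, (A.ρ g).obj X ⟶ X) {g g' : G} (e : g = g') :
    A.cast e X ≫ r g' = r g := by
  subst e
  rw [CrossedActionData.cast_rfl, Category.id_comp]

/-- The defining relations of an equivariant object force `r^g` to be invertible. -/
theorem CrossedActionData.isIso_of_relations {G : Type v} {Γ : Type w} [Group G] [Group Γ]
    {M : MatchedPair G Γ} {C : Type u₁} [Category.{v₁} C] [MonoidalCategory C]
    {A : CrossedActionData M C} (X : C) (r : ∀ g, (A.ρ g).obj X ⟶ X)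
    (r_mul : ∀ g g', (A.ρ g).map (r g') ≫ r g = (A.ρ₂ g g').hom.app X ≫ r (g' * g))
    (r_one : A.ρ₀.hom.app X ≫ r 1 = 𝟙 X) (g : G) : IsIso (r g) := by
  have h1 : IsIso (r 1) := by
    have : r 1 = inv (A.ρ₀.hom.app X) := by
      rw [← cancel_epi (A.ρ₀.hom.app X), r_one]
      exact (IsIso.hom_inv_id _).symm
    rw [this]; infer_instance
  have hr : ∀ a : G, a = 1 → IsIso (r a) := fun a ha => ha ▸ h1
  have hcomp : ∀ a b : G, b * a = 1 → IsIso ((A.ρ a).map (r b) ≫ r a) := fun a b hab => by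
    have := hr _ hab
    rw [r_mul]; infer_instance
  -- the functor of the inverse element reflects isomorphisms
  have hepi : ∀ a : G, IsSplitEpi (r a) := fun a => by
    have := hcomp a a⁻¹ (by simp)
    exact ⟨⟨⟨inv ((A.ρ a).map (r a⁻¹) ≫ r a) ≫ (A.ρ a).map (r a⁻¹), by simp⟩⟩⟩
  have hmap : IsIso ((A.ρ g⁻¹).map (r g)) := by
    have := hcomp g⁻¹ g (by simp)
    have : IsSplitMono ((A.ρ g⁻¹).map (r g)) :=
      ⟨⟨⟨r g⁻¹ ≫ inv ((A.ρ g⁻¹).map (r g) ≫ r g⁻¹), by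
        rw [← Category.assoc, IsIso.hom_inv_id]⟩⟩⟩
    have := hepi g
    exact isIso_of_mono_of_isSplitEpi _
  have hmap2 : IsIso ((A.ρ g).map ((A.ρ g⁻¹).map (r g))) := inferInstance
  have hn := (A.ρ₂ g g⁻¹).hom.naturality (r g)
  have hmap3 : IsIso ((A.ρ (g⁻¹ * g)).map (r g)) := by
    have e : (A.ρ (g⁻¹ * g)).map (r g) = (A.ρ₂ g g⁻¹).inv.app _ ≫
        (A.ρ g).map ((A.ρ g⁻¹).map (r g)) ≫ (A.ρ₂ g g⁻¹).hom.app _ := by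
      rw [← Functor.comp_map, hn, Iso.inv_hom_id_app_assoc]
    rw [e]; infer_instance
  have hmap4 : IsIso ((A.ρ 1).map (r g)) := by
    have e : g⁻¹ * g = 1 := by simp
    exact e ▸ hmap3
  have e : r g = A.ρ₀.hom.app _ ≫ (A.ρ 1).map (r g) ≫ A.ρ₀.inv.app _ := by
    rw [← NatTrans.naturality_assoc, Iso.hom_inv_id_app]
    exact (Category.comp_id _).symm
  rw [e]; infer_instance

section Equivariantization

variable {k : Type u} [Field k] {G : Type v} {Γ : Type w} [Group G] [Group Γ] [Fintype Γ]
  {M : MatchedPair G Γ} {C : Type u₁} [Category.{v₁} C] [Preadditive C] [Linear k C]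
  [MonoidalCategory C] {A : CrossedActionData M C}

/-- `G`-equivariant objects `(X, r)` of a `(G, Γ)`-crossed tensor category. They are the objects
of the category `C^{(G, Γ)}`. -/
@[ext]
structure Equivariantization (h : IsCrossedTensorCategory k A) where
  X : C
  r : ∀ g, (A.ρ g).obj X ⟶ X
  isIso : ∀ g, IsIso (r g)
  r_mul : ∀ g g', (A.ρ g).map (r g') ≫ r g = (A.ρ₂ g g').hom.app X ≫ r (g' * g)
  r_one : A.ρ₀.hom.app X ≫ r 1 = 𝟙 X

namespace Equivariantization

/-- Equivariant morphisms. -/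
@[ext]
structure Hom {h : IsCrossedTensorCategory k A} (P Q : Equivariantization h) where
  f : P.X ⟶ Q.X
  comm : ∀ g, P.r g ≫ f = (A.ρ g).map f ≫ Q.r g

variable {h : IsCrossedTensorCategory k A}

instance : Category (Equivariantization h) where
  Hom P Q := Hom P Q
  id P := ⟨𝟙 P.X, fun g => by simp⟩
  comp a b := ⟨a.f ≫ b.f, fun g => by
    rw [← Category.assoc, a.comm, Category.assoc, b.comm, Functor.map_comp, Category.assoc]⟩

@[ext]
theorem hom_ext {P Q : Equivariantization h} {a b : P ⟶ Q} (e : a.f = b.f) : a = b :=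
  Hom.ext e

@[simp] theorem id_f (P : Equivariantization h) : Hom.f (𝟙 P) = 𝟙 P.X := rfl
@[simp] theorem comp_f {P Q R : Equivariantization h} (a : P ⟶ Q) (b : Q ⟶ R) :
    (a ≫ b).f = a.f ≫ b.f := rfl

instance (P Q : Equivariantization h) : Zero (P ⟶ Q) :=
  ⟨⟨0, fun g => by have := h.additive g; simp⟩⟩
instance (P Q : Equivariantization h) : Add (P ⟶ Q) :=
  ⟨fun a b => ⟨a.f + b.f, fun g => by
    have := h.additive g; simp [a.comm, b.comm, Functor.map_add]⟩⟩
instance (P Q : Equivariantization h) : Neg (P ⟶ Q) :=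
  ⟨fun a => ⟨-a.f, fun g => by have := h.additive g; simp [a.comm, Functor.map_neg]⟩⟩
instance (P Q : Equivariantization h) : Sub (P ⟶ Q) :=
  ⟨fun a b => ⟨a.f - b.f, fun g => by
    have := h.additive g; simp [a.comm, b.comm, Functor.map_sub]⟩⟩
instance (P Q : Equivariantization h) : SMul k (P ⟶ Q) :=
  ⟨fun c a => ⟨c • a.f, fun g => by
    have := h.additive g; have := h.linear g; simp [a.comm, Functor.map_smul]⟩⟩
instance (P Q : Equivariantization h) : SMul ℕ (P ⟶ Q) :=
  ⟨fun c a => ⟨c • a.f, fun g => by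
    have := h.additive g; simp [a.comm]⟩⟩
instance (P Q : Equivariantization h) : SMul ℤ (P ⟶ Q) :=
  ⟨fun c a => ⟨c • a.f, fun g => by
    have := h.additive g; simp [a.comm]⟩⟩

theorem f_injective (P Q : Equivariantization h) :
    Function.Injective (fun a : P ⟶ Q => a.f) := fun _ _ e => hom_ext e

instance (P Q : Equivariantization h) : AddCommGroup (P ⟶ Q) :=
  (f_injective P Q).addCommGroup _ rfl (fun _ _ => rfl) (fun _ => rfl) (fun _ _ => rfl)
    (fun _ _ => rfl) (fun _ _ => rfl)

@[simp] theorem add_f {P Q : Equivariantization h} (a b : P ⟶ Q) : (a + b).f = a.f + b.f := rfl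
@[simp] theorem smul_f {P Q : Equivariantization h} (c : k) (a : P ⟶ Q) :
    (c • a).f = c • a.f := rfl

instance : Preadditive (Equivariantization h) where
  add_comp _ _ _ _ _ _ := hom_ext (by simp)
  comp_add _ _ _ _ _ _ := hom_ext (by simp)

instance : Linear k (Equivariantization h) where
  homModule P Q := (f_injective P Q).module k
    (⟨⟨fun a => a.f, rfl⟩, fun _ _ => rfl⟩ : (P ⟶ Q) →+ (P.X ⟶ Q.X)) (fun _ _ => rfl)
  smul_comp _ _ _ _ _ _ := hom_ext (Linear.smul_comp ..)
  comp_smul _ _ _ _ _ _ := hom_ext (Linear.comp_smul ..)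

/-- An isomorphism of the underlying objects which is equivariant. -/
def mkIso {P Q : Equivariantization h} (e : P.X ≅ Q.X)
    (comm : ∀ g, P.r g ≫ e.hom = (A.ρ g).map e.hom ≫ Q.r g) : P ≅ Q where
  hom := ⟨e.hom, comm⟩
  inv := ⟨e.inv, fun g => by
    rw [← cancel_epi ((A.ρ g).map e.hom), ← Category.assoc, ← comm, Category.assoc]
    simp [← Functor.map_comp_assoc]⟩
  hom_inv_id := hom_ext e.hom_inv_id
  inv_hom_id := hom_ext e.inv_hom_id

/-! ### The tensor product -/

/-- The homogeneous summands `Y_s` of an object `Y`. -/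
def part (h : IsCrossedTensorCategory k A) (Y : C) : Γ → C := (h.decomp Y).choose
def incl (h : IsCrossedTensorCategory k A) (Y : C) : ∀ s, part h Y s ⟶ Y :=
  (h.decomp Y).choose_spec.choose
def projn (h : IsCrossedTensorCategory k A) (Y : C) : ∀ s, Y ⟶ part h Y s :=
  (h.decomp Y).choose_spec.choose_spec.choose

theorem part_mem (h : IsCrossedTensorCategory k A) (Y : C) (s : Γ) : A.homog s (part h Y s) :=
  (h.decomp Y).choose_spec.choose_spec.choose_spec.1 s

theorem sum_projn_incl (h : IsCrossedTensorCategory k A) (Y : C) :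
    ∑ s, projn h Y s ≫ incl h Y s = 𝟙 Y :=
  (h.decomp Y).choose_spec.choose_spec.choose_spec.2.2.2

/-- The morphism `r̃^g : ρ^g(X ⊗ Y) → X ⊗ Y`, whose restriction to `ρ^g(X ⊗ Y_s)` is
`γ^g_{X, Y_s}` followed by `r^{s ▷ g} ⊗ r'^g`. -/
def tensorR (h : IsCrossedTensorCategory k A) {X Y : C} (r : ∀ g, (A.ρ g).obj X ⟶ X)
    (r' : ∀ g, (A.ρ g).obj Y ⟶ Y) (g : G) : (A.ρ g).obj (X ⊗ Y) ⟶ X ⊗ Y :=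
  ∑ s, (A.ρ g).map (X ◁ projn h Y s) ≫ (A.γ g s X (part h Y s) (part_mem h Y s)).hom ≫
    (r (M.lact s g) ⊗ₘ ((A.ρ g).map (incl h Y s) ≫ r' g))

theorem map_whisker_tensorR (h : IsCrossedTensorCategory k A) {X Y : C}
    (r : ∀ g, (A.ρ g).obj X ⟶ X) (r' : ∀ g, (A.ρ g).obj Y ⟶ Y) (g : G) {t : Γ} {Z : C}
    (hZ : A.homog t Z) (f : Z ⟶ Y) :
    (A.ρ g).map (X ◁ f) ≫ tensorR h r r' g =
      (A.γ g t X Z hZ).hom ≫ (r (M.lact t g) ⊗ₘ ((A.ρ g).map f ≫ r' g)) := by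
  have := h.additive g
  have := h.tensorCategory.monoidalPreadditive
  have key : ∀ s, s ≠ t → f ≫ projn h Y s = 0 := fun s hs =>
    h.hom_zero t s _ _ hZ (part_mem h Y s) (Ne.symm hs) _
  have hf : f = (f ≫ projn h Y t) ≫ incl h Y t := by
    conv_lhs => rw [← Category.comp_id f, ← sum_projn_incl h Y, Preadditive.comp_sum]
    rw [Finset.sum_eq_single t]
    · simp
    · intro s _ hs
      rw [← Category.assoc, key s hs, zero_comp]
    · simp
  rw [tensorR, Preadditive.comp_sum, Finset.sum_eq_single t]
  · rw [← Functor.map_comp_assoc, ← whiskerLeft_comp, ← id_tensorHom, ← Category.assoc,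
      h.γ_natural g t _ _ _ _ hZ (part_mem h Y t), Category.assoc, tensorHom_comp_tensorHom,
      CategoryTheory.Functor.map_id, Category.id_comp, ← Functor.map_comp_assoc, ← hf]
  · intro s _ hs
    rw [← Functor.map_comp_assoc, ← whiskerLeft_comp, key s hs]
    simp
  · simp

theorem hom_ext_parts (h : IsCrossedTensorCategory k A) {X Y Z : C} (F : C ⥤ C) [F.Additive]
    {a b : F.obj (X ⊗ Y) ⟶ Z}
    (e : ∀ (t : Γ) (W : C), A.homog t W → ∀ f : W ⟶ Y,
      F.map (X ◁ f) ≫ a = F.map (X ◁ f) ≫ b) : a = b := by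
  have := h.tensorCategory.monoidalPreadditive
  have one : ∑ s, F.map (X ◁ projn h Y s) ≫ F.map (X ◁ incl h Y s) = 𝟙 (F.obj (X ⊗ Y)) := by
    simp_rw [← Functor.map_comp, ← whiskerLeft_comp]
    rw [← Functor.map_sum, ← whiskerLeft_sum, sum_projn_incl]
    simp
  rw [← Category.id_comp a, ← Category.id_comp b, ← one, Preadditive.sum_comp,
    Preadditive.sum_comp]
  refine Finset.sum_congr rfl fun s _ => ?_
  rw [Category.assoc, Category.assoc, e s _ (part_mem h Y s)]

theorem map_mem (h : IsCrossedTensorCategory k A) (g : G) {s : Γ} {Y : C} (hY : A.homog s Y) :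
    A.homog (M.ract s g) ((A.ρ g).obj Y) := by
  rw [← h.map_homog]
  exact ⟨Y, hY, ⟨Iso.refl _⟩⟩

section

variable (h) {X Y Z : C} (r : ∀ g, (A.ρ g).obj X ⟶ X) (r' : ∀ g, (A.ρ g).obj Y ⟶ Y)
  (r'' : ∀ g, (A.ρ g).obj Z ⟶ Z)

theorem tensorR_mul
    (hr : ∀ g g', (A.ρ g).map (r g') ≫ r g = (A.ρ₂ g g').hom.app X ≫ r (g' * g))
    (hr' : ∀ g g', (A.ρ g).map (r' g') ≫ r' g = (A.ρ₂ g g').hom.app Y ≫ r' (g' * g))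
    (g g' : G) :
    (A.ρ g).map (tensorR h r r' g') ≫ tensorR h r r' g =
      (A.ρ₂ g g').hom.app (X ⊗ Y) ≫ tensorR h r r' (g' * g) := by
  have := h.additive g
  have := h.additive g'
  refine hom_ext_parts h (A.ρ g' ⋙ A.ρ g) fun t Z hZ f => ?_
  have hY' := map_mem h g' hZ
  have rhs : (A.ρ g' ⋙ A.ρ g).map (X ◁ f) ≫ (A.ρ₂ g g').hom.app (X ⊗ Y) ≫
      tensorR h r r' (g' * g) = (A.ρ₂ g g').hom.app (X ⊗ Z) ≫
        (A.γ (g' * g) t X Z hZ).hom ≫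
          (r (M.lact t (g' * g)) ⊗ₘ ((A.ρ (g' * g)).map f ≫ r' (g' * g))) := by
    rw [NatTrans.naturality_assoc, map_whisker_tensorR h r r' _ hZ f]
  have split : (r (M.lact t g') ⊗ₘ ((A.ρ g').map f ≫ r' g')) =
      (r (M.lact t g') ▷ _) ≫ (X ◁ ((A.ρ g').map f ≫ r' g')) :=
    MonoidalCategory.tensorHom_def _ _
  have lhs : (A.ρ g' ⋙ A.ρ g).map (X ◁ f) ≫ (A.ρ g).map (tensorR h r r' g') ≫
      tensorR h r r' g = (A.ρ g).map (A.γ g' t X Z hZ).hom ≫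
        (A.γ g (M.ract t g') _ _ hY').hom ≫
          (((A.ρ _).map (r (M.lact t g')) ≫ r (M.lact (M.ract t g') g)) ⊗ₘ
            ((A.ρ g).map ((A.ρ g').map f) ≫ (A.ρ g).map (r' g') ≫ r' g)) := by
    rw [Functor.comp_map, ← Functor.map_comp_assoc, map_whisker_tensorR h r r' _ hZ f, split,
      Functor.map_comp, Functor.map_comp, Category.assoc, Category.assoc,
      map_whisker_tensorR h r r' g hY', ← tensorHom_id, ← Category.assoc ((A.ρ g).map (_ ⊗ₘ _)),
      h.γ_natural g _ _ _ _ _ hY' hY', Category.assoc, tensorHom_comp_tensorHom,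
      CategoryTheory.Functor.map_id, Category.id_comp, Functor.map_comp, Category.assoc]
  rw [lhs, rhs, ← Category.assoc ((A.ρ₂ g g').hom.app (X ⊗ Z)), h.γ_ρ₂ g g' t X Z hZ hY',
    hr, hr']
  simp only [Category.assoc, tensorHom_comp_tensorHom]
  rw [CrossedActionData.cast_comp, ← NatTrans.naturality_assoc, Functor.comp_map]

theorem tensorR_one (hr : A.ρ₀.hom.app X ≫ r 1 = 𝟙 X) (hr' : A.ρ₀.hom.app Y ≫ r' 1 = 𝟙 Y) :
    A.ρ₀.hom.app (X ⊗ Y) ≫ tensorR h r r' 1 = 𝟙 (X ⊗ Y) := by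
  have e : ∀ (t : Γ) (Z : C), A.homog t Z → ∀ f : Z ⟶ Y,
      (X ◁ f) ≫ A.ρ₀.hom.app (X ⊗ Y) ≫ tensorR h r r' 1 = (X ◁ f) ≫ 𝟙 (X ⊗ Y) := by
    intro t Z hZ f
    have n1 := A.ρ₀.hom.naturality_assoc (X ◁ f) (tensorR h r r' 1)
    have n2 := A.ρ₀.hom.naturality_assoc f (r' 1)
    simp only [Functor.id_map, Functor.id_obj] at n1 n2
    have e : (r (M.lact t 1) ⊗ₘ ((A.ρ 1).map f ≫ r' 1)) =
        (A.cast (M.lact_one t) X ⊗ₘ 𝟙 _) ≫ (r 1 ⊗ₘ ((A.ρ 1).map f ≫ r' 1)) := by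
      rw [tensorHom_comp_tensorHom, CrossedActionData.cast_comp, Category.id_comp]
    have g1 := h.γ_ρ₀ t X Z hZ
    simp only [Functor.id_obj] at g1 hr hr'
    rw [n1, map_whisker_tensorR h r r' 1 hZ f, e]
    have e2 := congrArg (· ≫ (r 1 ⊗ₘ ((A.ρ 1).map f ≫ r' 1))) g1
    simp only [Category.assoc] at e2
    rw [e2, tensorHom_comp_tensorHom, hr, ← n2, hr', Category.comp_id, Category.comp_id,
      id_tensorHom]
  exact hom_ext_parts h (𝟭 C) e

theorem tensorR_natural {X' Y' : C} (q : ∀ g, (A.ρ g).obj X' ⟶ X')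
    (q' : ∀ g, (A.ρ g).obj Y' ⟶ Y') (a : X ⟶ X') (b : Y ⟶ Y')
    (ha : ∀ g, r g ≫ a = (A.ρ g).map a ≫ q g) (hb : ∀ g, r' g ≫ b = (A.ρ g).map b ≫ q' g)
    (g : G) : tensorR h r r' g ≫ (a ⊗ₘ b) = (A.ρ g).map (a ⊗ₘ b) ≫ tensorR h q q' g := by
  have := h.additive g
  refine hom_ext_parts h (A.ρ g) fun t Z hZ f => ?_
  have e : (X ◁ f) ≫ (a ⊗ₘ b) = (a ▷ Z) ≫ (X' ◁ (f ≫ b)) := by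
    rw [MonoidalCategory.tensorHom_def, whisker_exchange_assoc, whiskerLeft_comp]
  rw [← Category.assoc, map_whisker_tensorR h r r' g hZ f, Category.assoc,
    tensorHom_comp_tensorHom, ha, Category.assoc, hb, ← Functor.map_comp_assoc, ← Functor.map_comp_assoc (A.ρ g) (X ◁ f), e,
    Functor.map_comp _ (a ▷ Z), Category.assoc, map_whisker_tensorR h q q' g hZ, ← tensorHom_id,
    ← Category.assoc ((A.ρ g).map (a ⊗ₘ 𝟙 Z)), h.γ_natural g t _ _ _ _ hZ hZ, Category.assoc,
    tensorHom_comp_tensorHom,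
    CategoryTheory.Functor.map_id, Category.id_comp, Functor.map_comp, Category.assoc]

theorem hom_ext_parts₂ (h : IsCrossedTensorCategory k A) {X Y Z T : C} (F : C ⥤ C) [F.Additive]
    {a b : F.obj ((X ⊗ Y) ⊗ Z) ⟶ T}
    (e : ∀ (s t : Γ) (V W : C), A.homog s V → A.homog t W → ∀ (f' : V ⟶ Y) (f : W ⟶ Z),
      F.map ((X ◁ f') ⊗ₘ f) ≫ a = F.map ((X ◁ f') ⊗ₘ f) ≫ b) : a = b := by
  have := h.tensorCategory.monoidalPreadditive
  refine hom_ext_parts h F fun t W hW f => ?_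
  have : (tensorRight W).Additive := {}
  refine hom_ext_parts h (tensorRight W ⋙ F) fun s V hV f' => ?_
  have e' := e s t V W hV hW f' f
  rw [MonoidalCategory.tensorHom_def, Functor.map_comp, Category.assoc, Category.assoc] at e'
  exact e'

theorem tensorR_assoc (g : G) :
    tensorR h (tensorR h r r') r'' g ≫ (α_ X Y Z).hom =
      (A.ρ g).map (α_ X Y Z).hom ≫ tensorR h r (tensorR h r' r'') g := by
  have := h.additive g
  refine hom_ext_parts₂ h (A.ρ g) fun s t V W hV hW f' f => ?_
  have eL : ((X ◁ f') ⊗ₘ f) = ((X ◁ f') ▷ W) ≫ ((X ⊗ Y) ◁ f) :=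
    MonoidalCategory.tensorHom_def _ _
  have eR : ((X ◁ f') ⊗ₘ f) ≫ (α_ X Y Z).hom =
      (α_ X V W).hom ≫ (X ◁ (f' ⊗ₘ f)) := by
    rw [← id_tensorHom, ← id_tensorHom, associator_naturality]
  have e3 : (f' ⊗ₘ f) = (f' ▷ W) ≫ (Y ◁ f) := MonoidalCategory.tensorHom_def _ _
  have hVW := h.tensor_mem s t V W hV hW
  have rhs : (A.ρ g).map ((X ◁ f') ⊗ₘ f) ≫ (A.ρ g).map (α_ X Y Z).hom ≫
      tensorR h r (tensorR h r' r'') g = (A.ρ g).map (α_ X V W).hom ≫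
      (A.γ g (s * t) X (V ⊗ W) hVW).hom ≫ (r (M.lact (s * t) g) ⊗ₘ
        ((A.γ g t V W hW).hom ≫ (((A.ρ (M.lact t g)).map f' ≫ r' (M.lact t g)) ⊗ₘ
          ((A.ρ g).map f ≫ r'' g)))) := by
    rw [← Functor.map_comp_assoc, eR, Functor.map_comp, Category.assoc,
      map_whisker_tensorR h _ _ g hVW (f' ⊗ₘ f)]
    congr 3
    rw [e3, Functor.map_comp, Category.assoc, map_whisker_tensorR h _ _ g hW f,
      ← tensorHom_id, ← Category.assoc, h.γ_natural g t _ _ _ _ hW hW, Category.assoc,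
      tensorHom_comp_tensorHom, CategoryTheory.Functor.map_id, Category.id_comp]
  have lhs : (A.ρ g).map ((X ◁ f') ⊗ₘ f) ≫ tensorR h (tensorR h r r') r'' g =
      (A.γ g t (X ⊗ V) W hW).hom ≫ (((A.γ (M.lact t g) s X V hV).hom ≫
        (r (M.lact s (M.lact t g)) ⊗ₘ ((A.ρ (M.lact t g)).map f' ≫ r' (M.lact t g)))) ⊗ₘ
          ((A.ρ g).map f ≫ r'' g)) := by
    rw [eL, Functor.map_comp, Category.assoc, map_whisker_tensorR h _ _ g hW f,
      ← tensorHom_id, ← Category.assoc, h.γ_natural g t _ _ _ _ hW hW, Category.assoc,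
      tensorHom_comp_tensorHom, CategoryTheory.Functor.map_id, Category.id_comp,
      map_whisker_tensorR h _ _ (M.lact t g) hV f']
  have e4 : (((A.γ (M.lact t g) s X V hV).hom ≫
        (r (M.lact s (M.lact t g)) ⊗ₘ ((A.ρ (M.lact t g)).map f' ≫ r' (M.lact t g)))) ⊗ₘ
          ((A.ρ g).map f ≫ r'' g)) = ((A.γ (M.lact t g) s X V hV).hom ▷ (A.ρ g).obj W) ≫
      ((r (M.lact s (M.lact t g)) ⊗ₘ ((A.ρ (M.lact t g)).map f' ≫ r' (M.lact t g))) ⊗ₘ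
          ((A.ρ g).map f ≫ r'' g)) := by
    rw [← tensorHom_id, tensorHom_comp_tensorHom, Category.id_comp]
  have er : r (M.lact (s * t) g) =
      A.cast (M.mul_lact s t g) X ≫ r (M.lact s (M.lact t g)) := (CrossedActionData.cast_comp r _).symm
  have hγ := congrArg (· ≫ (r (M.lact s (M.lact t g)) ⊗ₘ
    (((A.ρ (M.lact t g)).map f' ≫ r' (M.lact t g)) ⊗ₘ ((A.ρ g).map f ≫ r'' g))))
    (h.γ_assoc g s t X V W hV hW)
  simp only [Category.assoc, tensorHom_comp_tensorHom] at hγ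
  rw [rhs, ← Category.assoc, lhs, er, ← hγ, e4]
  simp only [Category.assoc]
  rw [associator_naturality]

theorem tensorR_leftUnitor (g : G) :
    tensorR h (fun g => (A.γ₀ g).hom) r g ≫ (λ_ X).hom = (A.ρ g).map (λ_ X).hom ≫ r g := by
  have := h.additive g
  refine hom_ext_parts h (A.ρ g) fun t Z hZ f => ?_
  have e1 : (𝟙_ C ◁ f) ≫ (λ_ X).hom = (λ_ Z).hom ≫ f := leftUnitor_naturality f
  rw [← Category.assoc, map_whisker_tensorR h _ _ g hZ f, ← Functor.map_comp_assoc, e1,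
    Functor.map_comp, ← h.γ_unit_left g t Z hZ, MonoidalCategory.tensorHom_def]
  simp only [Category.assoc]
  rw [leftUnitor_naturality]

theorem tensorR_rightUnitor (g : G) :
    tensorR h r (fun g => (A.γ₀ g).hom) g ≫ (ρ_ X).hom = (A.ρ g).map (ρ_ X).hom ≫ r g := by
  have e := map_whisker_tensorR h r (fun g => (A.γ₀ g).hom) g h.unit_mem (𝟙 (𝟙_ C))
  rw [whiskerLeft_id, CategoryTheory.Functor.map_id, CategoryTheory.Functor.map_id,
    Category.id_comp, Category.id_comp] at e
  have er : r (M.lact 1 g) = A.cast (M.one_lact g) X ≫ r g := (CrossedActionData.cast_comp r _).symm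
  have e5 : ((A.cast (M.one_lact g) X ≫ r g) ⊗ₘ (A.γ₀ g).hom) =
      (A.cast (M.one_lact g) X ⊗ₘ (A.γ₀ g).hom) ≫ (r g ▷ 𝟙_ C) := by
    rw [← tensorHom_id, tensorHom_comp_tensorHom, Category.comp_id]
  rw [e, ← h.γ_unit_right, er, e5]
  simp only [Category.assoc]
  rw [rightUnitor_naturality]

end

/-- The tensor product `(X, r) ⊗ (Y, r') = (X ⊗ Y, r̃)`. -/
def tensor (P Q : Equivariantization h) : Equivariantization h where
  X := P.X ⊗ Q.X
  r := tensorR h P.r Q.r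
  isIso := CrossedActionData.isIso_of_relations _ _ (tensorR_mul h P.r Q.r P.r_mul Q.r_mul)
    (tensorR_one h P.r Q.r P.r_one Q.r_one)
  r_mul := tensorR_mul h P.r Q.r P.r_mul Q.r_mul
  r_one := tensorR_one h P.r Q.r P.r_one Q.r_one

/-- The unit object `(𝟙, γ₀)`. -/
def unit (h : IsCrossedTensorCategory k A) : Equivariantization h where
  X := 𝟙_ C
  r g := (A.γ₀ g).hom
  isIso _ := inferInstance
  r_mul g g' := (h.γ₀_ρ₂ g g').symm
  r_one := h.γ₀_ρ₀

/-- The monoidal category `C^{(G, Γ)}`; its associativity and unit constraints are those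
of `C`. -/
instance : MonoidalCategoryStruct (Equivariantization h) where
  tensorObj := tensor
  whiskerLeft P _ _ b := ⟨P.X ◁ b.f, fun g => by
    have := tensorR_natural h P.r _ P.r _ (𝟙 P.X) b.f (fun g => by simp) b.comm g
    rwa [id_tensorHom] at this⟩
  whiskerRight a Q := ⟨a.f ▷ Q.X, fun g => by
    have := tensorR_natural h _ Q.r _ Q.r a.f (𝟙 Q.X) a.comm (fun g => by simp) g
    rwa [tensorHom_id] at this⟩
  tensorHom a b := ⟨a.f ⊗ₘ b.f, tensorR_natural h _ _ _ _ a.f b.f a.comm b.comm⟩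
  tensorUnit := unit h
  associator P Q R := mkIso (α_ P.X Q.X R.X) (tensorR_assoc h P.r Q.r R.r)
  leftUnitor P := mkIso (λ_ P.X) (tensorR_leftUnitor h P.r)
  rightUnitor P := mkIso (ρ_ P.X) (tensorR_rightUnitor h P.r)

instance : MonoidalCategory (Equivariantization h) where
  tensorHom_def a b := hom_ext (MonoidalCategory.tensorHom_def a.f b.f)
  id_tensorHom_id P Q := hom_ext (id_tensorHom_id P.X Q.X)
  tensorHom_comp_tensorHom a b c d := hom_ext (tensorHom_comp_tensorHom a.f b.f c.f d.f)
  whiskerLeft_id P Q := hom_ext (whiskerLeft_id P.X Q.X)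
  id_whiskerRight P Q := hom_ext (id_whiskerRight P.X Q.X)
  associator_naturality a b c := hom_ext (associator_naturality a.f b.f c.f)
  leftUnitor_naturality a := hom_ext (leftUnitor_naturality a.f)
  rightUnitor_naturality a := hom_ext (rightUnitor_naturality a.f)
  pentagon P Q R S := hom_ext (MonoidalCategory.pentagon P.X Q.X R.X S.X)
  triangle P Q := hom_ext (MonoidalCategory.triangle P.X Q.X)

end Equivariantization

end Equivariantization

/-! ## Abelian extensions of Hopf algebras -/

/-- A compatible pair of normalized 2-cocycles `σ : G × G → (kˣ)^Γ`, `τ : Γ × Γ → (kˣ)^G`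
for a matched pair; `σ g h s` is `σ_s(g, h)` and `τ s t g` is `τ_g(s, t)`. -/
structure CocyclePair (k : Type u) [Field k] {G : Type v} {Γ : Type w} [Group G] [Group Γ]
    (M : MatchedPair G Γ) where
  σ : G → G → Γ → kˣ
  τ : Γ → Γ → G → kˣ
  σ_cocycle : ∀ s g h l, σ h l (M.ract s g) * σ g (h * l) s = σ g h s * σ (g * h) l s
  σ_one_left : ∀ s g, σ 1 g s = 1
  σ_one_right : ∀ s g, σ g 1 s = 1
  τ_cocycle : ∀ g s t u, τ (s * t) u g * τ s t (M.lact u g) = τ t u g * τ s (t * u) g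
  τ_one_left : ∀ g s, τ 1 s g = 1
  τ_one_right : ∀ g s, τ s 1 g = 1
  compat : ∀ s t g h, σ g h (s * t) * τ s t (g * h) =
    σ (M.lact t g) (M.lact (M.ract t g) h) s * σ g h t * τ s t g *
      τ (M.ract s (M.lact t g)) (M.ract t g) h
  σ_one : ∀ g h, σ g h 1 = 1
  τ_one : ∀ s t, τ s t 1 = 1

section AbelianExtension

variable {k : Type u} [Field k] {G : Type v} {Γ : Type w} [Group G] [Group Γ] {M : MatchedPair G Γ}

/-- The abelian extension `H = k^Γ ^τ#_σ kG`: the vector space `k^Γ ⊗ kG`, with basis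
`e_s # g` for `s ∈ Γ`, `g ∈ G`. -/
def AbelianExtension (_ : CocyclePair k M) : Type (max u v w) := (Γ × G) →₀ k

namespace AbelianExtension

variable (c : CocyclePair k M)

instance : AddCommGroup (AbelianExtension c) := inferInstanceAs (AddCommGroup ((Γ × G) →₀ k))
instance : Module k (AbelianExtension c) := inferInstanceAs (Module k ((Γ × G) →₀ k))

/-- The basis `e_s # g`. -/
def basis : Module.Basis (Γ × G) k (AbelianExtension c) := Finsupp.basisSingleOne

/-- The basis element `e_s # g`. -/
def e (s : Γ) (g : G) : AbelianExtension c := basis c (s, g)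

open Classical in
/-- `(e_s # g)(e_t # h) = δ_{s ◁ g, t} σ_s(g, h) e_s # gh` -/
def mulLin : AbelianExtension c →ₗ[k] AbelianExtension c →ₗ[k] AbelianExtension c :=
  (basis c).constr k fun p => (basis c).constr k fun q =>
    if M.ract p.1 p.2 = q.1 then (c.σ p.2 q.2 p.1 : k) • e c p.1 (p.2 * q.2) else 0

instance : Mul (AbelianExtension c) := ⟨fun a b => mulLin c a b⟩

theorem mul_def (a b : AbelianExtension c) : a * b = mulLin c a b := rfl

open Classical in
theorem e_mul_e (s t : Γ) (g h : G) : e c s g * e c t h =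
    if M.ract s g = t then (c.σ g h s : k) • e c s (g * h) else 0 := by
  rw [mul_def, mulLin, e, e, Module.Basis.constr_basis, Module.Basis.constr_basis]

theorem e_mul_e_self (s : Γ) (g h : G) : e c s g * e c (M.ract s g) h =
    (c.σ g h s : k) • e c s (g * h) := by
  rw [e_mul_e, if_pos rfl]

theorem e_mul_e_ne {s t : Γ} {g : G} (h : G) (hne : M.ract s g ≠ t) :
    e c s g * e c t h = 0 := by
  rw [e_mul_e, if_neg hne]

variable {c} in
theorem ind {P : AbelianExtension c → Prop} (h0 : P 0) (hadd : ∀ a b, P a → P b → P (a + b))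
    (hsmul : ∀ (x : k) a, P a → P (x • a)) (he : ∀ s g, P (e c s g)) (a) : P a := by
  have ha : a ∈ Submodule.span k (Set.range (basis c)) := by
    rw [(basis c).span_eq]; trivial
  refine Submodule.span_induction (p := fun a _ => P a) ?_ h0 (fun a b _ _ => hadd a b)
    (fun x a _ => hsmul x a) ha
  rintro _ ⟨⟨s, g⟩, rfl⟩
  exact he s g

variable {c}

theorem add_mul' (a b d : AbelianExtension c) : (a + b) * d = a * d + b * d := by
  simp [mul_def]
theorem mul_add' (a b d : AbelianExtension c) : a * (b + d) = a * b + a * d := by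
  simp [mul_def]
theorem smul_mul' (x : k) (a b : AbelianExtension c) : (x • a) * b = x • (a * b) := by
  simp [mul_def]
theorem mul_smul' (x : k) (a b : AbelianExtension c) : a * (x • b) = x • (a * b) := by
  simp [mul_def]
theorem zero_mul' (a : AbelianExtension c) : 0 * a = 0 := by simp [mul_def]
theorem mul_zero' (a : AbelianExtension c) : a * 0 = 0 := by simp [mul_def]

theorem mul_assoc' (a b d : AbelianExtension c) : a * b * d = a * (b * d) := by
  induction a using ind with
  | h0 => simp only [zero_mul']
  | hadd a a' h h' => simp only [add_mul', h, h']
  | hsmul x a h => simp only [smul_mul', h]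
  | he s g =>
  induction b using ind with
  | h0 => simp only [zero_mul', mul_zero']
  | hadd a a' h h' => simp only [add_mul', mul_add', h, h']
  | hsmul x a h => simp only [smul_mul', mul_smul', h]
  | he t g' =>
  induction d using ind with
  | h0 => simp only [mul_zero']
  | hadd a a' h h' => simp only [mul_add', h, h']
  | hsmul x a h => simp only [mul_smul', h]
  | he u g'' =>
  by_cases h1 : M.ract s g = t
  · subst h1
    rw [e_mul_e_self, smul_mul']
    by_cases h2 : M.ract (M.ract s g) g' = u
    · subst h2
      rw [e_mul_e_self, ← M.ract_mul, e_mul_e_self, mul_smul', e_mul_e_self, smul_smul, smul_smul,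
        mul_assoc]
      congr 1
      exact_mod_cast (c.σ_cocycle s g g' g'').symm
    · rw [e_mul_e_ne c g'' h2, mul_zero', e_mul_e_ne c g'' (by rwa [M.ract_mul]), smul_zero]
  · rw [e_mul_e_ne c g' h1, zero_mul']
    by_cases h2 : M.ract t g' = u
    · subst h2
      rw [e_mul_e_self, mul_smul', e_mul_e_ne c _ h1, smul_zero]
    · rw [e_mul_e_ne c g'' h2, mul_zero']

variable (c)

theorem lact_inv (s : Γ) (g : G) : M.lact s (M.lact s⁻¹ g) = g := by
  rw [← M.mul_lact, mul_inv_cancel, M.one_lact]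

theorem inv_ract (s : Γ) (g : G) : M.ract s⁻¹ (M.lact s g) = (M.ract s g)⁻¹ := by
  have h := M.mul_ract s⁻¹ s g
  rw [inv_mul_cancel, M.one_ract] at h
  exact eq_inv_of_mul_eq_one_left h.symm

theorem inv_ract_inv (s : Γ) (g : G) : M.ract (M.ract s g)⁻¹ (M.lact s g)⁻¹ = s⁻¹ := by
  rw [← inv_ract, ← M.ract_mul, mul_inv_cancel, M.ract_one]

theorem σ_inv (s : Γ) (g : G) : c.σ g⁻¹ g (M.ract s g) = c.σ g g⁻¹ s := by
  have h := c.σ_cocycle s g g⁻¹ g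
  rwa [inv_mul_cancel, mul_inv_cancel, c.σ_one_right, c.σ_one_left, mul_one, mul_one] at h

theorem τ_inv (s : Γ) (g : G) : c.τ s s⁻¹ (M.lact s g) = c.τ s⁻¹ s g := by
  have h := c.τ_cocycle g s s⁻¹ s
  rwa [inv_mul_cancel, mul_inv_cancel, c.τ_one_right, c.τ_one_left, mul_one, one_mul] at h

variable {c}

variable [Fintype Γ]

instance : One (AbelianExtension c) := ⟨∑ s, e c s 1⟩

theorem one_def : (1 : AbelianExtension c) = ∑ s, e c s 1 := rfl

theorem one_mul' (a : AbelianExtension c) : 1 * a = a := by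
  induction a using ind with
  | h0 => simp only [mul_zero']
  | hadd a a' h h' => simp only [mul_add', h, h']
  | hsmul x a h => simp only [mul_smul', h]
  | he s g =>
  have : (∑ t, e c t 1) * e c s g = ∑ t, e c t 1 * e c s g := by simp [mul_def]
  rw [one_def, this, Finset.sum_eq_single s]
  · conv_lhs => rw [← M.ract_one s]
    rw [e_mul_e, if_pos (by simp [M.ract_one])]
    simp [c.σ_one_left, M.ract_one]
  · intro t _ ht
    exact e_mul_e_ne c g (by rwa [M.ract_one])
  · simp

theorem mul_one' (a : AbelianExtension c) : a * 1 = a := by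
  induction a using ind with
  | h0 => simp only [zero_mul']
  | hadd a a' h h' => simp only [add_mul', h, h']
  | hsmul x a h => simp only [smul_mul', h]
  | he s g =>
  have : e c s g * (∑ t, e c t 1) = ∑ t, e c s g * e c t 1 := by simp [mul_def]
  rw [one_def, this, Finset.sum_eq_single (M.ract s g)]
  · simp [e_mul_e_self, c.σ_one_right]
  · intro t _ ht
    exact e_mul_e_ne c 1 (Ne.symm ht)
  · simp

instance : Ring (AbelianExtension c) :=
  { (inferInstance : AddCommGroup (AbelianExtension c)),
    (inferInstance : Mul (AbelianExtension c)), (inferInstance : One (AbelianExtension c)) with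
    left_distrib := mul_add'
    right_distrib := add_mul'
    zero_mul := zero_mul'
    mul_zero := mul_zero'
    mul_assoc := mul_assoc'
    one_mul := one_mul'
    mul_one := mul_one' }

instance : Algebra k (AbelianExtension c) := Algebra.ofModule smul_mul' mul_smul'

variable (c)

/-- `Δ(e_s # g) = ∑_{tu = s} τ_g(t, u) e_t # (u ▷ g) ⊗ e_u # g` -/
def comulLin : AbelianExtension c →ₗ[k] AbelianExtension c ⊗[k] AbelianExtension c :=
  (basis c).constr k fun p => ∑ t, (c.τ t (t⁻¹ * p.1) p.2 : k) •
    (e c t (M.lact (t⁻¹ * p.1) p.2) ⊗ₜ[k] e c (t⁻¹ * p.1) p.2)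

open Classical in
/-- `ε(e_s # g) = δ_{s, e}` -/
def counitLin : AbelianExtension c →ₗ[k] k :=
  (basis c).constr k fun p => if p.1 = 1 then 1 else 0

/-- `S(e_s # g) = (τ_g(s⁻¹, s) σ_{s⁻¹}(s ▷ g, (s ▷ g)⁻¹))⁻¹ e_{(s ◁ g)⁻¹} # (s ▷ g)⁻¹` -/
def antipodeLin : AbelianExtension c →ₗ[k] AbelianExtension c :=
  (basis c).constr k fun p =>
    (((c.τ p.1⁻¹ p.1 p.2 * c.σ (M.lact p.1 p.2) (M.lact p.1 p.2)⁻¹ p.1⁻¹)⁻¹ : kˣ) : k) •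
      e c (M.ract p.1 p.2)⁻¹ (M.lact p.1 p.2)⁻¹

theorem comulLin_e (s : Γ) (g : G) : comulLin c (e c s g) =
    ∑ t, (c.τ t (t⁻¹ * s) g : k) • (e c t (M.lact (t⁻¹ * s) g) ⊗ₜ[k] e c (t⁻¹ * s) g) := by
  rw [comulLin, e, Module.Basis.constr_basis]

open Classical in
theorem counitLin_e (s : Γ) (g : G) : counitLin c (e c s g) = if s = 1 then 1 else 0 := by
  rw [counitLin, e, Module.Basis.constr_basis]

theorem antipodeLin_e (s : Γ) (g : G) : antipodeLin c (e c s g) =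
    (((c.τ s⁻¹ s g * c.σ (M.lact s g) (M.lact s g)⁻¹ s⁻¹)⁻¹ : kˣ) : k) •
      e c (M.ract s g)⁻¹ (M.lact s g)⁻¹ := by
  rw [antipodeLin, e, Module.Basis.constr_basis]

theorem lin_ext {N : Type*} [AddCommMonoid N] [Module k N] {f f' : AbelianExtension c →ₗ[k] N}
    (he : ∀ s g, f (e c s g) = f' (e c s g)) : f = f' :=
  (basis c).ext fun p => he p.1 p.2

instance : Coalgebra k (AbelianExtension c) where
  comul := comulLin c
  counit := counitLin c
  coassoc := lin_ext c fun s g => by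
    simp only [LinearMap.comp_apply, LinearEquiv.coe_coe, comulLin_e, map_sum, map_smul,
      LinearMap.rTensor_tmul, LinearMap.lTensor_tmul, TensorProduct.sum_tmul,
      TensorProduct.tmul_sum, TensorProduct.smul_tmul',
      TensorProduct.assoc_tmul, Finset.smul_sum, smul_smul]
    conv_lhs => rw [Finset.sum_comm]
    refine Finset.sum_congr rfl fun t _ => ?_
    rw [← Equiv.sum_comp (Equiv.mulLeft t)]
    refine Finset.sum_congr rfl fun u _ => ?_
    have h1 : (Equiv.mulLeft t u)⁻¹ * s = u⁻¹ * (t⁻¹ * s) := by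
      simp [mul_assoc]
    have h2 : t⁻¹ * Equiv.mulLeft t u = u := by simp
    rw [h1, h2, ← M.mul_lact, mul_inv_cancel_left]
    simp only [← TensorProduct.smul_tmul', TensorProduct.tmul_smul, smul_smul]
    congr 1
    have := c.τ_cocycle g t u (u⁻¹ * (t⁻¹ * s))
    rw [mul_inv_cancel_left] at this
    rw [Equiv.coe_mulLeft]
    exact_mod_cast this
  rTensor_counit_comp_comul := lin_ext c fun s g => by
    simp only [LinearMap.comp_apply, comulLin_e, map_sum, map_smul, LinearMap.rTensor_tmul,
      counitLin_e, TensorProduct.mk_apply]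
    rw [Finset.sum_eq_single 1]
    · simp [c.τ_one_left]
    · intro t _ ht
      simp [ht]
    · simp
  lTensor_counit_comp_comul := lin_ext c fun s g => by
    simp only [LinearMap.comp_apply, comulLin_e, map_sum, map_smul, LinearMap.lTensor_tmul,
      counitLin_e, TensorProduct.mk_apply, LinearMap.flip_apply]
    rw [Finset.sum_eq_single s]
    · simp [c.τ_one_right, M.one_lact]
    · intro t _ ht
      rw [if_neg (by rwa [inv_mul_eq_one]), TensorProduct.tmul_zero, smul_zero]
    · simp

theorem comul_e (s : Γ) (g : G) : Coalgebra.comul (R := k) (e c s g) =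
    ∑ t, (c.τ t (t⁻¹ * s) g : k) • (e c t (M.lact (t⁻¹ * s) g) ⊗ₜ[k] e c (t⁻¹ * s) g) :=
  comulLin_e c s g

open Classical in
theorem counit_e (s : Γ) (g : G) :
    Coalgebra.counit (R := k) (e c s g) = if s = 1 then 1 else 0 := counitLin_e c s g

theorem comul_mul' (a b : AbelianExtension c) :
    Coalgebra.comul (R := k) (a * b) = Coalgebra.comul (R := k) a * Coalgebra.comul (R := k) b := by
  induction a using ind with
  | h0 => simp
  | hadd a a' h h' => rw [add_mul, map_add, map_add, add_mul, h, h']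
  | hsmul x a h => rw [smul_mul_assoc, map_smul, map_smul, smul_mul_assoc, h]
  | he s g =>
  induction b using ind with
  | h0 => simp
  | hadd a a' h h' => rw [mul_add, map_add, map_add, mul_add, h, h']
  | hsmul x a h => rw [mul_smul_comm, map_smul, map_smul, mul_smul_comm, h]
  | he t h =>
  rw [comul_e, comul_e, Finset.sum_mul_sum]
  simp only [smul_mul_smul_comm, Algebra.TensorProduct.tmul_mul_tmul]
  have hsplit : ∀ a : Γ, M.ract s g = M.ract a (M.lact (a⁻¹ * s) g) * M.ract (a⁻¹ * s) g :=
    fun a => by rw [← M.mul_ract, mul_inv_cancel_left]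
  by_cases ht : M.ract s g = t
  · subst ht
    rw [e_mul_e_self, map_smul, comul_e, Finset.smul_sum]
    refine Finset.sum_congr rfl fun a _ => ?_
    rw [Finset.sum_eq_single (M.ract a (M.lact (a⁻¹ * s) g))]
    · rw [hsplit a, inv_mul_cancel_left, e_mul_e_self, e_mul_e_self, ← M.lact_mul,
        TensorProduct.smul_tmul_smul, smul_smul, smul_smul]
      congr 1
      have := c.compat a (a⁻¹ * s) g h
      rw [mul_inv_cancel_left] at this
      norm_cast
      rw [this]
      ac_rfl
    · intro b _ hb
      rw [e_mul_e_ne c _ (Ne.symm hb), TensorProduct.zero_tmul, smul_zero]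
    · simp
  · rw [e_mul_e_ne c h ht, map_zero]
    symm
    refine Finset.sum_eq_zero fun a _ => Finset.sum_eq_zero fun b _ => ?_
    by_cases hb : M.ract a (M.lact (a⁻¹ * s) g) = b
    · subst hb
      rw [e_mul_e_ne c h, TensorProduct.tmul_zero, smul_zero]
      intro h2
      apply ht
      rw [hsplit a, h2, mul_inv_cancel_left]
    · rw [e_mul_e_ne c _ hb, TensorProduct.zero_tmul, smul_zero]

theorem counit_mul' (a b : AbelianExtension c) :
    Coalgebra.counit (R := k) (a * b) =
      Coalgebra.counit (R := k) a * Coalgebra.counit (R := k) b := by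
  induction a using ind with
  | h0 => simp
  | hadd a a' h h' => rw [add_mul, map_add, map_add, add_mul, h, h']
  | hsmul x a h => rw [smul_mul_assoc, map_smul, map_smul, smul_mul_assoc, h]
  | he s g =>
  induction b using ind with
  | h0 => simp
  | hadd a a' h h' => rw [mul_add, map_add, map_add, mul_add, h, h']
  | hsmul x a h => rw [mul_smul_comm, map_smul, map_smul, mul_smul_comm, h]
  | he t h =>
  rw [counit_e, counit_e]
  by_cases ht : M.ract s g = t
  · subst ht
    rw [e_mul_e_self, map_smul, counit_e]
    by_cases hs : s = 1
    · subst hs; simp [M.one_ract, c.σ_one]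
    · simp [hs]
  · rw [e_mul_e_ne c h ht, map_zero]
    by_cases hs : s = 1
    · subst hs
      rw [M.one_ract] at ht
      simp [Ne.symm ht]
    · simp [hs]

theorem counit_one' : Coalgebra.counit (R := k) (1 : AbelianExtension c) = 1 := by
  rw [one_def, map_sum, Finset.sum_eq_single 1]
  · simp [counit_e]
  · intro s _ hs
    simp [counit_e, hs]
  · simp

theorem comul_one' : Coalgebra.comul (R := k) (1 : AbelianExtension c) = 1 := by
  rw [Algebra.TensorProduct.one_def, one_def, map_sum, TensorProduct.sum_tmul]
  simp only [comul_e, TensorProduct.tmul_sum, c.τ_one, M.lact_one, Units.val_one, one_smul]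
  rw [Finset.sum_comm]
  refine Finset.sum_congr rfl fun t _ => ?_
  exact Equiv.sum_comp (Equiv.mulLeft t⁻¹) fun u => e c t 1 ⊗ₜ[k] e c u 1

instance : Bialgebra k (AbelianExtension c) :=
  Bialgebra.mk' k _ (counit_one' c) (counit_mul' c _ _) (comul_one' c) (comul_mul' c _ _)

/-- The Hopf algebra `k^Γ ^τ#_σ kG`. -/
instance : HopfAlgebra k (AbelianExtension c) where
  antipode := antipodeLin c
  mul_antipode_rTensor_comul := lin_ext c fun s g => by
    simp only [LinearMap.comp_apply, comul_e, map_sum, map_smul, LinearMap.rTensor_tmul,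
      LinearMap.mul'_apply, counit_e, antipodeLin_e, smul_mul_assoc, smul_smul,
      ← M.mul_lact, mul_inv_cancel_left]
    by_cases hs : s = 1
    · subst hs
      rw [if_pos rfl, Algebra.linearMap_apply, map_one, one_def]
      let φ : Γ ≃ Γ := (Equiv.inv Γ).trans
        ⟨fun s => M.ract s g, fun s => M.ract s g⁻¹,
          fun s => by simp [← M.ract_mul, M.ract_one], fun s => by simp [← M.ract_mul, M.ract_one]⟩
      rw [← Equiv.sum_comp φ (fun t => e c t 1)]
      refine Finset.sum_congr rfl fun t _ => ?_
      have h1 : (M.ract t (M.lact t⁻¹ g))⁻¹ = M.ract t⁻¹ g := by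
        rw [← inv_ract, lact_inv]
      have h2 : c.τ t⁻¹ t (M.lact t⁻¹ g) = c.τ t t⁻¹ g := by
        have := τ_inv c t⁻¹ g
        rwa [inv_inv] at this
      have h3 : e c (M.ract t⁻¹ g) g⁻¹ * e c t⁻¹ g =
          (c.σ g g⁻¹ t⁻¹ : k) • e c (M.ract t⁻¹ g) 1 := by
        have := e_mul_e_self c (M.ract t⁻¹ g) g⁻¹ g
        rwa [← M.ract_mul, mul_inv_cancel, M.ract_one, inv_mul_cancel, σ_inv] at this
      rw [mul_one, M.one_lact, h1, h2, h3, smul_smul]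
      have h4 : (c.τ t t⁻¹ g : k) * ((c.τ t t⁻¹ g * c.σ g g⁻¹ t⁻¹)⁻¹ : kˣ) *
          (c.σ g g⁻¹ t⁻¹ : k) = 1 := by
        rw [mul_right_comm, ← Units.val_mul, Units.mul_inv]
      rw [h4, one_smul]
      rfl
    · rw [if_neg hs, map_zero]
      refine Finset.sum_eq_zero fun t _ => ?_
      rw [e_mul_e_ne, smul_zero]
      have h1 := inv_ract_inv (M := M) t (M.lact (t⁻¹ * s) g)
      rw [← M.mul_lact, mul_inv_cancel_left] at h1
      rw [h1]
      intro h2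
      exact hs (by simpa using h2)
  mul_antipode_lTensor_comul := lin_ext c fun s g => by
    simp only [LinearMap.comp_apply, comul_e, map_sum, map_smul, LinearMap.lTensor_tmul,
      LinearMap.mul'_apply, counit_e, antipodeLin_e, mul_smul_comm, smul_smul]
    by_cases hs : s = 1
    · subst hs
      rw [if_pos rfl, Algebra.linearMap_apply, map_one, one_def]
      refine Finset.sum_congr rfl fun t _ => ?_
      have h1 := inv_ract (M := M) t⁻¹ g
      rw [inv_inv] at h1
      rw [mul_one, ← h1, e_mul_e_self, inv_inv, mul_inv_cancel, smul_smul]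
      have h4 : (c.τ t t⁻¹ g : k) * ((c.τ t t⁻¹ g *
          c.σ (M.lact t⁻¹ g) (M.lact t⁻¹ g)⁻¹ t)⁻¹ : kˣ) *
          (c.σ (M.lact t⁻¹ g) (M.lact t⁻¹ g)⁻¹ t : k) = 1 := by
        rw [mul_right_comm, ← Units.val_mul, Units.mul_inv]
      rw [h4, one_smul]
    · rw [if_neg hs, map_zero]
      refine Finset.sum_eq_zero fun t _ => ?_
      rw [e_mul_e_ne, smul_zero]
      rw [← inv_ract]
      intro h2
      have h3 := congrArg (fun x => M.ract x (M.lact (t⁻¹ * s) g)⁻¹) h2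
      simp only [← M.ract_mul, mul_inv_cancel, M.ract_one] at h3
      apply hs
      rw [mul_inv_rev, inv_inv] at h3
      simpa using h3

end AbelianExtension
end AbelianExtension

/-! ## Finite dimensional representations of a bialgebra -/

section FinDimRep

/-- A finite dimensional representation of the `k`-bialgebra `H`. -/
structure FinDimRep (k : Type u) [Field k] (H : Type v₁) [Ring H] [Bialgebra k H] where
  V : Type u
  [addCommGroup : AddCommGroup V]
  [module : Module k V]
  [finiteDimensional : FiniteDimensional k V]
  act : H →ₐ[k] Module.End k V

attribute [instance] FinDimRep.addCommGroup FinDimRep.module FinDimRep.finiteDimensional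

namespace FinDimRep

variable {k : Type u} [Field k] {H : Type v₁} [Ring H] [Bialgebra k H]

/-- Morphisms: the linear maps compatible with the structure. -/
@[ext]
structure Hom (P Q : FinDimRep k H) where
  f : P.V →ₗ[k] Q.V
  comm : ∀ a v, f (P.act a v) = Q.act a (f v)

instance : Category (FinDimRep k H) where
  Hom P Q := Hom P Q
  id P := ⟨LinearMap.id, fun _ _ => rfl⟩
  comp a b := ⟨b.f ∘ₗ a.f, fun x v => by simp [a.comm, b.comm]⟩

@[ext]
theorem hom_ext {P Q : FinDimRep k H} {a b : P ⟶ Q} (e : a.f = b.f) : a = b := Hom.ext e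

@[simp] theorem id_f (P : FinDimRep k H) : Hom.f (𝟙 P) = LinearMap.id := rfl
@[simp] theorem comp_f {P Q R : FinDimRep k H} (a : P ⟶ Q) (b : Q ⟶ R) :
    (a ≫ b).f = b.f ∘ₗ a.f := rfl

instance (P Q : FinDimRep k H) : Zero (P ⟶ Q) := ⟨⟨0, fun _ _ => by simp⟩⟩
instance (P Q : FinDimRep k H) : Add (P ⟶ Q) := ⟨fun a b => ⟨a.f + b.f, fun x v => by simp [a.comm, b.comm]⟩⟩
instance (P Q : FinDimRep k H) : Neg (P ⟶ Q) := ⟨fun a => ⟨-a.f, fun x v => by simp [a.comm]⟩⟩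
instance (P Q : FinDimRep k H) : Sub (P ⟶ Q) := ⟨fun a b => ⟨a.f - b.f, fun x v => by simp [a.comm, b.comm]⟩⟩
instance (P Q : FinDimRep k H) : SMul k (P ⟶ Q) := ⟨fun x a => ⟨x • a.f, fun y v => by simp [a.comm]⟩⟩
instance (P Q : FinDimRep k H) : SMul ℕ (P ⟶ Q) := ⟨fun x a => ⟨x • a.f, fun y v => by simp [a.comm]⟩⟩
instance (P Q : FinDimRep k H) : SMul ℤ (P ⟶ Q) := ⟨fun x a => ⟨x • a.f, fun y v => by simp [a.comm]⟩⟩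

theorem f_injective (P Q : FinDimRep k H) : Function.Injective (fun a : P ⟶ Q => a.f) :=
  fun _ _ e => hom_ext e

instance (P Q : FinDimRep k H) : AddCommGroup (P ⟶ Q) :=
  (f_injective P Q).addCommGroup _ rfl (fun _ _ => rfl) (fun _ => rfl) (fun _ _ => rfl)
    (fun _ _ => rfl) (fun _ _ => rfl)

@[simp] theorem zero_f (P Q : FinDimRep k H) : Hom.f (0 : P ⟶ Q) = 0 := rfl
@[simp] theorem add_f {P Q : FinDimRep k H} (a b : P ⟶ Q) : (a + b).f = a.f + b.f := rfl
@[simp] theorem smul_f {P Q : FinDimRep k H} (x : k) (a : P ⟶ Q) : (x • a).f = x • a.f := rfl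

instance : Preadditive (FinDimRep k H) where
  add_comp _ _ _ _ _ _ := hom_ext (LinearMap.comp_add _ _ _)
  comp_add _ _ _ _ _ _ := hom_ext (LinearMap.add_comp _ _ _)

instance : Linear k (FinDimRep k H) where
  homModule P Q := (f_injective P Q).module k
    (⟨⟨fun a => a.f, rfl⟩, fun _ _ => rfl⟩ : (P ⟶ Q) →+ (P.V →ₗ[k] Q.V)) (fun _ _ => rfl)
  smul_comp _ _ _ _ _ _ := hom_ext (LinearMap.comp_smul _ _ _)
  comp_smul _ _ _ _ _ _ := hom_ext (LinearMap.smul_comp _ _ _)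

/-- An isomorphism from an invertible linear map commuting with the actions. -/
def mkIso {P Q : FinDimRep k H} (f : P.V ≃ₗ[k] Q.V)
    (comm : ∀ a v, f (P.act a v) = Q.act a (f v)) : P ≅ Q where
  hom := ⟨f, comm⟩
  inv := ⟨f.symm, fun a v => by
    apply f.injective
    simp [comm]⟩
  hom_inv_id := hom_ext (by simp)
  inv_hom_id := hom_ext (by simp)

section Tensor

variable {V W U : Type u} [AddCommGroup V] [Module k V] [AddCommGroup W] [Module k W]
  [AddCommGroup U] [Module k U]

/-- The action of `H₁ ⊗ H₂` on the tensor product of a representation of `H₁` and one of `H₂`. -/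
def act₂ {H₁ H₂ : Type v₁} [Ring H₁] [Algebra k H₁] [Ring H₂] [Algebra k H₂]
    (p : H₁ →ₐ[k] Module.End k V) (q : H₂ →ₐ[k] Module.End k W) :
    H₁ ⊗[k] H₂ →ₐ[k] Module.End k (V ⊗[k] W) :=
  (Module.endTensorEndAlgHom (R := k) (S := k) (A := k)).comp (Algebra.TensorProduct.map p q)

theorem act₂_tmul (p : H →ₐ[k] Module.End k V) (q : H →ₐ[k] Module.End k W) (a b : H) :
    act₂ p q (a ⊗ₜ b) = TensorProduct.map (p a) (q b) := rfl

/-- `H` acts on `V ⊗ W` through its comultiplication. -/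
def tensorAct (p : H →ₐ[k] Module.End k V) (q : H →ₐ[k] Module.End k W) :
    H →ₐ[k] Module.End k (V ⊗[k] W) :=
  (act₂ p q).comp (Bialgebra.comulAlgHom k H)

theorem tensorAct_apply (p : H →ₐ[k] Module.End k V) (q : H →ₐ[k] Module.End k W) (a : H) :
    tensorAct p q a = act₂ p q (Coalgebra.comul a) := rfl

/-- `H` acts on `k` through its counit. -/
def unitAct (k : Type u) [Field k] (H : Type v₁) [Ring H] [Bialgebra k H] :
    H →ₐ[k] Module.End k k :=
  (Algebra.lmul k k).comp (Bialgebra.counitAlgHom k H)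

theorem unitAct_apply (a : H) (x : k) :
    unitAct k H a x = Coalgebra.counit (R := k) a * x := rfl

theorem map_tensorAct {V' W' : Type u} [AddCommGroup V'] [Module k V'] [AddCommGroup W']
    [Module k W'] (p : H →ₐ[k] Module.End k V) (q : H →ₐ[k] Module.End k W)
    (p' : H →ₐ[k] Module.End k V') (q' : H →ₐ[k] Module.End k W')
    (f : V →ₗ[k] V') (g : W →ₗ[k] W') (hf : ∀ a v, f (p a v) = p' a (f v))
    (hg : ∀ a v, g (q a v) = q' a (g v)) (a : H) (v : V ⊗[k] W) :
    TensorProduct.map f g (tensorAct p q a v) = tensorAct p' q' a (TensorProduct.map f g v) := by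
  have key : ∀ x : H ⊗[k] H, TensorProduct.map f g (act₂ p q x v) =
      act₂ p' q' x (TensorProduct.map f g v) := by
    intro x
    induction x with
    | zero => simp
    | add x y hx hy => simp [hx, hy]
    | tmul a b =>
      induction v with
      | zero => simp
      | add x y hx hy => simp [hx, hy]
      | tmul v w => simp [act₂_tmul, hf, hg]
  exact key _

theorem assoc_act (p : H →ₐ[k] Module.End k V) (q : H →ₐ[k] Module.End k W)
    (r : H →ₐ[k] Module.End k U) (a : H) (v : (V ⊗[k] W) ⊗[k] U) :
    TensorProduct.assoc k V W U (tensorAct (tensorAct p q) r a v) =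
      tensorAct p (tensorAct q r) a (TensorProduct.assoc k V W U v) := by
  -- the action of `H ⊗ (H ⊗ H)`
  let A₃ : H ⊗[k] (H ⊗[k] H) →ₐ[k] Module.End k (V ⊗[k] (W ⊗[k] U)) :=
    (Module.endTensorEndAlgHom (R := k) (S := k) (A := k)).comp
      (Algebra.TensorProduct.map p (act₂ q r))
  have hR : ∀ x : H ⊗[k] H, act₂ p (tensorAct q r) x = A₃ (Coalgebra.comul.lTensor H x) := by
    intro x
    induction x with
    | zero => simp only [map_zero]
    | add x y hx hy => simp only [map_add, hx, hy]
    | tmul x y => rfl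
  have hA₃ : ∀ (y : H ⊗[k] H) (b : H) (v : (V ⊗[k] W) ⊗[k] U),
      TensorProduct.assoc k V W U (TensorProduct.map (act₂ p q y) (r b) v) =
        A₃ (TensorProduct.assoc k H H H (y ⊗ₜ b)) (TensorProduct.assoc k V W U v) := by
    intro y b v
    induction y with
    | zero => simp
    | add x y hx hy =>
      simp only [map_add, TensorProduct.map_add_left, LinearMap.add_apply, hx, hy,
        TensorProduct.add_tmul]
    | tmul x y =>
      induction v with
      | zero => simp only [map_zero]
      | add x y hx hy => simp only [map_add, hx, hy]
      | tmul v w =>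
        induction v with
        | zero => simp only [map_zero, TensorProduct.zero_tmul]
        | add x y hx hy => simp only [map_add, TensorProduct.add_tmul, hx, hy]
        | tmul u v => rfl
  have hL : ∀ (x : H ⊗[k] H) (v : (V ⊗[k] W) ⊗[k] U),
      TensorProduct.assoc k V W U (act₂ (tensorAct p q) r x v) =
        A₃ (TensorProduct.assoc k H H H (Coalgebra.comul.rTensor H x))
          (TensorProduct.assoc k V W U v) := by
    intro x v
    induction x with
    | zero => simp only [map_zero, LinearMap.zero_apply]
    | add x y hx hy => simp only [map_add, LinearMap.add_apply, hx, hy]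
    | tmul x y =>
      rw [act₂_tmul, tensorAct_apply]
      exact hA₃ _ _ _
  rw [tensorAct_apply, tensorAct_apply, hL, Coalgebra.coassoc_apply, ← hR]

theorem lid_act (p : H →ₐ[k] Module.End k V) (a : H) (v : k ⊗[k] V) :
    TensorProduct.lid k V (tensorAct (unitAct k H) p a v) = p a (TensorProduct.lid k V v) := by
  have key : ∀ (x : H ⊗[k] H), TensorProduct.lid k V (act₂ (unitAct k H) p x v) =
      p (TensorProduct.lid k H (Coalgebra.counit.rTensor H x)) (TensorProduct.lid k V v) := by
    intro x
    induction x with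
    | zero => simp
    | add x y hx hy => simp only [map_add, LinearMap.add_apply, hx, hy]
    | tmul x y =>
      induction v with
      | zero => simp
      | add x y hx hy => simp only [map_add, hx, hy]
      | tmul z v => simp [act₂_tmul, unitAct_apply, smul_smul, mul_comm]
  rw [tensorAct_apply, key, Coalgebra.rTensor_counit_comul]
  simp

theorem rid_act (p : H →ₐ[k] Module.End k V) (a : H) (v : V ⊗[k] k) :
    TensorProduct.rid k V (tensorAct p (unitAct k H) a v) = p a (TensorProduct.rid k V v) := by
  have key : ∀ (x : H ⊗[k] H), TensorProduct.rid k V (act₂ p (unitAct k H) x v) =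
      p (TensorProduct.rid k H (Coalgebra.counit.lTensor H x)) (TensorProduct.rid k V v) := by
    intro x
    induction x with
    | zero => simp
    | add x y hx hy => simp only [map_add, LinearMap.add_apply, hx, hy]
    | tmul x y =>
      induction v with
      | zero => simp
      | add x y hx hy => simp only [map_add, hx, hy]
      | tmul v z => simp [act₂_tmul, unitAct_apply, smul_smul, mul_comm]
  rw [tensorAct_apply, key, Coalgebra.lTensor_counit_comul]
  simp

end Tensor

/-- The tensor product of representations. -/
def tensor (P Q : FinDimRep k H) : FinDimRep k H where
  V := P.V ⊗[k] Q.V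
  act := tensorAct P.act Q.act

/-- The trivial representation. -/
def unit : FinDimRep k H where
  V := k
  act := unitAct k H

instance : MonoidalCategoryStruct (FinDimRep k H) where
  tensorObj := tensor
  whiskerLeft P _ _ g := ⟨TensorProduct.map LinearMap.id g.f, 
    map_tensorAct P.act _ P.act _ LinearMap.id g.f (fun _ _ => rfl) g.comm⟩
  whiskerRight f Q := ⟨TensorProduct.map f.f LinearMap.id, 
    map_tensorAct _ Q.act _ Q.act f.f LinearMap.id f.comm (fun _ _ => rfl)⟩
  tensorHom f g := ⟨TensorProduct.map f.f g.f, map_tensorAct _ _ _ _ f.f g.f f.comm g.comm⟩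
  tensorUnit := unit
  associator P Q R := mkIso (P := tensor (tensor P Q) R) (Q := tensor P (tensor Q R))
    (TensorProduct.assoc k P.V Q.V R.V) (assoc_act P.act Q.act R.act)
  leftUnitor P := mkIso (P := tensor unit P) (TensorProduct.lid k P.V) (lid_act P.act)
  rightUnitor P := mkIso (P := tensor P unit) (TensorProduct.rid k P.V) (rid_act P.act)

instance : MonoidalCategory (FinDimRep k H) where
  tensorHom_def _ _ := hom_ext (TensorProduct.ext' fun _ _ => rfl)
  id_tensorHom_id _ _ := hom_ext (TensorProduct.ext' fun _ _ => rfl)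
  tensorHom_comp_tensorHom _ _ _ _ := hom_ext (TensorProduct.ext' fun _ _ => rfl)
  whiskerLeft_id _ _ := hom_ext (TensorProduct.ext' fun _ _ => rfl)
  id_whiskerRight _ _ := hom_ext (TensorProduct.ext' fun _ _ => rfl)
  associator_naturality _ _ _ := hom_ext (TensorProduct.ext_threefold fun _ _ _ => rfl)
  leftUnitor_naturality a := hom_ext (TensorProduct.ext' fun x v => (a.f.map_smul x v).symm)
  rightUnitor_naturality a := hom_ext (TensorProduct.ext' fun v x => (a.f.map_smul x v).symm)
  pentagon _ _ _ _ := hom_ext (TensorProduct.ext_fourfold fun _ _ _ _ => rfl)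
  triangle P Q := hom_ext (TensorProduct.ext_threefold fun (v : P.V) (x : k) (w : Q.V) =>
    (TensorProduct.smul_tmul x v w).symm)

end FinDimRep

end FinDimRep

/-! ## Graded vector spaces -/

section GrVect

/-- A finite dimensional `Γ`-graded vector space over `k` (equivalently, a finite dimensional
representation of the algebra `k^Γ`): the grading `V = ⨁ V_s` is given by the projections
`proj s : V → V` onto the homogeneous components `V_s`. -/
structure GrVect (k : Type u) [Field k] (Γ : Type w) [Fintype Γ] where
  V : Type u
  [addCommGroup : AddCommGroup V]
  [module : Module k V]
  [finiteDimensional : FiniteDimensional k V]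
  proj : Γ → V →ₗ[k] V
  proj_self : ∀ s v, proj s (proj s v) = proj s v
  proj_ne : ∀ s t v, s ≠ t → proj s (proj t v) = 0
  sum_proj : ∀ v, ∑ s, proj s v = v

attribute [instance] GrVect.addCommGroup GrVect.module GrVect.finiteDimensional

namespace GrVect

section Category

variable {k : Type u} [Field k] {Γ : Type w} [Fintype Γ]

/-- The homogeneous component `V_s`. -/
def component (P : GrVect k Γ) (s : Γ) : Submodule k P.V := LinearMap.range (P.proj s)

open Classical in
/-- `V` is the direct sum of its homogeneous components. -/
theorem isInternal (P : GrVect k Γ) : DirectSum.IsInternal P.component := by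
  have hmem : ∀ s v, v ∈ P.component s → P.proj s v = v := by
    rintro s _ ⟨v, rfl⟩
    exact P.proj_self s v
  refine (DirectSum.isInternal_submodule_iff_iSupIndep_and_iSup_eq_top _).2 ⟨?_, ?_⟩
  · rw [iSupIndep_def]
    intro s
    rw [Submodule.disjoint_def]
    intro v hv hv'
    have hle : ⨆ (t) (_ : t ≠ s), P.component t ≤ LinearMap.ker (P.proj s) := by
      refine iSup₂_le fun t ht => ?_
      rintro _ ⟨w, rfl⟩
      exact P.proj_ne s t w (Ne.symm ht)
    rw [← hmem s v hv]
    exact hle hv'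
  · rw [eq_top_iff]
    intro v _
    rw [← P.sum_proj v]
    exact Submodule.sum_mem _ fun s _ => Submodule.mem_iSup_of_mem s ⟨v, rfl⟩

/-- Morphisms: the linear maps compatible with the structure. -/
@[ext]
structure Hom (P Q : GrVect k Γ) where
  f : P.V →ₗ[k] Q.V
  comm : ∀ s v, f (P.proj s v) = Q.proj s (f v)

instance : Category (GrVect k Γ) where
  Hom P Q := Hom P Q
  id P := ⟨LinearMap.id, fun _ _ => rfl⟩
  comp a b := ⟨b.f ∘ₗ a.f, fun s v => by simp [a.comm, b.comm]⟩

@[ext]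
theorem hom_ext {P Q : GrVect k Γ} {a b : P ⟶ Q} (e : a.f = b.f) : a = b := Hom.ext e

@[simp] theorem id_f (P : GrVect k Γ) : Hom.f (𝟙 P) = LinearMap.id := rfl
@[simp] theorem comp_f {P Q R : GrVect k Γ} (a : P ⟶ Q) (b : Q ⟶ R) :
    (a ≫ b).f = b.f ∘ₗ a.f := rfl

instance (P Q : GrVect k Γ) : Zero (P ⟶ Q) := ⟨⟨0, fun _ _ => by simp⟩⟩
instance (P Q : GrVect k Γ) : Add (P ⟶ Q) := ⟨fun a b => ⟨a.f + b.f, fun s v => by simp [a.comm, b.comm]⟩⟩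
instance (P Q : GrVect k Γ) : Neg (P ⟶ Q) := ⟨fun a => ⟨-a.f, fun s v => by simp [a.comm]⟩⟩
instance (P Q : GrVect k Γ) : Sub (P ⟶ Q) := ⟨fun a b => ⟨a.f - b.f, fun s v => by simp [a.comm, b.comm]⟩⟩
instance (P Q : GrVect k Γ) : SMul k (P ⟶ Q) := ⟨fun x a => ⟨x • a.f, fun s v => by simp [a.comm]⟩⟩
instance (P Q : GrVect k Γ) : SMul ℕ (P ⟶ Q) := ⟨fun x a => ⟨x • a.f, fun s v => by simp [a.comm]⟩⟩
instance (P Q : GrVect k Γ) : SMul ℤ (P ⟶ Q) := ⟨fun x a => ⟨x • a.f, fun s v => by simp [a.comm]⟩⟩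

theorem f_injective (P Q : GrVect k Γ) : Function.Injective (fun a : P ⟶ Q => a.f) :=
  fun _ _ e => hom_ext e

instance (P Q : GrVect k Γ) : AddCommGroup (P ⟶ Q) :=
  (f_injective P Q).addCommGroup _ rfl (fun _ _ => rfl) (fun _ => rfl) (fun _ _ => rfl)
    (fun _ _ => rfl) (fun _ _ => rfl)

@[simp] theorem zero_f (P Q : GrVect k Γ) : Hom.f (0 : P ⟶ Q) = 0 := rfl
@[simp] theorem add_f {P Q : GrVect k Γ} (a b : P ⟶ Q) : (a + b).f = a.f + b.f := rfl
@[simp] theorem smul_f {P Q : GrVect k Γ} (x : k) (a : P ⟶ Q) : (x • a).f = x • a.f := rfl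

instance : Preadditive (GrVect k Γ) where
  add_comp _ _ _ _ _ _ := hom_ext (LinearMap.comp_add _ _ _)
  comp_add _ _ _ _ _ _ := hom_ext (LinearMap.add_comp _ _ _)

instance : Linear k (GrVect k Γ) where
  homModule P Q := (f_injective P Q).module k
    (⟨⟨fun a => a.f, rfl⟩, fun _ _ => rfl⟩ : (P ⟶ Q) →+ (P.V →ₗ[k] Q.V)) (fun _ _ => rfl)
  smul_comp _ _ _ _ _ _ := hom_ext (LinearMap.comp_smul _ _ _)
  comp_smul _ _ _ _ _ _ := hom_ext (LinearMap.smul_comp _ _ _)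

/-- An isomorphism from an invertible degree preserving linear map. -/
def mkIso {P Q : GrVect k Γ} (f : P.V ≃ₗ[k] Q.V)
    (comm : ∀ s v, f (P.proj s v) = Q.proj s (f v)) : P ≅ Q where
  hom := ⟨f, comm⟩
  inv := ⟨f.symm, fun a v => by
    apply f.injective
    simp [comm]⟩
  hom_inv_id := hom_ext (by simp)
  inv_hom_id := hom_ext (by simp)

theorem proj_sum_smul (P : GrVect k Γ) (x : Γ → k) (s : Γ) (v : P.V) :
    P.proj s (∑ t, x t • P.proj t v) = x s • P.proj s v := by
  rw [map_sum, Finset.sum_eq_single s]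
  · rw [map_smul, P.proj_self]
  · intro t _ ht
    rw [map_smul, P.proj_ne _ _ _ (Ne.symm ht), smul_zero]
  · simp

/-- The invertible map which multiplies the elements of degree `s` by `x s`. -/
def scale (P : GrVect k Γ) (x : Γ → kˣ) : P.V ≃ₗ[k] P.V :=
  LinearEquiv.ofLinearMap (∑ s, (x s : k) • P.proj s) (∑ s, ((x s)⁻¹ : kˣ).val • P.proj s)
    (LinearMap.ext fun v => by
      simp only [LinearMap.comp_apply, LinearMap.sum_apply, LinearMap.smul_apply,
        proj_sum_smul P fun s => ((x s)⁻¹ : kˣ).val]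
      simp [smul_smul, P.sum_proj])
    (LinearMap.ext fun v => by
      simp only [LinearMap.comp_apply, LinearMap.sum_apply, LinearMap.smul_apply,
        proj_sum_smul P fun s => (x s : k)]
      simp [smul_smul, P.sum_proj])

theorem scale_apply (P : GrVect k Γ) (x : Γ → kˣ) (v : P.V) :
    P.scale x v = ∑ s, (x s : k) • P.proj s v := by
  simp [scale, LinearMap.sum_apply]

theorem scale_proj (P : GrVect k Γ) (x : Γ → kˣ) {s s' : Γ} (e : s = s') (v : P.V) :
    P.scale x (P.proj s v) = P.proj s' (P.scale x v) := by
  subst e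
  rw [scale_apply, scale_apply, proj_sum_smul P fun s => (x s : k), Finset.sum_eq_single s]
  · rw [P.proj_self]
  · intro t _ ht
    rw [P.proj_ne _ _ _ ht, smul_zero]
  · simp

theorem scale_natural {P Q : GrVect k Γ} (a : P ⟶ Q) (x : Γ → kˣ) (v : P.V) :
    Q.scale x (a.f v) = a.f (P.scale x v) := by
  rw [scale_apply, scale_apply, map_sum]
  simp [a.comm]

end Category

open Classical in
/-- The grading of `k` concentrated in degree `1`. -/
def unitProj (k : Type u) [Field k] {Γ : Type w} [Group Γ] (s : Γ) : k →ₗ[k] k :=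
  if s = 1 then LinearMap.id else 0

theorem unitProj_one {k : Type u} [Field k] {Γ : Type w} [Group Γ] : unitProj k (1 : Γ) = LinearMap.id := if_pos rfl

theorem unitProj_ne {k : Type u} [Field k] {Γ : Type w} [Group Γ] {s : Γ} (hs : s ≠ 1) : unitProj k s = 0 := if_neg hs

section Monoidal

variable {k : Type u} [Field k] {Γ : Type w} [Group Γ] [Fintype Γ]

section Tensor

variable {V W U : Type u} [AddCommGroup V] [Module k V] [AddCommGroup W] [Module k W]
  [AddCommGroup U] [Module k U]

/-- The projection onto `(V ⊗ W)_s = ⨁_{tu = s} V_t ⊗ W_u`. -/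
def tensorProj (p : Γ → V →ₗ[k] V) (q : Γ → W →ₗ[k] W) (s : Γ) : V ⊗[k] W →ₗ[k] V ⊗[k] W :=
  ∑ t, TensorProduct.map (p t) (q (t⁻¹ * s))

theorem tensorProj_tmul (p : Γ → V →ₗ[k] V) (q : Γ → W →ₗ[k] W) (s : Γ) (v : V) (w : W) :
    tensorProj p q s (v ⊗ₜ w) = ∑ t, p t v ⊗ₜ[k] q (t⁻¹ * s) w := by
  rw [tensorProj, LinearMap.sum_apply]
  simp

theorem tensorProj_tensorProj (P Q : GrVect k Γ) (s s' : Γ) (v : P.V) (w : Q.V) :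
    tensorProj P.proj Q.proj s (tensorProj P.proj Q.proj s' (v ⊗ₜ w)) =
      ∑ t, P.proj t v ⊗ₜ[k] Q.proj (t⁻¹ * s) (Q.proj (t⁻¹ * s') w) := by
  rw [tensorProj_tmul, map_sum]
  refine Finset.sum_congr rfl fun t _ => ?_
  rw [tensorProj_tmul, Finset.sum_eq_single t]
  · rw [P.proj_self]
  · intro b _ hb
    rw [P.proj_ne _ _ _ hb, TensorProduct.zero_tmul]
  · simp

theorem map_proj {V' W' : Type u} [AddCommGroup V'] [Module k V'] [AddCommGroup W']
    [Module k W'] (p : Γ → V →ₗ[k] V) (q : Γ → W →ₗ[k] W) (p' : Γ → V' →ₗ[k] V')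
    (q' : Γ → W' →ₗ[k] W') (f : V →ₗ[k] V') (g : W →ₗ[k] W')
    (hf : ∀ s v, f (p s v) = p' s (f v)) (hg : ∀ s v, g (q s v) = q' s (g v)) (s : Γ)
    (v : V ⊗[k] W) :
    TensorProduct.map f g (tensorProj p q s v) = tensorProj p' q' s (TensorProduct.map f g v) := by
  induction v with
  | zero => simp
  | add x y hx hy => simp only [map_add, hx, hy]
  | tmul v w =>
    rw [tensorProj_tmul, map_sum, TensorProduct.map_tmul, tensorProj_tmul]
    simp [hf, hg]

theorem assoc_proj (p : Γ → V →ₗ[k] V) (q : Γ → W →ₗ[k] W) (r : Γ → U →ₗ[k] U) (s : Γ)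
    (v : (V ⊗[k] W) ⊗[k] U) :
    TensorProduct.assoc k V W U (tensorProj (tensorProj p q) r s v) =
      tensorProj p (tensorProj q r) s (TensorProduct.assoc k V W U v) := by
  induction v with
  | zero => simp
  | add x y hx hy => simp only [map_add, hx, hy]
  | tmul v w =>
    induction v with
    | zero => simp
    | add x y hx hy => simp only [map_add, TensorProduct.add_tmul, hx, hy]
    | tmul u v =>
      simp only [tensorProj_tmul, TensorProduct.assoc_tmul, map_sum, TensorProduct.sum_tmul,
        TensorProduct.tmul_sum]
      rw [Finset.sum_comm]
      refine Finset.sum_congr rfl fun t _ => ?_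
      rw [← Equiv.sum_comp (Equiv.mulLeft t)]
      refine Finset.sum_congr rfl fun a _ => ?_
      simp [mul_assoc]

theorem lid_proj (p : Γ → V →ₗ[k] V) (s : Γ) (v : k ⊗[k] V) :
    TensorProduct.lid k V (tensorProj (unitProj k) p s v) = p s (TensorProduct.lid k V v) := by
  induction v with
  | zero => simp
  | add x y hx hy => simp only [map_add, hx, hy]
  | tmul x v =>
    rw [tensorProj_tmul, Finset.sum_eq_single 1]
    · simp [unitProj_one]
    · intro t _ ht
      simp [unitProj_ne ht]
    · simp

theorem rid_proj (p : Γ → V →ₗ[k] V) (s : Γ) (v : V ⊗[k] k) :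
    TensorProduct.rid k V (tensorProj p (unitProj k) s v) = p s (TensorProduct.rid k V v) := by
  induction v with
  | zero => simp
  | add x y hx hy => simp only [map_add, hx, hy]
  | tmul v x =>
    rw [tensorProj_tmul, Finset.sum_eq_single s]
    · simp [unitProj_one]
    · intro t _ ht
      have : t⁻¹ * s ≠ 1 := by rwa [Ne, inv_mul_eq_one]
      simp [unitProj_ne this]
    · simp

end Tensor

/-- The tensor product of graded vector spaces. -/
def tensor (P Q : GrVect k Γ) : GrVect k Γ where
  V := P.V ⊗[k] Q.V
  proj := tensorProj P.proj Q.proj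
  proj_self s v := by
    induction v with
    | zero => simp
    | add x y hx hy => simp only [map_add, hx, hy]
    | tmul v w =>
      rw [tensorProj_tensorProj, tensorProj_tmul]
      simp [Q.proj_self]
  proj_ne s t v hst := by
    induction v with
    | zero => simp
    | add x y hx hy => simp only [map_add, hx, hy, add_zero]
    | tmul v w =>
      rw [tensorProj_tensorProj]
      refine Finset.sum_eq_zero fun a _ => ?_
      rw [Q.proj_ne _ _ _ (by simpa using hst), TensorProduct.tmul_zero]
  sum_proj v := by
    induction v with
    | zero => simp
    | add x y hx hy => simp only [map_add, Finset.sum_add_distrib, hx, hy]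
    | tmul v w =>
      simp only [tensorProj_tmul]
      rw [Finset.sum_comm]
      simp only [← TensorProduct.tmul_sum]
      have : ∀ t : Γ, ∑ s, Q.proj (t⁻¹ * s) w = w := fun t =>
        (Equiv.sum_comp (Equiv.mulLeft t⁻¹) fun s => Q.proj s w).trans (Q.sum_proj w)
      simp only [this, ← TensorProduct.sum_tmul, P.sum_proj]

/-- The unit object: `k` in degree `1`. -/
def unit : GrVect k Γ where
  V := k
  proj := unitProj k
  proj_self s v := by
    by_cases h : s = 1
    · subst h; simp [unitProj_one]
    · simp [unitProj_ne h]
  proj_ne s t v hst := by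
    by_cases h : s = 1
    · subst h; simp [unitProj_ne (Ne.symm hst)]
    · simp [unitProj_ne h]
  sum_proj v := by
    rw [Finset.sum_eq_single 1]
    · simp [unitProj_one]
    · intro s _ hs
      simp [unitProj_ne hs]
    · simp

instance : MonoidalCategoryStruct (GrVect k Γ) where
  tensorObj := tensor
  whiskerLeft P _ _ g := ⟨TensorProduct.map LinearMap.id g.f, 
    map_proj P.proj _ P.proj _ LinearMap.id g.f (fun _ _ => rfl) g.comm⟩
  whiskerRight f Q := ⟨TensorProduct.map f.f LinearMap.id, 
    map_proj _ Q.proj _ Q.proj f.f LinearMap.id f.comm (fun _ _ => rfl)⟩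
  tensorHom f g := ⟨TensorProduct.map f.f g.f, map_proj _ _ _ _ f.f g.f f.comm g.comm⟩
  tensorUnit := unit
  associator P Q R := mkIso (P := tensor (tensor P Q) R) (Q := tensor P (tensor Q R))
    (TensorProduct.assoc k P.V Q.V R.V) (assoc_proj P.proj Q.proj R.proj)
  leftUnitor P := mkIso (P := tensor unit P) (TensorProduct.lid k P.V) (lid_proj P.proj)
  rightUnitor P := mkIso (P := tensor P unit) (TensorProduct.rid k P.V) (rid_proj P.proj)

instance : MonoidalCategory (GrVect k Γ) where
  tensorHom_def _ _ := hom_ext (TensorProduct.ext' fun _ _ => rfl)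
  id_tensorHom_id _ _ := hom_ext (TensorProduct.ext' fun _ _ => rfl)
  tensorHom_comp_tensorHom _ _ _ _ := hom_ext (TensorProduct.ext' fun _ _ => rfl)
  whiskerLeft_id _ _ := hom_ext (TensorProduct.ext' fun _ _ => rfl)
  id_whiskerRight _ _ := hom_ext (TensorProduct.ext' fun _ _ => rfl)
  associator_naturality _ _ _ := hom_ext (TensorProduct.ext_threefold fun _ _ _ => rfl)
  leftUnitor_naturality a := hom_ext (TensorProduct.ext' fun x v => (a.f.map_smul x v).symm)
  rightUnitor_naturality a := hom_ext (TensorProduct.ext' fun v x => (a.f.map_smul x v).symm)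
  pentagon _ _ _ _ := hom_ext (TensorProduct.ext_fourfold fun _ _ _ _ => rfl)
  triangle P Q := hom_ext (TensorProduct.ext_threefold fun (v : P.V) (x : k) (w : Q.V) =>
    (TensorProduct.smul_tmul x v w).symm)

end Monoidal

end GrVect

end GrVect

/-! ## The crossed action on graded vector spaces -/

section GradedCrossedAction

variable {k : Type u} [Field k] {G : Type v} {Γ : Type w} [Group G] [Group Γ] [Fintype Γ]

namespace MatchedPair

variable (M : MatchedPair G Γ)

/-- The permutation `s ↦ s ◁ g` of `Γ`. -/
def ractEquiv (g : G) : Γ ≃ Γ where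
  toFun s := M.ract s g
  invFun s := M.ract s g⁻¹
  left_inv s := by dsimp only; rw [← M.ract_mul, mul_inv_cancel, M.ract_one]
  right_inv s := by dsimp only; rw [← M.ract_mul, inv_mul_cancel, M.ract_one]

/-- The functor `ρ^g` on graded vector spaces: `ρ^g(V) = V` as a vector space, with the grading
`ρ^g(V)_{s ◁ g} = V_s`. -/
def regrade (k : Type u) [Field k] (g : G) : GrVect k Γ ⥤ GrVect k Γ where
  obj P :=
    { V := P.V
      proj := fun s => P.proj (M.ract s g⁻¹)
      proj_self := fun s v => P.proj_self _ v
      proj_ne := fun s t v hst => P.proj_ne _ _ v fun e => hst ((M.ractEquiv g⁻¹).injective e)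
      sum_proj := fun v =>
        (Equiv.sum_comp (M.ractEquiv g⁻¹) fun s => P.proj s v).trans (P.sum_proj v) }
  map a := ⟨a.f, fun s v => a.comm _ v⟩

end MatchedPair

namespace CocyclePair

variable {M : MatchedPair G Γ} (c : CocyclePair k M)

theorem γ_comm (g : G) (t : Γ) (P Q : GrVect k Γ) (hQ : Q.proj t = LinearMap.id) (s : Γ)
    (v : P.V ⊗[k] Q.V) :
    TensorProduct.map (P.scale fun a => (c.τ a t g)⁻¹).toLinearMap LinearMap.id
        (GrVect.tensorProj P.proj Q.proj (M.ract s g⁻¹) v) =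
      GrVect.tensorProj (fun a => P.proj (M.ract a (M.lact t g)⁻¹))
        (fun a => Q.proj (M.ract a g⁻¹)) s
        (TensorProduct.map (P.scale fun a => (c.τ a t g)⁻¹).toLinearMap LinearMap.id v) := by
  have hne : ∀ b w, b ≠ t → Q.proj b w = 0 := fun b w hb => by
    have h := Q.proj_ne b t w hb
    rwa [hQ] at h
  have e : M.ract s g⁻¹ * t⁻¹ = M.ract (s * (M.ract t g)⁻¹) (M.lact t g)⁻¹ := by
    apply (M.ractEquiv (M.lact t g)).injective
    have h := M.mul_ract (M.ract s g⁻¹ * t⁻¹) t g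
    rw [inv_mul_cancel_right, ← M.ract_mul, inv_mul_cancel, M.ract_one] at h
    change M.ract _ _ = M.ract (M.ract _ _) _
    rw [← M.ract_mul, inv_mul_cancel, M.ract_one]
    exact eq_mul_inv_of_mul_eq h.symm
  induction v with
  | zero => simp
  | add x y hx hy => simp only [map_add, hx, hy]
  | tmul v w =>
    rw [GrVect.tensorProj_tmul, map_sum, TensorProduct.map_tmul, GrVect.tensorProj_tmul,
      Finset.sum_eq_single (M.ract s g⁻¹ * t⁻¹), Finset.sum_eq_single (s * (M.ract t g)⁻¹)]
    · rw [TensorProduct.map_tmul, LinearEquiv.coe_coe, GrVect.scale_proj P _ e]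
      simp [← M.ract_mul, M.ract_one]
    · intro b _ hb
      rw [hne _ _ fun h => hb _, TensorProduct.tmul_zero]
      intro h
      have h2 := congrArg (fun a => M.ract a g) h
      simp only [← M.ract_mul, inv_mul_cancel, M.ract_one] at h2
      rw [← h2]; group
    · simp
    · intro b _ hb
      rw [hne _ _ fun h => hb _, TensorProduct.tmul_zero, map_zero]
      intro h
      rw [← h]; group
    · simp

/-- The data of the `(G, Γ)`-crossed action on the category `C(Γ)` of graded vector spaces
defined by the cocycles `σ`, `τ`. -/
def crossedActionData : CrossedActionData M (GrVect k Γ) where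
  -- vector spaces concentrated in degree `s`
  homog s P := P.proj s = LinearMap.id
  ρ g := M.regrade k g
  -- `ρ₂^{g,h}(v) = σ_{|v|}(h, g)⁻¹ v`
  ρ₂ g h := NatIso.ofComponents
    (fun P => GrVect.mkIso (P := (M.regrade k g).obj ((M.regrade k h).obj P))
      (Q := (M.regrade k (h * g)).obj P) (P.scale fun s => (c.σ h g s)⁻¹) (fun s v =>
        P.scale_proj _ (by rw [mul_inv_rev, M.ract_mul]) v))
    (fun a => GrVect.hom_ext (LinearMap.ext fun v => GrVect.scale_natural a _ v))
  ρ₀ := NatIso.ofComponents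
    (fun P => GrVect.mkIso (P := P) (Q := (M.regrade k 1).obj P) (LinearEquiv.refl k P.V)
      (fun s v => by
        change P.proj s v = P.proj (M.ract s 1⁻¹) v
        rw [inv_one, M.ract_one]))
    (fun _ => rfl)
  -- `γ^g(u ⊗ v) = τ_g(|u|, t)⁻¹ u ⊗ v` for `v` of degree `t`
  γ g t P Q hQ := GrVect.mkIso (P := (M.regrade k g).obj (P ⊗ Q))
    (Q := (M.regrade k (M.lact t g)).obj P ⊗ (M.regrade k g).obj Q)
    (TensorProduct.congr (P.scale fun s => (c.τ s t g)⁻¹) (LinearEquiv.refl k Q.V))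
    (c.γ_comm g t P Q hQ)
  γ₀ g := GrVect.mkIso (P := (M.regrade k g).obj (𝟙_ (GrVect k Γ))) (Q := 𝟙_ (GrVect k Γ))
    (LinearEquiv.refl k k) (fun s v => by
      change GrVect.unitProj k (M.ract s g⁻¹) v = GrVect.unitProj k s v
      by_cases h : s = 1
      · subst h; rw [M.one_ract]
      · rw [GrVect.unitProj_ne h, GrVect.unitProj_ne]
        intro e
        apply h
        have := (M.ractEquiv g⁻¹).injective (e.trans (M.one_ract g⁻¹).symm)
        exact this)

end CocyclePair

end GradedCrossedAction

end

/-! Let `u_g` denote `groupUnit c g`, the sum of all `e_s # g`. Every basis element factors as `e_s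
# g = (e_s # 1) u_g`. The `e_s # 1` are orthogonal idempotents with sum `1`, so an `H`-module is a
`Γ`-graded vector space with extra operators. The `u_g` are invertible, `u_g⁻¹` carries degree `s`
to degree `s ◁ g`, and `u_h⁻¹ u_g⁻¹` equals `σ_s(g,h)⁻¹ u_{gh}⁻¹` on degree `s`. These are exactly
the conditions under which `r^g`, the action of `u_g⁻¹`, is an equivariant structure for the given
`ρ₂`. Conversely `(X, r)` becomes a module by letting `e_s # g` act as the projection to degree `s`
after `(r^g)⁻¹`. Both constructions keep the vector space and are mutually inverse on objects as
equalities (`toRep_ofRep_obj`, `ofRep_toRep_obj`).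

For tensor products take `u`, `v` homogeneous of degrees `a`, `b`. The equivariant structure sends
`u ⊗ v` to `τ_g(a,b)⁻¹ (r^{b ▷ g} u ⊗ r^g v)`, while the comultiplication of `e_{ab} # g` contains
`τ_g(a,b) (e_a # (b ▷ g)) ⊗ (e_b # g)`. The scalars cancel, so the two module structures on the
tensor product of vector spaces coincide (`repAct_tensor`); the same holds for the units, and
identities serve as monoidal structure morphisms.

That the data form a crossed action is a computation with scalars: on homogeneous vectors every
structure map multiplies by a value of `σ⁻¹` or `τ⁻¹`, and the coherence axioms become the cocycle,
normalization and compatibility equations (`isCrossedTensorCategory`).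

The tensor category axioms other than duality and the bilinearity of the tensor product follow from
a faithful linear functor to finite-dimensional vector spaces that computes kernels and cokernels
(`IsVectorialFunctor.isTensorCategory`). Representations have duals on `V*` through the antipode and
its inverse; the antipode is bijective because its square is diagonal with unit entries in the basis
`e_s # g`. The equivariant category inherits duals along the monoidal equivalence. Graded spaces are
a fusion category because a homogeneous basis splits them into lines and linear lifts can be made
degree preserving. -/

noncomputable section

/-! ## Abelian categories of finite dimensional vector spaces with extra structure -/

/-- A faithful linear functor `U` to vector spaces along which kernels, cokernels and
factorizations through injections and surjections can be computed. -/
structure IsVectorialFunctor (k : Type u) [Field k] {C : Type u₁} [Category.{v₁} C]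
    [Preadditive C] [Linear k C] (U : C ⥤ ModuleCat.{u} k) : Prop where
  additive : U.Additive
  linear : U.Linear k
  faithful : U.Faithful
  finite : ∀ X, Module.Finite k (U.obj X)
  hasFiniteProducts : HasFiniteProducts C
  lift : ∀ {K X Z : C} (i : K ⟶ X) (g : Z ⟶ X), Function.Injective (U.map i).hom →
    LinearMap.range (U.map g).hom ≤ LinearMap.range (U.map i).hom → ∃ h : Z ⟶ K, h ≫ i = g
  desc : ∀ {X Q Z : C} (p : X ⟶ Q) (g : X ⟶ Z), Function.Surjective (U.map p).hom →
    LinearMap.ker (U.map p).hom ≤ LinearMap.ker (U.map g).hom → ∃ h : Q ⟶ Z, p ≫ h = g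
  exists_kernel : ∀ {X Y : C} (f : X ⟶ Y), ∃ (K : C) (i : K ⟶ X),
    Function.Injective (U.map i).hom ∧ LinearMap.range (U.map i).hom = LinearMap.ker (U.map f).hom
  exists_cokernel : ∀ {X Y : C} (f : X ⟶ Y), ∃ (Q : C) (p : Y ⟶ Q),
    Function.Surjective (U.map p).hom ∧ LinearMap.ker (U.map p).hom = LinearMap.range (U.map f).hom

namespace IsVectorialFunctor

variable {k : Type u} [Field k] {C : Type u₁} [Category.{v₁} C] [Preadditive C] [Linear k C]
  {U : C ⥤ ModuleCat.{u} k} (hU : IsVectorialFunctor k U)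

include hU

theorem map_zero {X Y : C} : (U.map (0 : X ⟶ Y)).hom = 0 := by
  have := hU.additive
  simp

theorem eq_of_hom_eq {X Y : C} {f g : X ⟶ Y} (e : (U.map f).hom = (U.map g).hom) : f = g :=
  have := hU.faithful
  U.map_injective (ModuleCat.hom_ext e)

/-- By faithfulness, vanishing of composites can be tested on underlying maps. This translates the
universal properties of kernels and cokernels into inclusions of submodules. -/
theorem comp_eq_zero_iff {X Y Z : C} (f : X ⟶ Y) (g : Y ⟶ Z) :
    f ≫ g = 0 ↔ LinearMap.range (U.map f).hom ≤ LinearMap.ker (U.map g).hom := by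
  rw [LinearMap.range_le_ker_iff]
  constructor
  · intro e
    rw [← ModuleCat.hom_comp, ← U.map_comp, e, hU.map_zero]
  · intro e
    apply hU.eq_of_hom_eq
    rw [hU.map_zero, U.map_comp, ModuleCat.hom_comp, e]

theorem mono_of_injective {X Y : C} (f : X ⟶ Y) (hf : Function.Injective (U.map f).hom) :
    Mono f :=
  have := hU.faithful
  U.mono_of_mono_map ((ModuleCat.mono_iff_injective _).2 hf)

theorem epi_of_surjective {X Y : C} (f : X ⟶ Y) (hf : Function.Surjective (U.map f).hom) :
    Epi f :=
  have := hU.faithful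
  U.epi_of_epi_map ((ModuleCat.epi_iff_surjective _).2 hf)

/-- The concrete kernel inclusion `i` satisfies `i ≫ f = 0`, so a mono kills it, and its range, the
linear kernel of `f`, is zero. Preservation of limits by `U` is not needed. -/
theorem injective_of_mono {X Y : C} (f : X ⟶ Y) [Mono f] :
    Function.Injective (U.map f).hom := by
  obtain ⟨K, i, -, hi⟩ := hU.exists_kernel f
  have h0 : i = 0 := zero_of_comp_mono f ((hU.comp_eq_zero_iff i f).2 hi.le)
  rw [← LinearMap.ker_eq_bot, ← hi, h0, hU.map_zero, LinearMap.range_zero]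

theorem surjective_of_epi {X Y : C} (f : X ⟶ Y) [Epi f] :
    Function.Surjective (U.map f).hom := by
  obtain ⟨Q, p, -, hp⟩ := hU.exists_cokernel f
  have h0 : p = 0 := zero_of_epi_comp f ((hU.comp_eq_zero_iff f p).2 hp.ge)
  rw [← LinearMap.range_eq_top, ← hp, h0, hU.map_zero, LinearMap.ker_zero]

/-- An injection whose image is the kernel of `f` is a kernel of `f`. -/
theorem isLimit_fork {K X Y : C} {f : X ⟶ Y} (i : K ⟶ X) (w : i ≫ f = 0)
    (hi : Function.Injective (U.map i).hom)
    (hr : LinearMap.ker (U.map f).hom ≤ LinearMap.range (U.map i).hom) :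
    Nonempty (IsLimit (KernelFork.ofι i w)) := by
  have := hU.mono_of_injective i hi
  have key : ∀ {Z : C} (g : Z ⟶ X), g ≫ f = 0 → ∃ h : Z ⟶ K, h ≫ i = g := fun g hg =>
    hU.lift i g hi (((hU.comp_eq_zero_iff g f).1 hg).trans hr)
  exact ⟨KernelFork.IsLimit.ofι i w (fun g hg => (key g hg).choose)
    (fun g hg => (key g hg).choose_spec)
    (fun g hg m hm => by rw [← cancel_mono i, hm, (key g hg).choose_spec])⟩

/-- A surjection whose kernel is the image of `f` is a cokernel of `f`. -/
theorem isColimit_cofork {X Y Q : C} {f : X ⟶ Y} (p : Y ⟶ Q) (w : f ≫ p = 0)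
    (hp : Function.Surjective (U.map p).hom)
    (hr : LinearMap.ker (U.map p).hom ≤ LinearMap.range (U.map f).hom) :
    Nonempty (IsColimit (CokernelCofork.ofπ p w)) := by
  have := hU.epi_of_surjective p hp
  have key : ∀ {Z : C} (g : Y ⟶ Z), f ≫ g = 0 → ∃ h : Q ⟶ Z, p ≫ h = g := fun g hg =>
    hU.desc p g hp (hr.trans ((hU.comp_eq_zero_iff f g).1 hg))
  exact ⟨CokernelCofork.IsColimit.ofπ p w (fun g hg => (key g hg).choose)
    (fun g hg => (key g hg).choose_spec)
    (fun g hg m hm => by rw [← cancel_epi p, hm, (key g hg).choose_spec])⟩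

theorem hasKernels : HasKernels C where
  has_limit f := by
    obtain ⟨K, i, hi, hr⟩ := hU.exists_kernel f
    obtain ⟨l⟩ := hU.isLimit_fork i ((hU.comp_eq_zero_iff i f).2 hr.le) hi hr.ge
    exact ⟨⟨_, l⟩⟩

theorem hasCokernels : HasCokernels C where
  has_colimit f := by
    obtain ⟨Q, p, hp, hr⟩ := hU.exists_cokernel f
    obtain ⟨l⟩ := hU.isColimit_cofork p ((hU.comp_eq_zero_iff f p).2 hr.ge) hp hr.le
    exact ⟨⟨_, l⟩⟩

/-- A mono is injective, and its range is the linear kernel of its concrete cokernel; by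
`isLimit_fork` it is therefore a kernel of that cokernel. -/
theorem isNormalMonoCategory : IsNormalMonoCategory C where
  normalMonoOfMono f _ := by
    obtain ⟨Q, p, -, hr⟩ := hU.exists_cokernel f
    have w := (hU.comp_eq_zero_iff f p).2 hr.ge
    obtain ⟨l⟩ := hU.isLimit_fork f w (hU.injective_of_mono f) hr.le
    exact ⟨⟨Q, p, w, l⟩⟩

theorem isNormalEpiCategory : IsNormalEpiCategory C where
  normalEpiOfEpi f _ := by
    obtain ⟨K, i, -, hr⟩ := hU.exists_kernel f
    have w := (hU.comp_eq_zero_iff i f).2 hr.le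
    obtain ⟨l⟩ := hU.isColimit_cofork f w (hU.surjective_of_epi f) hr.ge
    exact ⟨⟨K, i, w, l⟩⟩

/-- Surjectivity lets the identity of `Y` lift along `f` to a section; since `f` is mono, the
section is a two-sided inverse. -/
theorem isIso_of_bijective {X Y : C} (f : X ⟶ Y) (hf : Function.Bijective (U.map f).hom) :
    IsIso f := by
  have := hU.mono_of_injective f hf.1
  obtain ⟨g, hg⟩ := hU.lift f (𝟙 Y) hf.1 (by rw [LinearMap.range_eq_top.2 hf.2]; exact le_top)
  exact ⟨g, by rw [← cancel_mono f, Category.assoc, hg, Category.comp_id, Category.id_comp], hg⟩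

/-- The underlying linear map of an inclusion of subobjects is strict if the inclusion is. -/
theorem finrank_strictMono (X : C) :
    StrictMono fun Y : Subobject X => Module.finrank k (U.obj (Y : C)) := by
  intro Y Z hYZ
  have := hU.finite
  let j := Subobject.ofLE Y Z hYZ.le
  have hj : Function.Injective (U.map j).hom := hU.injective_of_mono j
  -- Equal dimensions would make the inclusion bijective, hence an isomorphism, and then `Z ≤ Y`.
  refine lt_of_le_of_ne (LinearMap.finrank_le_finrank_of_injective hj) fun e => hYZ.not_ge ?_
  have hb : Function.Bijective (U.map j).hom :=
    ⟨hj, (LinearMap.injective_iff_surjective_of_finrank_eq_finrank e).1 hj⟩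
  have := hU.isIso_of_bijective j hb
  refine Subobject.le_of_comm (inv j) ?_
  rw [IsIso.inv_comp_eq, Subobject.ofLE_arrow]

theorem isArtinianObject (X : C) : IsArtinianObject X := by
  refine ⟨?_⟩
  exact (hU.finrank_strictMono X).wellFoundedLT

theorem isNoetherianObject (X : C) : IsNoetherianObject X := by
  have := hU.finite
  refine ⟨?_⟩
  have hle : ∀ Y : Subobject X, Module.finrank k (U.obj (Y : C)) ≤ Module.finrank k (U.obj X) :=
    fun Y => LinearMap.finrank_le_finrank_of_injective (hU.injective_of_mono Y.arrow)
  -- The codimension strictly decreases; the bound `hle` is what keeps the truncated subtraction of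
  -- naturals from losing strictness.
  have : StrictAnti fun Y : Subobject X =>
      Module.finrank k (U.obj X) - Module.finrank k (U.obj (Y : C)) := by
    intro Y Z hYZ
    have h1 := hU.finrank_strictMono X hYZ
    have h2 := hle Z
    dsimp only at h1 ⊢
    omega
  exact this.wellFoundedGT

theorem finite_hom (X Y : C) : Module.Finite k (X ⟶ Y) := by
  have := hU.finite
  have := hU.additive
  have := hU.linear
  have := hU.faithful
  let φ : (X ⟶ Y) →ₗ[k] (U.obj X →ₗ[k] U.obj Y) :=
    { toFun := fun f => (U.map f).hom
      map_add' := fun f g => by simp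
      map_smul' := fun c f => by simp }
  exact Module.Finite.of_injective φ fun f g e => hU.eq_of_hom_eq e

/-- A nonzero linear map into a line is onto, so a nonzero mono is bijective; the zero map is not
onto a line. -/
theorem simple_of_finrank_eq_one {X : C} (hX : Module.finrank k (U.obj X) = 1) : Simple X where
  mono_isIso_iff_nonzero {Y} f _ := by
    have := hU.finite
    constructor
    · rintro hf rfl
      have h1 := (ConcreteCategory.bijective_of_isIso (U.map (0 : Y ⟶ X))).2
      have h2 : LinearMap.range (U.map (0 : Y ⟶ X)).hom = ⊤ := LinearMap.range_eq_top.2 h1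
      rw [hU.map_zero, LinearMap.range_zero] at h2
      have h3 := finrank_top k (U.obj X)
      rw [← h2, finrank_bot, hX] at h3
      exact zero_ne_one h3
    · intro hf
      have hinj := hU.injective_of_mono f
      refine hU.isIso_of_bijective f ⟨hinj, surjective_of_nonzero_of_finrank_eq_one (A := k) hX ?_⟩
      exact fun e => hf (hU.eq_of_hom_eq (e.trans hU.map_zero.symm))

omit hU in
/-- Vectorial functors can be precomposed with equivalences. -/
theorem comp_equivalence {D : Type u₂} [Category.{v₂} D] [Preadditive D] [Linear k D]
    {U : D ⥤ ModuleCat.{u} k} (hU : IsVectorialFunctor k U) (F : C ⥤ D) [F.IsEquivalence]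
    [F.Additive] [F.Linear k] : IsVectorialFunctor k (F ⋙ U) where
  additive := have := hU.additive; inferInstance
  linear := have := hU.additive; have := hU.linear; inferInstance
  faithful := have := hU.faithful; inferInstance
  finite X := hU.finite (F.obj X)
  hasFiniteProducts := ⟨fun n =>
    have := hU.hasFiniteProducts
    Adjunction.hasLimitsOfShape_of_equivalence F⟩
  lift i g hi hr := by
    obtain ⟨h, e⟩ := hU.lift (F.map i) (F.map g) hi hr
    exact ⟨F.preimage h, F.map_injective (by simp [e])⟩
  desc p g hp hr := by
    obtain ⟨h, e⟩ := hU.desc (F.map p) (F.map g) hp hr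
    exact ⟨F.preimage h, F.map_injective (by simp [e])⟩
  exists_kernel f := by
    obtain ⟨K, i, hi, hr⟩ := hU.exists_kernel (F.map f)
    -- The kernel found in `D` is replaced by an isomorphic object in the image of `F`; precomposing
    -- with the isomorphism affects neither injectivity nor the range.
    refine ⟨F.objPreimage K, F.preimage ((F.objObjPreimageIso K).hom ≫ i), ?_, ?_⟩
    · simpa using hi.comp (ConcreteCategory.bijective_of_isIso (U.map (F.objObjPreimageIso K).hom)).1
    · have h2 := (ConcreteCategory.bijective_of_isIso (U.map (F.objObjPreimageIso K).hom)).2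
      simp only [Functor.comp_map, Functor.map_preimage, Functor.map_comp, ModuleCat.hom_comp]
      rw [LinearMap.range_comp_of_range_eq_top _ (LinearMap.range_eq_top.2 h2)]
      exact hr
  exists_cokernel f := by
    obtain ⟨Q, p, hp, hr⟩ := hU.exists_cokernel (F.map f)
    refine ⟨F.objPreimage Q, F.preimage (p ≫ (F.objObjPreimageIso Q).inv), ?_, ?_⟩
    · simpa using
        (ConcreteCategory.bijective_of_isIso (U.map (F.objObjPreimageIso Q).inv)).2.comp hp
    · have h2 := (ConcreteCategory.bijective_of_isIso (U.map (F.objObjPreimageIso Q).inv)).1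
      simp only [Functor.comp_map, Functor.map_preimage, Functor.map_comp, ModuleCat.hom_comp]
      rw [LinearMap.ker_comp_of_ker_eq_bot _ (LinearMap.ker_eq_bot.2 h2)]
      exact hr

/-- The criterion for tensor categories in terms of a vectorial functor. -/
theorem isTensorCategory [MonoidalCategory C] (h₁ : MonoidalPreadditive C)
    (h₂ : MonoidalLinear k C) (hl : ∀ X : C, Nonempty (HasLeftDual X))
    (hr : ∀ X : C, Nonempty (HasRightDual X)) (hunit : Module.finrank k (U.obj (𝟙_ C)) = 1) :
    IsTensorCategory k C where
  hasFiniteProducts := hU.hasFiniteProducts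
  hasKernels := hU.hasKernels
  hasCokernels := hU.hasCokernels
  normalMono := hU.isNormalMonoCategory
  normalEpi := hU.isNormalEpiCategory
  monoidalPreadditive := h₁
  monoidalLinear := h₂
  leftDual := hl
  rightDual := hr
  noetherian := hU.isNoetherianObject
  artinian := hU.isArtinianObject
  finite_hom := hU.finite_hom
  simple_unit := hU.simple_of_finrank_eq_one hunit

end IsVectorialFunctor

/-! ## Linear algebra -/

section LinearAlgebra

variable {k : Type*} [Field k] {V W U : Type*} [AddCommGroup V] [Module k V] [AddCommGroup W]
  [Module k W] [AddCommGroup U] [Module k U]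

/-- The linear part of the field `lift`; compatibility with further structure is then automatic,
because it can be tested after the injection. -/
theorem LinearMap.exists_comp_eq_of_range_le (i : V →ₗ[k] W) (g : U →ₗ[k] W)
    (hi : Function.Injective i) (h : LinearMap.range g ≤ LinearMap.range i) :
    ∃ f : U →ₗ[k] V, i ∘ₗ f = g := by
  refine ⟨(LinearEquiv.ofInjective i hi).symm.toLinearMap ∘ₗ
    g.codRestrict (LinearMap.range i) (fun x => h ⟨x, rfl⟩), LinearMap.ext fun x => ?_⟩
  have := LinearEquiv.apply_symm_apply (LinearEquiv.ofInjective i hi) ⟨g x, h ⟨x, rfl⟩⟩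
  exact congrArg Subtype.val this

theorem LinearMap.exists_eq_comp_of_ker_le (p : V →ₗ[k] W) (g : V →ₗ[k] U)
    (hp : Function.Surjective p) (h : LinearMap.ker p ≤ LinearMap.ker g) :
    ∃ f : W →ₗ[k] U, f ∘ₗ p = g := by
  refine ⟨(LinearMap.ker p).liftQ g h ∘ₗ (p.quotKerEquivOfSurjective hp).symm.toLinearMap,
    LinearMap.ext fun x => ?_⟩
  have : (p.quotKerEquivOfSurjective hp).symm (p x) = (LinearMap.ker p).mkQ x := by
    rw [LinearEquiv.symm_apply_eq]
    rfl
  simp [this]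

variable (k V) in
/-- The element `∑ bᵢ* ⊗ bᵢ` of `V* ⊗ V`. -/
def coevaluationComm [FiniteDimensional k V] : k →ₗ[k] Module.Dual k V ⊗[k] V :=
  (TensorProduct.comm k V (Module.Dual k V)).toLinearMap ∘ₗ coevaluation k V

theorem coevaluationComm_one [FiniteDimensional k V] : coevaluationComm k V 1 =
    ∑ i, (Module.Basis.ofVectorSpace k V).coord i ⊗ₜ[k] Module.Basis.ofVectorSpace k V i := by
  simp [coevaluationComm, coevaluation_apply_one]

/-- One of the two zigzag identities making `V*` a left dual. It is the expansion of a vector in a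
basis. -/
theorem contractRight_assoc_coevaluationComm [FiniteDimensional k V] :
    (contractRight k V).rTensor _ ∘ₗ (TensorProduct.assoc k _ _ _).symm.toLinearMap ∘ₗ
        (coevaluationComm k V).lTensor V =
      (TensorProduct.lid k _).symm.toLinearMap ∘ₗ (TensorProduct.rid k _).toLinearMap := by
  refine TensorProduct.ext' fun v x => ?_
  -- Linearity reduces the identity to the scalar `1`, where the coevaluation is an explicit sum.
  have hx : x = x • (1 : k) := by simp
  rw [hx, TensorProduct.tmul_smul, map_smul, map_smul]
  congr 1
  simp only [LinearMap.comp_apply, LinearMap.lTensor_tmul, coevaluationComm_one,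
    TensorProduct.tmul_sum, map_sum, LinearEquiv.coe_coe, TensorProduct.assoc_symm_tmul,
    LinearMap.rTensor_tmul, contractRight_apply, TensorProduct.rid_tmul, one_smul,
    TensorProduct.lid_symm_apply]
  calc _ = ∑ i, (1 : k) ⊗ₜ[k] ((Module.Basis.ofVectorSpace k V).coord i v •
        Module.Basis.ofVectorSpace k V i) := Finset.sum_congr rfl fun i _ => by
          rw [TensorProduct.tmul_smul, TensorProduct.smul_tmul', smul_eq_mul, mul_one]
    _ = _ := by
      rw [← TensorProduct.tmul_sum]
      exact congrArg _ ((Module.Basis.ofVectorSpace k V).sum_repr v)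

/-- The other zigzag identity: the expansion of a functional in the dual basis. -/
theorem contractRight_assoc_coevaluationComm' [FiniteDimensional k V] :
    (contractRight k V).lTensor _ ∘ₗ (TensorProduct.assoc k _ _ _).toLinearMap ∘ₗ
        (coevaluationComm k V).rTensor (Module.Dual k V) =
      (TensorProduct.rid k _).symm.toLinearMap ∘ₗ (TensorProduct.lid k _).toLinearMap := by
  refine TensorProduct.ext' fun x f => ?_
  have hx : x = x • (1 : k) := by simp
  rw [hx, ← TensorProduct.smul_tmul', map_smul, map_smul]
  congr 1
  simp only [LinearMap.comp_apply, LinearMap.rTensor_tmul, coevaluationComm_one,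
    TensorProduct.sum_tmul, map_sum, LinearEquiv.coe_coe, TensorProduct.assoc_tmul,
    LinearMap.lTensor_tmul, contractRight_apply, TensorProduct.lid_tmul, one_smul,
    TensorProduct.rid_symm_apply]
  calc _ = ∑ i, (f (Module.Basis.ofVectorSpace k V i) • (Module.Basis.ofVectorSpace k V).coord i)
        ⊗ₜ[k] (1 : k) := Finset.sum_congr rfl fun i _ => by
          rw [TensorProduct.smul_tmul, smul_eq_mul, mul_one]
    _ = _ := by
      rw [← TensorProduct.sum_tmul]
      exact congrArg (· ⊗ₜ[k] (1 : k)) ((Module.Basis.ofVectorSpace k V).sum_dual_apply_smul_coord f)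

/-- Together with `dualTensorHom_injective` this turns statements about the coevaluation tensor into
statements about endomorphisms, with no basis left. -/
theorem dualTensorHom_coevaluationComm [FiniteDimensional k V] :
    dualTensorHom k V V (coevaluationComm k V 1) = LinearMap.id := by
  refine LinearMap.ext fun v => ?_
  simp only [coevaluationComm_one, map_sum, LinearMap.sum_apply, dualTensorHom_apply]
  exact (Module.Basis.ofVectorSpace k V).sum_repr v

theorem dualTensorHom_injective [FiniteDimensional k V] :
    Function.Injective (dualTensorHom k V V) :=
  (dualTensorHomEquiv k V V).injective

end LinearAlgebra

/-! ## Representations of a Hopf algebra -/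

namespace FinDimRep

/-! ### Abelian structure of the category of representations. -/

section Vectorial

variable {k : Type u} [Field k] {H : Type v₁} [Ring H] [Bialgebra k H]

variable (k H) in
/-- The underlying vector space. -/
def forget : FinDimRep k H ⥤ ModuleCat.{u} k where
  obj P := ModuleCat.of k P.V
  map f := ModuleCat.ofHom f.f

/-- Subrepresentations. -/
def sub (P : FinDimRep k H) (S : Submodule k P.V) (hS : ∀ a, ∀ v ∈ S, P.act a v ∈ S) :
    FinDimRep k H where
  V := S
  act := AlgHom.ofLinearMap
    { toFun := fun a => (P.act a).restrict (hS a)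
      map_add' := fun a b => LinearMap.ext fun v => Subtype.ext (by simp)
      map_smul' := fun x a => LinearMap.ext fun v => Subtype.ext (by simp) }
    (LinearMap.ext fun v => Subtype.ext (by simp))
    (fun a b => LinearMap.ext fun v => Subtype.ext (by simp))

/-- Quotient representations. -/
def quot (P : FinDimRep k H) (S : Submodule k P.V) (hS : ∀ a, ∀ v ∈ S, P.act a v ∈ S) :
    FinDimRep k H where
  V := P.V ⧸ S
  act := AlgHom.ofLinearMap
    { toFun := fun a => S.mapQ S (P.act a) (hS a)
      map_add' := fun a b => Submodule.linearMap_qext _ (LinearMap.ext fun v => by simp)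
      map_smul' := fun x a => Submodule.linearMap_qext _ (LinearMap.ext fun v => by simp) }
    (Submodule.linearMap_qext _ (LinearMap.ext fun v => by simp))
    (fun a b => Submodule.linearMap_qext _ (LinearMap.ext fun v => by simp))

/-- The direct sum of two representations. -/
def prod (P Q : FinDimRep k H) : FinDimRep k H where
  V := P.V × Q.V
  act := AlgHom.ofLinearMap
    { toFun := fun a => (P.act a).prodMap (Q.act a)
      map_add' := fun a b => LinearMap.ext fun v => Prod.ext (by simp) (by simp)
      map_smul' := fun x a => LinearMap.ext fun v => Prod.ext (by simp) (by simp) }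
    (LinearMap.ext fun v => Prod.ext (by simp) (by simp))
    (fun a b => LinearMap.ext fun v => Prod.ext (by simp) (by simp))

theorem hasFiniteProducts : HasFiniteProducts (FinDimRep k H) := by
  have : HasTerminal (FinDimRep k H) := by
    -- The counit only supplies some algebra map from `H` to the endomorphisms of the zero space.
    let Z : FinDimRep k H := ⟨PUnit, Algebra.ofId k _ |>.comp
      ((Bialgebra.counitAlgHom k H))⟩
    have hZ : IsZero Z := by
      rw [IsZero.iff_id_eq_zero]
      exact hom_ext (LinearMap.ext fun _ => rfl)
    exact IsTerminal.hasTerminal hZ.isTerminal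
  have : HasBinaryBiproducts (FinDimRep k H) := ⟨fun P Q =>
    hasBinaryBiproduct_of_total
      { pt := prod P Q
        fst := ⟨LinearMap.fst k P.V Q.V, fun _ _ => rfl⟩
        snd := ⟨LinearMap.snd k P.V Q.V, fun _ _ => rfl⟩
        inl := ⟨LinearMap.inl k P.V Q.V, fun a v => Prod.ext rfl (map_zero (Q.act a)).symm⟩
        inr := ⟨LinearMap.inr k P.V Q.V, fun a v => Prod.ext (map_zero (P.act a)).symm rfl⟩
        inl_fst := rfl
        inl_snd := rfl
        inr_fst := rfl
        inr_snd := rfl }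
      (hom_ext (LinearMap.ext fun v => Prod.ext (add_zero _) (zero_add _)))⟩
  exact hasFiniteProducts_of_has_binary_and_terminal

theorem isVectorialFunctor_forget : IsVectorialFunctor k (forget k H) where
  additive := ⟨rfl⟩
  linear := ⟨fun _ _ => rfl⟩
  faithful := ⟨fun e => hom_ext (congrArg ModuleCat.Hom.hom e)⟩
  finite X := X.finiteDimensional
  hasFiniteProducts := hasFiniteProducts
  lift {K X Z} i g hi hr := by
    obtain ⟨f, hf⟩ := LinearMap.exists_comp_eq_of_range_le i.f g.f hi hr
    have hf' := LinearMap.congr_fun hf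
    simp only [LinearMap.comp_apply] at hf'
    -- The linear factorization is `H`-linear because this may be checked after applying the
    -- injective `H`-map `i`.
    refine ⟨⟨f, fun a v => hi ?_⟩, hom_ext hf⟩
    change i.f (f _) = i.f _
    rw [hf', g.comm, i.comm, hf']
  desc {X Q Z} p g hp hr := by
    obtain ⟨f, hf⟩ := LinearMap.exists_eq_comp_of_ker_le p.f g.f hp hr
    have hf' := LinearMap.congr_fun hf
    simp only [LinearMap.comp_apply] at hf'
    refine ⟨⟨f, fun a v => ?_⟩, hom_ext hf⟩
    -- Dually, `H`-linearity is checked on images under the surjective `H`-map `p`.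
    obtain ⟨x, rfl⟩ : ∃ x, p.f x = v := hp v
    rw [← p.comm, hf', hf', g.comm]
  exists_kernel {X Y} f :=
    ⟨X.sub (LinearMap.ker f.f) fun a v hv => by
        rw [LinearMap.mem_ker] at hv ⊢
        rw [f.comm, hv, map_zero],
      ⟨(LinearMap.ker f.f).subtype, fun _ _ => rfl⟩, Subtype.val_injective,
      Submodule.range_subtype _⟩
  exists_cokernel {X Y} f :=
    ⟨Y.quot (LinearMap.range f.f) (by
        rintro a _ ⟨v, rfl⟩
        exact ⟨X.act a v, f.comm a v⟩),
      ⟨(LinearMap.range f.f).mkQ, fun _ _ => rfl⟩, Submodule.mkQ_surjective _,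
      Submodule.ker_mkQ _⟩

theorem monoidalPreadditive : MonoidalPreadditive (FinDimRep k H) where
  whiskerLeft_zero := hom_ext (TensorProduct.ext' fun _ _ => TensorProduct.tmul_zero _ _)
  zero_whiskerRight := hom_ext (TensorProduct.ext' fun _ _ => TensorProduct.zero_tmul _ _)
  whiskerLeft_add _ _ := hom_ext (TensorProduct.ext' fun _ _ => TensorProduct.tmul_add _ _ _)
  add_whiskerRight _ _ := hom_ext (TensorProduct.ext' fun _ _ => TensorProduct.add_tmul _ _ _)

theorem monoidalLinear :
    letI := monoidalPreadditive (k := k) (H := H); MonoidalLinear k (FinDimRep k H) :=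
  letI := monoidalPreadditive (k := k) (H := H)
  { whiskerLeft_smul := fun _ _ _ _ _ =>
      hom_ext (TensorProduct.ext' fun _ _ => TensorProduct.tmul_smul _ _ _)
    smul_whiskerRight := fun _ _ _ _ _ =>
      hom_ext (TensorProduct.ext' fun _ _ => (TensorProduct.smul_tmul' _ _ _).symm) }

end Vectorial

/-! ### Duals of representations. -/

section Dual

variable {k : Type u} [Field k] {H : Type v₁} [Ring H] [Bialgebra k H]

/-- The action of `H` on the dual vector space given by an antiendomorphism of `H`. -/
def dualAct {V : Type u} [AddCommGroup V] [Module k V] (p : H →ₐ[k] Module.End k V)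
    (S : H →ₗ[k] H) (h1 : S 1 = 1) (hmul : ∀ a b, S (a * b) = S b * S a) :
    H →ₐ[k] Module.End k (Module.Dual k V) :=
  AlgHom.ofLinearMap
    { toFun := fun a => (p (S a)).dualMap
      map_add' := fun a b => LinearMap.ext fun f => LinearMap.ext fun v => by simp
      map_smul' := fun x a => LinearMap.ext fun f => LinearMap.ext fun v => by simp }
    (LinearMap.ext fun f => LinearMap.ext fun v => by simp [h1])
    (fun a b => LinearMap.ext fun f => LinearMap.ext fun v => by simp [hmul])

section

variable {V : Type u} [AddCommGroup V] [Module k V] (S : H →ₗ[k] H) {p : H →ₐ[k] Module.End k V}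
  {d : H →ₐ[k] Module.End k (Module.Dual k V)} (hd : ∀ a f v, d a f v = f (p (S a) v))

include hd

/-- Evaluating `a · (f ⊗ v)` gives `f (S(a₁) a₂ v)`, which is `ε(a) f(v)`. Here and below, `key`
treats an arbitrary tensor in `H ⊗ H`, so that induction applies, before it is specialized to the
comultiplication. -/
theorem contractLeft_tensorAct (a : H) (hS : LinearMap.mul' k H (S.rTensor H (Coalgebra.comul a)) =
    algebraMap k H (Coalgebra.counit a)) (t : Module.Dual k V ⊗[k] V) :
    contractLeft k V (tensorAct d p a t) = Coalgebra.counit (R := k) a * contractLeft k V t := by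
  induction t with
  | zero => simp only [map_zero, mul_zero]
  | add x y hx hy => simp only [map_add, hx, hy, mul_add]
  | tmul f v =>
    have key : ∀ x : H ⊗[k] H, contractLeft k V (act₂ d p x (f ⊗ₜ v)) =
        f (p (LinearMap.mul' k H (S.rTensor H x)) v) := by
      intro x
      induction x with
      | zero => simp only [map_zero, LinearMap.zero_apply]
      | add x y hx hy => simp only [map_add, LinearMap.add_apply, hx, hy]
      | tmul a b => simp [act₂_tmul, contractLeft_apply, hd]
    rw [tensorAct_apply, key, hS]
    simp [contractLeft_apply, Algebra.algebraMap_eq_smul_one]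

/-- With the factors exchanged the evaluation produces `f (S(a₂) a₁ v)`; this order forces the
inverse antipode for left duals. -/
theorem contractRight_tensorAct (a : H) (hS : LinearMap.mul' k H (TensorProduct.comm k H H
      (S.lTensor H (Coalgebra.comul a))) = algebraMap k H (Coalgebra.counit a))
    (t : V ⊗[k] Module.Dual k V) :
    contractRight k V (tensorAct p d a t) = Coalgebra.counit (R := k) a * contractRight k V t := by
  induction t with
  | zero => simp only [map_zero, mul_zero]
  | add x y hx hy => simp only [map_add, hx, hy, mul_add]
  | tmul v f =>
    have key : ∀ x : H ⊗[k] H, contractRight k V (act₂ p d x (v ⊗ₜ f)) =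
        f (p (LinearMap.mul' k H (TensorProduct.comm k H H (S.lTensor H x))) v) := by
      intro x
      induction x with
      | zero => simp only [map_zero, LinearMap.zero_apply]
      | add x y hx hy => simp only [map_add, LinearMap.add_apply, hx, hy]
      | tmul a b => simp [act₂_tmul, contractRight_apply, hd]
    rw [tensorAct_apply, key, hS]
    simp [contractRight_apply, Algebra.algebraMap_eq_smul_one]

/-- Applied to the coevaluation tensor, which corresponds to the identity, this yields the operator
of `b S(a)`. -/
theorem dualTensorHom_map (a b : H) (t : Module.Dual k V ⊗[k] V) :
    dualTensorHom k V V (TensorProduct.map (d a) (p b) t) =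
      p b ∘ₗ dualTensorHom k V V t ∘ₗ p (S a) := by
  induction t with
  | zero => simp
  | add x y hx hy => simp only [map_add, hx, hy, LinearMap.comp_add, LinearMap.add_comp]
  | tmul f v => exact LinearMap.ext fun w => by simp [hd]

variable [FiniteDimensional k V]

/-- Seen as an endomorphism of `V`, the coevaluation is the identity, and `a` transforms it into the
operator of `a₁ S(a₂) = ε(a)`. -/
theorem tensorAct_coevaluation (a : H)
    (hS : LinearMap.mul' k H (S.lTensor H (Coalgebra.comul a)) =
      algebraMap k H (Coalgebra.counit a)) (x : k) :
    tensorAct p d a (coevaluation k V x) =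
      coevaluation k V (Coalgebra.counit (R := k) a * x) := by
  have key : ∀ x : H ⊗[k] H, dualTensorHom k V V (TensorProduct.comm k V (Module.Dual k V)
      (act₂ p d x (coevaluation k V 1))) = p (LinearMap.mul' k H (S.lTensor H x)) := by
    intro x
    induction x with
    | zero => simp only [map_zero, LinearMap.zero_apply]
    | add x y hx hy => simp only [map_add, LinearMap.add_apply, hx, hy]
    | tmul a b =>
      rw [act₂_tmul, ← TensorProduct.map_comm, dualTensorHom_map S hd]
      have := dualTensorHom_coevaluationComm (k := k) (V := V)
      rw [coevaluationComm, LinearMap.comp_apply, LinearEquiv.coe_coe] at this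
      rw [this, LinearMap.id_comp, LinearMap.lTensor_tmul, LinearMap.mul'_apply, map_mul]
      rfl
  have h1 : tensorAct p d a (coevaluation k V 1) =
      (Coalgebra.counit (R := k) a) • coevaluation k V 1 := by
    apply (TensorProduct.comm k V (Module.Dual k V)).injective
    apply dualTensorHom_injective
    rw [tensorAct_apply, key, hS, map_smul, map_smul]
    have := dualTensorHom_coevaluationComm (k := k) (V := V)
    rw [coevaluationComm, LinearMap.comp_apply, LinearEquiv.coe_coe] at this
    rw [this, AlgHom.commutes]
    rfl
  have hx : x = x • (1 : k) := by simp
  rw [hx, mul_smul_comm, map_smul, map_smul, map_smul, h1, mul_one, ← map_smul, smul_eq_mul,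
    mul_one]

/-- As for `tensorAct_coevaluation`, but the order of the factors now gives the operator of `a₂
S(a₁)`. -/
theorem tensorAct_coevaluationComm (a : H)
    (hS : LinearMap.mul' k H (TensorProduct.comm k H H
      (S.rTensor H (Coalgebra.comul a))) = algebraMap k H (Coalgebra.counit a)) (x : k) :
    tensorAct d p a (coevaluationComm k V x) =
      coevaluationComm k V (Coalgebra.counit (R := k) a * x) := by
  have key : ∀ x : H ⊗[k] H, dualTensorHom k V V (act₂ d p x (coevaluationComm k V 1)) =
      p (LinearMap.mul' k H (TensorProduct.comm k H H (S.rTensor H x))) := by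
    intro x
    induction x with
    | zero => simp only [map_zero, LinearMap.zero_apply]
    | add x y hx hy => simp only [map_add, LinearMap.add_apply, hx, hy]
    | tmul a b =>
      rw [act₂_tmul, dualTensorHom_map S hd, dualTensorHom_coevaluationComm, LinearMap.id_comp,
        LinearMap.rTensor_tmul, TensorProduct.comm_tmul, LinearMap.mul'_apply, map_mul]
      rfl
  have h1 : tensorAct d p a (coevaluationComm k V 1) =
      (Coalgebra.counit (R := k) a) • coevaluationComm k V 1 := by
    apply dualTensorHom_injective
    rw [tensorAct_apply, key, hS, map_smul, dualTensorHom_coevaluationComm, AlgHom.commutes]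
    rfl
  have hx : x = x • (1 : k) := by simp
  rw [hx, mul_smul_comm, map_smul, map_smul, map_smul, h1, mul_one, ← map_smul, smul_eq_mul,
    mul_one]

end

/-- `V*` is a right dual of `V` if `S(a₁) a₂ = ε(a) = a₁ S(a₂)`. -/
theorem nonempty_hasRightDual (S : H →ₗ[k] H) (h1 : S 1 = 1)
    (hmul : ∀ a b, S (a * b) = S b * S a)
    (hl : ∀ a, LinearMap.mul' k H (S.rTensor H (Coalgebra.comul a)) =
      algebraMap k H (Coalgebra.counit a))
    (hr : ∀ a, LinearMap.mul' k H (S.lTensor H (Coalgebra.comul a)) =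
      algebraMap k H (Coalgebra.counit a))
    (P : FinDimRep k H) : Nonempty (HasRightDual P) :=
  have hd : ∀ a f v, dualAct P.act S h1 hmul a f v = f (P.act (S a) v) := fun _ _ _ => rfl
  ⟨{ rightDual := ⟨Module.Dual k P.V, dualAct P.act S h1 hmul⟩
     exact :=
      { coevaluation' := ⟨coevaluation k P.V, fun a x =>
          (tensorAct_coevaluation S hd a (hr a) x).symm⟩
        evaluation' := ⟨contractLeft k P.V, fun a t => contractLeft_tensorAct S hd a (hl a) t⟩
        coevaluation_evaluation' := hom_ext (contractLeft_assoc_coevaluation k P.V)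
        evaluation_coevaluation' := hom_ext (contractLeft_assoc_coevaluation' k P.V) } }⟩

/-- `V*` is a left dual of `V` if `S(a₂) a₁ = ε(a) = a₂ S(a₁)`. -/
theorem nonempty_hasLeftDual (S : H →ₗ[k] H) (h1 : S 1 = 1)
    (hmul : ∀ a b, S (a * b) = S b * S a)
    (hl : ∀ a, LinearMap.mul' k H (TensorProduct.comm k H H (S.lTensor H (Coalgebra.comul a))) =
      algebraMap k H (Coalgebra.counit a))
    (hr : ∀ a, LinearMap.mul' k H (TensorProduct.comm k H H (S.rTensor H (Coalgebra.comul a))) =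
      algebraMap k H (Coalgebra.counit a))
    (P : FinDimRep k H) : Nonempty (HasLeftDual P) :=
  have hd : ∀ a f v, dualAct P.act S h1 hmul a f v = f (P.act (S a) v) := fun _ _ _ => rfl
  ⟨{ leftDual := ⟨Module.Dual k P.V, dualAct P.act S h1 hmul⟩
     exact :=
      { coevaluation' := ⟨coevaluationComm k P.V, fun a x =>
          (tensorAct_coevaluationComm S hd a (hr a) x).symm⟩
        evaluation' := ⟨contractRight k P.V, fun a t => contractRight_tensorAct S hd a (hl a) t⟩
        coevaluation_evaluation' := hom_ext contractRight_assoc_coevaluationComm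
        evaluation_coevaluation' := hom_ext contractRight_assoc_coevaluationComm' } }⟩

end Dual

/-! ### Rigidity from a bijective antipode. -/

section Hopf

variable {k : Type u} [Field k] {H : Type v₁} [Ring H] [HopfAlgebra k H]

/-- The finite dimensional representations of a Hopf algebra with bijective antipode form a
tensor category. -/
theorem isTensorCategory (hS : Function.Bijective (HopfAlgebra.antipode k (A := H))) :
    IsTensorCategory k (FinDimRep k H) := by
  let S := HopfAlgebra.antipode k (A := H)
  -- Right duals use the antipode `S`, left duals its inverse `S'`.
  let S' : H →ₗ[k] H := (LinearEquiv.ofBijective S hS).symm.toLinearMap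
  have hSS' : ∀ a, S (S' a) = a := (LinearEquiv.ofBijective S hS).apply_symm_apply
  have hmul : ∀ a b, S' (a * b) = S' b * S' a := fun a b => hS.1 (by
    change S _ = S _
    rw [hSS', HopfAlgebra.antipode_mul_antidistrib]
    change _ = S (S' a) * S (S' b)
    rw [hSS', hSS'])
  have h1 : S' 1 = 1 := hS.1 (by
    change S _ = S _
    rw [hSS']
    exact HopfAlgebra.antipode_one.symm)
  have hε : ∀ x : k, S (algebraMap k H x) = algebraMap k H x := fun x => by
    rw [Algebra.algebraMap_eq_smul_one, map_smul]
    exact congrArg _ HopfAlgebra.antipode_one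
  -- Since `S` reverses products, it sends `S'(a₂) a₁` to `S(a₁) a₂`; likewise in `hr` it sends `a₂
  -- S'(a₁)` to `a₁ S(a₂)`. The identities needed for `S'` thus become the antipode axioms once the
  -- injective map `S` is applied.
  have hl : ∀ x : H ⊗[k] H, S (LinearMap.mul' k H (TensorProduct.comm k H H (S'.lTensor H x))) =
      LinearMap.mul' k H (S.rTensor H x) := by
    intro x
    induction x with
    | zero => simp only [map_zero]
    | add x y hx hy => simp only [map_add, hx, hy]
    | tmul a b =>
      rw [LinearMap.lTensor_tmul, TensorProduct.comm_tmul, LinearMap.mul'_apply,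
        LinearMap.rTensor_tmul, LinearMap.mul'_apply]
      refine (HopfAlgebra.antipode_mul_antidistrib _ _).trans ?_
      exact congrArg (S a * ·) (hSS' b)
  have hr : ∀ x : H ⊗[k] H, S (LinearMap.mul' k H (TensorProduct.comm k H H (S'.rTensor H x))) =
      LinearMap.mul' k H (S.lTensor H x) := by
    intro x
    induction x with
    | zero => simp only [map_zero]
    | add x y hx hy => simp only [map_add, hx, hy]
    | tmul a b =>
      rw [LinearMap.rTensor_tmul, TensorProduct.comm_tmul, LinearMap.mul'_apply,
        LinearMap.lTensor_tmul, LinearMap.mul'_apply]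
      refine (HopfAlgebra.antipode_mul_antidistrib _ _).trans ?_
      exact congrArg (· * S b) (hSS' a)
  refine isVectorialFunctor_forget.isTensorCategory monoidalPreadditive monoidalLinear ?_ ?_ ?_
  · refine nonempty_hasLeftDual S' h1 hmul (fun a => hS.1 ?_) (fun a => hS.1 ?_)
    · exact (hl _).trans ((HopfAlgebra.mul_antipode_rTensor_comul_apply a).trans (hε _).symm)
    · exact (hr _).trans ((HopfAlgebra.mul_antipode_lTensor_comul_apply a).trans (hε _).symm)
  · exact nonempty_hasRightDual S HopfAlgebra.antipode_one HopfAlgebra.antipode_mul_antidistrib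
      HopfAlgebra.mul_antipode_rTensor_comul_apply HopfAlgebra.mul_antipode_lTensor_comul_apply
  · exact Module.finrank_self k

end Hopf

end FinDimRep

/-! ## The fusion category of graded vector spaces -/

namespace GrVect

/-! ### Abelian structure of the category of graded vector spaces. -/

section Vectorial

variable {k : Type u} [Field k] {Γ : Type w} [Fintype Γ]

variable (k Γ) in
/-- The underlying vector space. -/
def forget : GrVect k Γ ⥤ ModuleCat.{u} k where
  obj P := ModuleCat.of k P.V
  map f := ModuleCat.ofHom f.f

/-- Graded subspaces. -/
def sub (P : GrVect k Γ) (S : Submodule k P.V) (hS : ∀ s, ∀ v ∈ S, P.proj s v ∈ S) :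
    GrVect k Γ where
  V := S
  proj s := (P.proj s).restrict (hS s)
  proj_self s v := Subtype.ext (P.proj_self s v)
  proj_ne s t v h := Subtype.ext (P.proj_ne s t v h)
  sum_proj v := Subtype.ext (by
    rw [AddSubmonoidClass.coe_finsetSum]
    exact P.sum_proj v)

/-- Graded quotients. -/
def quot (P : GrVect k Γ) (S : Submodule k P.V) (hS : ∀ s, ∀ v ∈ S, P.proj s v ∈ S) :
    GrVect k Γ where
  V := P.V ⧸ S
  proj s := S.mapQ S (P.proj s) (hS s)
  proj_self s v := by
    obtain ⟨v, rfl⟩ := S.mkQ_surjective v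
    simp [P.proj_self]
  proj_ne s t v h := by
    obtain ⟨v, rfl⟩ := S.mkQ_surjective v
    simp [P.proj_ne _ _ _ h]
  sum_proj v := by
    obtain ⟨v, rfl⟩ := S.mkQ_surjective v
    have := congrArg S.mkQ (P.sum_proj v)
    rwa [map_sum] at this

/-- The direct sum of two graded vector spaces. -/
def prod (P Q : GrVect k Γ) : GrVect k Γ where
  V := P.V × Q.V
  proj s := (P.proj s).prodMap (Q.proj s)
  proj_self s v := Prod.ext (P.proj_self s _) (Q.proj_self s _)
  proj_ne s t v h := Prod.ext (P.proj_ne s t _ h) (Q.proj_ne s t _ h)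
  sum_proj v := Prod.ext (by simp [Prod.fst_sum, P.sum_proj]) (by simp [Prod.snd_sum, Q.sum_proj])

theorem hasFiniteProducts : HasFiniteProducts (GrVect k Γ) := by
  have : HasTerminal (GrVect k Γ) := by
    let Z : GrVect k Γ := ⟨PUnit, 0, fun _ _ => rfl, fun _ _ _ _ => rfl, fun _ => rfl⟩
    have hZ : IsZero Z := by
      rw [IsZero.iff_id_eq_zero]
      exact hom_ext (LinearMap.ext fun _ => rfl)
    exact IsTerminal.hasTerminal hZ.isTerminal
  have : HasBinaryBiproducts (GrVect k Γ) := ⟨fun P Q =>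
    hasBinaryBiproduct_of_total
      { pt := prod P Q
        fst := ⟨LinearMap.fst k P.V Q.V, fun _ _ => rfl⟩
        snd := ⟨LinearMap.snd k P.V Q.V, fun _ _ => rfl⟩
        inl := ⟨LinearMap.inl k P.V Q.V, fun a v => Prod.ext rfl (map_zero (Q.proj a)).symm⟩
        inr := ⟨LinearMap.inr k P.V Q.V, fun a v => Prod.ext (map_zero (P.proj a)).symm rfl⟩
        inl_fst := rfl
        inl_snd := rfl
        inr_fst := rfl
        inr_snd := rfl }
      (hom_ext (LinearMap.ext fun v => Prod.ext (add_zero _) (zero_add _)))⟩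
  exact hasFiniteProducts_of_has_binary_and_terminal

theorem isVectorialFunctor_forget : IsVectorialFunctor k (forget k Γ) where
  additive := ⟨rfl⟩
  linear := ⟨fun _ _ => rfl⟩
  faithful := ⟨fun e => hom_ext (congrArg ModuleCat.Hom.hom e)⟩
  finite X := X.finiteDimensional
  hasFiniteProducts := hasFiniteProducts
  lift {K X Z} i g hi hr := by
    obtain ⟨f, hf⟩ := LinearMap.exists_comp_eq_of_range_le i.f g.f hi hr
    have hf' := LinearMap.congr_fun hf
    simp only [LinearMap.comp_apply] at hf'
    refine ⟨⟨f, fun a v => hi ?_⟩, hom_ext hf⟩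
    change i.f (f _) = i.f _
    rw [hf', g.comm, i.comm, hf']
  desc {X Q Z} p g hp hr := by
    obtain ⟨f, hf⟩ := LinearMap.exists_eq_comp_of_ker_le p.f g.f hp hr
    have hf' := LinearMap.congr_fun hf
    simp only [LinearMap.comp_apply] at hf'
    refine ⟨⟨f, fun a v => ?_⟩, hom_ext hf⟩
    obtain ⟨x, rfl⟩ : ∃ x, p.f x = v := hp v
    rw [← p.comm, hf', hf', g.comm]
  exists_kernel {X Y} f :=
    ⟨X.sub (LinearMap.ker f.f) fun a v hv => by
        rw [LinearMap.mem_ker] at hv ⊢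
        rw [f.comm, hv, map_zero],
      ⟨(LinearMap.ker f.f).subtype, fun _ _ => rfl⟩, Subtype.val_injective,
      Submodule.range_subtype _⟩
  exists_cokernel {X Y} f :=
    ⟨Y.quot (LinearMap.range f.f) (by
        rintro a _ ⟨v, rfl⟩
        exact ⟨X.proj a v, f.comm a v⟩),
      ⟨(LinearMap.range f.f).mkQ, fun _ _ => rfl⟩, Submodule.mkQ_surjective _,
      Submodule.ker_mkQ _⟩

end Vectorial

/-! ### Bilinearity of the tensor product and duals of graded vector spaces. -/

section Monoidal

variable {k : Type u} [Field k] {Γ : Type w} [Group Γ] [Fintype Γ]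

theorem monoidalPreadditive : MonoidalPreadditive (GrVect k Γ) where
  whiskerLeft_zero := hom_ext (TensorProduct.ext' fun _ _ => TensorProduct.tmul_zero _ _)
  zero_whiskerRight := hom_ext (TensorProduct.ext' fun _ _ => TensorProduct.zero_tmul _ _)
  whiskerLeft_add _ _ := hom_ext (TensorProduct.ext' fun _ _ => TensorProduct.tmul_add _ _ _)
  add_whiskerRight _ _ := hom_ext (TensorProduct.ext' fun _ _ => TensorProduct.add_tmul _ _ _)

theorem monoidalLinear :
    letI := monoidalPreadditive (k := k) (Γ := Γ); MonoidalLinear k (GrVect k Γ) :=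
  letI := monoidalPreadditive (k := k) (Γ := Γ)
  { whiskerLeft_smul := fun _ _ _ _ _ =>
      hom_ext (TensorProduct.ext' fun _ _ => TensorProduct.tmul_smul _ _ _)
    smul_whiskerRight := fun _ _ _ _ _ =>
      hom_ext (TensorProduct.ext' fun _ _ => (TensorProduct.smul_tmul' _ _ _).symm) }

/-- The projections of the dual vector space. -/
def dualProj (P : GrVect k Γ) (s : Γ) : Module.Dual k P.V →ₗ[k] Module.Dual k P.V :=
  (P.proj s⁻¹).dualMap

theorem dualProj_apply (P : GrVect k Γ) (s : Γ) (f : Module.Dual k P.V) (v : P.V) :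
    P.dualProj s f v = f (P.proj s⁻¹ v) := rfl

/-- The dual graded vector space. -/
def dual (P : GrVect k Γ) : GrVect k Γ where
  V := Module.Dual k P.V
  proj := P.dualProj
  proj_self s f := LinearMap.ext fun v => by simp only [dualProj_apply, P.proj_self]
  proj_ne s t f h := LinearMap.ext fun v => by
    simp only [dualProj_apply, LinearMap.zero_apply]
    rw [P.proj_ne _ _ _ fun e => h (inv_injective e).symm, map_zero]
  sum_proj f := LinearMap.ext fun v => by
    rw [LinearMap.sum_apply]
    simp only [dualProj_apply]
    rw [← map_sum]
    exact congrArg f ((Equiv.sum_comp (Equiv.inv Γ) fun s => P.proj s v).trans (P.sum_proj v))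

/-- The two degrees `t` and `(t⁻¹ s)⁻¹` agree exactly when `s = 1`. Otherwise every term vanishes,
and for `s = 1` the projections sum to the identity. Of the four variants, the unprimed ones serve
the coevaluations and the primed ones the evaluations. -/
theorem sum_proj_proj_left (P : GrVect k Γ) (s : Γ) :
    ∑ t, P.proj t ∘ₗ P.proj (t⁻¹ * s)⁻¹ = unitProj k s 1 • LinearMap.id := by
  refine LinearMap.ext fun v => ?_
  simp only [LinearMap.sum_apply, LinearMap.comp_apply, LinearMap.smul_apply, LinearMap.id_apply]
  by_cases hs : s = 1
  · subst hs
    simp [unitProj_one, P.proj_self, P.sum_proj]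
  · rw [unitProj_ne hs, LinearMap.zero_apply, zero_smul]
    refine Finset.sum_eq_zero fun t _ => P.proj_ne _ _ _ ?_
    rw [mul_inv_rev, inv_inv]
    exact fun e => hs (by simpa using e)

theorem sum_proj_proj_right (P : GrVect k Γ) (s : Γ) :
    ∑ t, P.proj (t⁻¹ * s) ∘ₗ P.proj t⁻¹ = unitProj k s 1 • LinearMap.id := by
  refine LinearMap.ext fun v => ?_
  simp only [LinearMap.sum_apply, LinearMap.comp_apply, LinearMap.smul_apply, LinearMap.id_apply]
  by_cases hs : s = 1
  · subst hs
    simp only [unitProj_one, P.proj_self, mul_one, LinearMap.id_apply, one_smul]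
    exact (Equiv.sum_comp (Equiv.inv Γ) fun s => P.proj s v).trans (P.sum_proj v)
  · rw [unitProj_ne hs, LinearMap.zero_apply, zero_smul]
    exact Finset.sum_eq_zero fun t _ => P.proj_ne _ _ _ fun e => hs (by simpa using e)

theorem sum_proj_proj_left' (P : GrVect k Γ) (s : Γ) :
    ∑ t, P.proj (t⁻¹ * s)⁻¹ ∘ₗ P.proj t = unitProj k s 1 • LinearMap.id := by
  refine LinearMap.ext fun v => ?_
  simp only [LinearMap.sum_apply, LinearMap.comp_apply, LinearMap.smul_apply, LinearMap.id_apply]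
  by_cases hs : s = 1
  · subst hs
    simp [unitProj_one, P.proj_self, P.sum_proj]
  · rw [unitProj_ne hs, LinearMap.zero_apply, zero_smul]
    refine Finset.sum_eq_zero fun t _ => P.proj_ne _ _ _ ?_
    rw [mul_inv_rev, inv_inv]
    exact fun e => hs (by simpa using e)

theorem sum_proj_proj_right' (P : GrVect k Γ) (s : Γ) :
    ∑ t, P.proj t⁻¹ ∘ₗ P.proj (t⁻¹ * s) = unitProj k s 1 • LinearMap.id := by
  refine LinearMap.ext fun v => ?_
  simp only [LinearMap.sum_apply, LinearMap.comp_apply, LinearMap.smul_apply, LinearMap.id_apply]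
  by_cases hs : s = 1
  · subst hs
    simp only [unitProj_one, P.proj_self, mul_one, LinearMap.id_apply, one_smul]
    exact (Equiv.sum_comp (Equiv.inv Γ) fun s => P.proj s v).trans (P.sum_proj v)
  · rw [unitProj_ne hs, LinearMap.zero_apply, zero_smul]
    exact Finset.sum_eq_zero fun t _ => P.proj_ne _ _ _ fun e => hs (by simpa using e)

-- The projection of the unit object is multiplication by the scalar `unitProj k s 1`, the indicator
-- of `s = 1`; the four sums above are expressed through this scalar.
omit [Fintype Γ] in
theorem unitProj_apply (s : Γ) (x : k) : unitProj k s x = unitProj k s 1 * x := by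
  by_cases hs : s = 1
  · subst hs; simp [unitProj_one]
  · simp [unitProj_ne hs]

theorem contractLeft_tensorProj (P : GrVect k Γ) (s : Γ) (t : Module.Dual k P.V ⊗[k] P.V) :
    contractLeft k P.V (tensorProj P.dualProj P.proj s t) =
      unitProj k s (contractLeft k P.V t) := by
  induction t with
  | zero => simp only [map_zero]
  | add x y hx hy => simp only [map_add, hx, hy]
  | tmul f v =>
    rw [tensorProj_tmul, map_sum, unitProj_apply]
    simp only [contractLeft_apply, dualProj_apply]
    have := congrArg f (LinearMap.congr_fun (P.sum_proj_proj_right' s) v)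
    simpa [LinearMap.sum_apply] using this

theorem contractRight_tensorProj (P : GrVect k Γ) (s : Γ) (t : P.V ⊗[k] Module.Dual k P.V) :
    contractRight k P.V (tensorProj P.proj P.dualProj s t) =
      unitProj k s (contractRight k P.V t) := by
  induction t with
  | zero => simp only [map_zero]
  | add x y hx hy => simp only [map_add, hx, hy]
  | tmul v f =>
    rw [tensorProj_tmul, map_sum, unitProj_apply]
    simp only [contractRight_apply, dualProj_apply]
    have := congrArg f (LinearMap.congr_fun (P.sum_proj_proj_left' s) v)
    simpa [LinearMap.sum_apply] using this

theorem dualTensorHom_map_dualProj (P : GrVect k Γ) (s t : Γ) (x : Module.Dual k P.V ⊗[k] P.V) :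
    dualTensorHom k P.V P.V (TensorProduct.map (P.dualProj s) (P.proj t) x) =
      P.proj t ∘ₗ dualTensorHom k P.V P.V x ∘ₗ P.proj s⁻¹ := by
  induction x with
  | zero => simp
  | add x y hx hy => simp only [map_add, hx, hy, LinearMap.comp_add, LinearMap.add_comp]
  | tmul f v => exact LinearMap.ext fun w => by simp [dualProj_apply]

/-- The coevaluation has degree `1`. Under `dualTensorHom` its component in degree `s` becomes the
sum evaluated in `sum_proj_proj_left`. -/
theorem tensorProj_coevaluation (P : GrVect k Γ) (s : Γ) (x : k) :
    tensorProj P.proj P.dualProj s (coevaluation k P.V x) =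
      coevaluation k P.V (unitProj k s x) := by
  have h1 : tensorProj P.proj P.dualProj s (coevaluation k P.V 1) =
      unitProj k s 1 • coevaluation k P.V 1 := by
    apply (TensorProduct.comm k P.V (Module.Dual k P.V)).injective
    apply dualTensorHom_injective
    have := dualTensorHom_coevaluationComm (k := k) (V := P.V)
    rw [coevaluationComm, LinearMap.comp_apply, LinearEquiv.coe_coe] at this
    rw [tensorProj, LinearMap.sum_apply, map_sum, map_sum, map_smul, map_smul, this]
    simp only [← TensorProduct.map_comm, dualTensorHom_map_dualProj, this, LinearMap.id_comp]
    exact P.sum_proj_proj_left s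
  have hx : x = x • (1 : k) := by simp
  rw [hx, map_smul, map_smul, map_smul, map_smul, h1, ← map_smul (coevaluation k P.V),
    smul_eq_mul, mul_one]

theorem tensorProj_coevaluationComm (P : GrVect k Γ) (s : Γ) (x : k) :
    tensorProj P.dualProj P.proj s (coevaluationComm k P.V x) =
      coevaluationComm k P.V (unitProj k s x) := by
  have h1 : tensorProj P.dualProj P.proj s (coevaluationComm k P.V 1) =
      unitProj k s 1 • coevaluationComm k P.V 1 := by
    apply dualTensorHom_injective
    rw [tensorProj, LinearMap.sum_apply, map_sum, map_smul, dualTensorHom_coevaluationComm]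
    simp only [dualTensorHom_map_dualProj, dualTensorHom_coevaluationComm, LinearMap.id_comp]
    exact P.sum_proj_proj_right s
  have hx : x = x • (1 : k) := by simp
  rw [hx, map_smul, map_smul, map_smul, map_smul, h1, ← map_smul (coevaluationComm k P.V),
    smul_eq_mul, mul_one]

theorem nonempty_hasRightDual (P : GrVect k Γ) : Nonempty (HasRightDual P) :=
  ⟨{ rightDual := P.dual
     exact :=
      { coevaluation' := ⟨coevaluation k P.V, fun s x => (P.tensorProj_coevaluation s x).symm⟩
        evaluation' := ⟨contractLeft k P.V, P.contractLeft_tensorProj⟩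
        coevaluation_evaluation' := hom_ext (contractLeft_assoc_coevaluation k P.V)
        evaluation_coevaluation' := hom_ext (contractLeft_assoc_coevaluation' k P.V) } }⟩

theorem nonempty_hasLeftDual (P : GrVect k Γ) : Nonempty (HasLeftDual P) :=
  ⟨{ leftDual := P.dual
     exact :=
      { coevaluation' := ⟨coevaluationComm k P.V,
          fun s x => (P.tensorProj_coevaluationComm s x).symm⟩
        evaluation' := ⟨contractRight k P.V, P.contractRight_tensorProj⟩
        coevaluation_evaluation' := hom_ext contractRight_assoc_coevaluationComm
        evaluation_coevaluation' := hom_ext contractRight_assoc_coevaluationComm' } }⟩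

theorem isTensorCategory : IsTensorCategory k (GrVect k Γ) :=
  isVectorialFunctor_forget.isTensorCategory monoidalPreadditive monoidalLinear
    nonempty_hasLeftDual nonempty_hasRightDual (Module.finrank_self k)

end Monoidal

/-! ### Simple objects, projectivity and semisimplicity. -/

section Concentrated

variable {k : Type u} [Field k] {Γ : Type w} [Fintype Γ]

section

variable (V : Type u) [AddCommGroup V] [Module k V]

open Classical in
/-- The projections of a vector space concentrated in degree `s`. -/
def concentratedProj (s t : Γ) : V →ₗ[k] V := if t = s then LinearMap.id else 0

omit [Fintype Γ] in
theorem concentratedProj_self (s : Γ) : concentratedProj (k := k) V s s = LinearMap.id :=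
  if_pos rfl

omit [Fintype Γ] in
theorem concentratedProj_ne {s t : Γ} (h : t ≠ s) : concentratedProj (k := k) V s t = 0 :=
  if_neg h

variable [FiniteDimensional k V]

/-- A vector space, concentrated in degree `s`. -/
def concentrated (s : Γ) : GrVect k Γ where
  V := V
  proj := concentratedProj V s
  proj_self t v := by
    by_cases ht : t = s
    · subst ht; simp [concentratedProj_self]
    · simp [concentratedProj_ne V ht]
  proj_ne t t' v h := by
    by_cases ht : t = s
    · subst ht; simp [concentratedProj_ne V h.symm]
    · simp [concentratedProj_ne V ht]
  sum_proj v := by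
    rw [Finset.sum_eq_single s]
    · simp [concentratedProj_self]
    · intro t _ ht
      simp [concentratedProj_ne V ht]
    · simp

variable {V} {s : Γ} {P : GrVect k Γ}

/-- A morphism from a space concentrated in one degree. -/
def ofConcentrated (f : V →ₗ[k] P.V) (hf : ∀ v, P.proj s (f v) = f v) :
    concentrated V s ⟶ P :=
  have key : ∀ t v, f (concentratedProj V s t v) = P.proj t (f v) := fun t v => by
    by_cases ht : t = s
    · subst ht
      rw [hf, concentratedProj_self, LinearMap.id_apply]
    · rw [concentratedProj_ne V ht, ← hf v, P.proj_ne _ _ _ ht, LinearMap.zero_apply, map_zero]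
  ⟨f, key⟩

/-- A morphism to a space concentrated in one degree. -/
def toConcentrated (f : P.V →ₗ[k] V) (hf : ∀ v, f (P.proj s v) = f v) :
    P ⟶ concentrated V s :=
  have key : ∀ t v, f (P.proj t v) = concentratedProj V s t (f v) := fun t v => by
    by_cases ht : t = s
    · subst ht
      rw [hf, concentratedProj_self, LinearMap.id_apply]
    · rw [concentratedProj_ne V ht, ← hf, P.proj_ne _ _ _ (Ne.symm ht), LinearMap.zero_apply,
        map_zero]
  ⟨f, key⟩

end

instance simple_concentrated (s : Γ) : Simple (concentrated (k := k) k s) :=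
  isVectorialFunctor_forget.simple_of_finrank_eq_one (Module.finrank_self k)

/-- A nonzero homogeneous vector, which exists because the projections sum to the identity, spans a
graded line in `X`; by simplicity this line is all of `X`. -/
theorem exists_iso_concentrated (X : GrVect k Γ) [Simple X] :
    ∃ s, Nonempty (X ≅ concentrated k s) := by
  obtain ⟨s, v, hv⟩ : ∃ s v, X.proj s v ≠ 0 := by
    by_contra! h
    refine id_nonzero X (hom_ext (LinearMap.ext fun v => ?_))
    change v = 0
    rw [← X.sum_proj v]
    exact Finset.sum_eq_zero fun s _ => h s v
  let f : concentrated k s ⟶ X := ofConcentrated (LinearMap.toSpanSingleton k X.V (X.proj s v))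
    fun x => by simp [X.proj_self]
  have := isVectorialFunctor_forget.mono_of_injective f (smul_left_injective k hv)
  have h0 : f ≠ 0 := fun e => hv (by
    have := LinearMap.congr_fun (congrArg Hom.f e) (1 : k)
    exact (one_smul k _).symm.trans this)
  have := isIso_of_mono_of_nonzero h0
  exact ⟨s, ⟨(asIso f).symm⟩⟩

/-- A linear section `l` of the surjection `e` need not respect degrees. The part of `l ∘ f` that
preserves them, the sum of `E.proj t ∘ l ∘ f ∘ P.proj t`, is still a lift because `e` and `f`
preserve degrees. -/
theorem projective (P : GrVect k Γ) : Projective P where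
  factors {E X} f e _ := by
    obtain ⟨l, hl⟩ := e.f.exists_rightInverse_of_surjective
      (LinearMap.range_eq_top.2 (isVectorialFunctor_forget.surjective_of_epi e))
    have hl' : ∀ x, e.f (l x) = x := LinearMap.congr_fun hl
    have hf : ∀ s v, (∑ t, E.proj t ∘ₗ l ∘ₗ f.f ∘ₗ P.proj t) (P.proj s v) =
        E.proj s (l (f.f (P.proj s v))) := fun s v => by
      rw [LinearMap.sum_apply, Finset.sum_eq_single s]
      · simp [P.proj_self]
      · intro t _ ht
        simp [P.proj_ne _ _ _ ht]
      · simp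
    refine ⟨⟨∑ t, E.proj t ∘ₗ l ∘ₗ f.f ∘ₗ P.proj t, fun s v => ?_⟩, hom_ext (LinearMap.ext fun v => ?_)⟩
    · rw [hf, LinearMap.sum_apply, map_sum, Finset.sum_eq_single s]
      · simp [E.proj_self]
      · intro t _ ht
        exact E.proj_ne _ _ _ ht.symm
      · simp
    · simp only [comp_f, LinearMap.comp_apply, LinearMap.sum_apply, map_sum]
      simp only [e.comm, hl', f.comm, X.proj_self]
      exact X.sum_proj _

open Classical in
/-- Every graded vector space has a basis of homogeneous elements. -/
theorem exists_homogeneous_basis (P : GrVect k Γ) : ∃ (n : ℕ) (b : Module.Basis (Fin n) k P.V)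
    (d : Fin n → Γ), ∀ i, P.proj (d i) (b i) = b i := by
  let b := P.isInternal.collectedBasis fun s => Module.finBasis k (P.component s)
  let e := Fintype.equivFin (Σ s, Fin (Module.finrank k (P.component s)))
  refine ⟨_, b.reindex e, fun i => (e.symm i).1, fun i => ?_⟩
  rw [Module.Basis.reindex_apply]
  obtain ⟨v, hv⟩ := P.isInternal.collectedBasis_mem
    (fun s => Module.finBasis k (P.component s)) (e.symm i)
  rw [← hv, P.proj_self]

theorem sum_f_apply {P Q : GrVect k Γ} {ι : Type*} (s : Finset ι) (F : ι → (P ⟶ Q)) (v : P.V) :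
    Hom.f (∑ i ∈ s, F i : P ⟶ Q) v = ∑ i ∈ s, Hom.f (F i) v := by
  classical
  induction s using Finset.induction_on with
  | empty => rfl
  | insert i s hi h => rw [Finset.sum_insert hi, Finset.sum_insert hi, add_f, LinearMap.add_apply, h]

/-- A homogeneous basis exhibits `X` itself as the biproduct of the lines spanned by its members. -/
theorem exists_semisimple_decomposition (X : GrVect k Γ) :
    ∃ (n : ℕ) (S : Fin n → GrVect k Γ), (∀ i, Simple (S i)) ∧
      ∃ b : Bicone S, Nonempty b.IsBilimit ∧ Nonempty (X ≅ b.pt) := by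
  classical
  obtain ⟨n, b, d, hd⟩ := X.exists_homogeneous_basis
  -- The coordinate `i` only sees degree `d i`; this is what makes it a morphism to a line
  -- concentrated in that degree.
  have hc : ∀ i v, b.coord i (X.proj (d i) v) = b.coord i v := fun i => by
    refine LinearMap.congr_fun (f := b.coord i ∘ₗ X.proj (d i)) (b.ext fun j => ?_)
    rw [LinearMap.comp_apply]
    by_cases h : d i = d j
    · rw [h, hd]
    · rw [← hd j, X.proj_ne _ _ _ h, map_zero, hd, Module.Basis.coord_apply,
        Module.Basis.repr_self, Finsupp.single_eq_of_ne (fun e => h (by rw [e]))]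
  let B : Bicone fun i => concentrated (k := k) k (d i) :=
    { pt := X
      π := fun i => toConcentrated (b.coord i) (hc i)
      ι := fun i => ofConcentrated (LinearMap.toSpanSingleton k X.V (b i)) fun x => by simp [hd]
      ι_π := fun i j => by
        by_cases h : i = j
        · subst h
          rw [dif_pos rfl, eqToHom_refl]
          refine hom_ext (LinearMap.ext fun (x : k) => ?_)
          change b.coord i (x • b i) = x
          simp
        · rw [dif_neg h]
          refine hom_ext (LinearMap.ext fun (x : k) => ?_)
          change b.coord j (x • b i) = 0
          simp [Finsupp.single_eq_of_ne (Ne.symm h)] }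
  refine ⟨n, _, fun i => simple_concentrated (d i), B, ⟨isBilimitOfTotal B ?_⟩, ⟨Iso.refl X⟩⟩
  refine hom_ext (LinearMap.ext fun v => ?_)
  rw [sum_f_apply]
  exact b.sum_repr v

end Concentrated

theorem isFusionCategory {k : Type u} [Field k] {Γ : Type w} [Group Γ] [Fintype Γ] :
    IsFusionCategory k (GrVect k Γ) where
  toIsTensorCategory := isTensorCategory
  -- Every object is projective, hence its own projective cover.
  enoughProjectives := ⟨fun X => ⟨{ p := X, projective := X.projective, f := 𝟙 X }⟩⟩
  finite_simples := by
    refine ⟨Fintype.card Γ, fun i => concentrated k ((Fintype.equivFin Γ).symm i), fun X _ => ?_⟩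
    obtain ⟨s, hs⟩ := X.exists_iso_concentrated
    exact ⟨Fintype.equivFin Γ s, by simpa using hs⟩
  semisimple := exists_semisimple_decomposition

end GrVect

/-! ## The crossed action on graded vector spaces -/

section SmulApply

variable {k : Type*} [Field k] {V W U V' : Type*} [AddCommGroup V] [Module k V] [AddCommGroup W]
  [Module k W] [AddCommGroup U] [Module k U] [AddCommGroup V'] [Module k V']

/-- With `TensorProduct.map_tmul_smul`, this is a calculus of scalars: maps that multiply a
homogeneous vector by a unit are composed and tensored by multiplying the units. A coherence axiom
becomes an equation in `kˣ`. -/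
theorem LinearMap.comp_apply_smul {f : V →ₗ[k] W} {g : W →ₗ[k] U} {v : V} {w : W} {z : U}
    {x y : kˣ} (h₁ : f v = (x : k) • w) (h₂ : g w = (y : k) • z) :
    (g ∘ₗ f) v = ((x * y : kˣ) : k) • z := by
  rw [LinearMap.comp_apply, h₁, map_smul, h₂, smul_smul, Units.val_mul]

theorem TensorProduct.map_tmul_smul {f : V →ₗ[k] W} {g : U →ₗ[k] V'} {v : V} {w : W} {z : U}
    {z' : V'} {x y : kˣ} (h₁ : f v = (x : k) • w) (h₂ : g z = (y : k) • z') :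
    TensorProduct.map f g (v ⊗ₜ z) = ((x * y : kˣ) : k) • (w ⊗ₜ[k] z') := by
  rw [TensorProduct.map_tmul, h₁, h₂, TensorProduct.smul_tmul_smul, Units.val_mul]

end SmulApply

namespace GrVect

section

variable {k : Type u} [Field k] {Γ : Type w} [Fintype Γ]

theorem ext_homogeneous (P : GrVect k Γ) {W : Type*} [AddCommGroup W] [Module k W]
    {f g : P.V →ₗ[k] W} (h : ∀ s v, P.proj s v = v → f v = g v) : f = g := by
  refine LinearMap.ext fun v => ?_
  rw [← P.sum_proj v, map_sum, map_sum]
  exact Finset.sum_congr rfl fun s _ => h s _ (P.proj_self s v)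

/-- Only the first factor needs to be homogeneous: in the crossed action the degree of the second is
fixed by hypothesis. -/
theorem ext_tmul_homogeneous (P : GrVect k Γ) {W U : Type*} [AddCommGroup W] [Module k W]
    [AddCommGroup U] [Module k U] {f g : P.V ⊗[k] U →ₗ[k] W}
    (h : ∀ s u v, P.proj s u = u → f (u ⊗ₜ v) = g (u ⊗ₜ v)) : f = g := by
  refine TensorProduct.ext' fun u v => ?_
  exact LinearMap.congr_fun (P.ext_homogeneous (f := f ∘ₗ (TensorProduct.mk k P.V U).flip v)
    (g := g ∘ₗ (TensorProduct.mk k P.V U).flip v) fun s u hu => h s u v hu) u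

theorem ext_tmul_tmul_homogeneous (P : GrVect k Γ) {W U N : Type*} [AddCommGroup W] [Module k W]
    [AddCommGroup U] [Module k U] [AddCommGroup N] [Module k N]
    {f g : (P.V ⊗[k] W) ⊗[k] U →ₗ[k] N}
    (h : ∀ s x y z, P.proj s x = x → f ((x ⊗ₜ y) ⊗ₜ z) = g ((x ⊗ₜ y) ⊗ₜ z)) : f = g := by
  refine TensorProduct.ext' fun t z => ?_
  exact LinearMap.congr_fun (P.ext_tmul_homogeneous
    (f := f ∘ₗ (TensorProduct.mk k (P.V ⊗[k] W) U).flip z)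
    (g := g ∘ₗ (TensorProduct.mk k (P.V ⊗[k] W) U).flip z) fun s x y hx => h s x y z hx) t

theorem scale_homogeneous (P : GrVect k Γ) (x : Γ → kˣ) {s : Γ} {v : P.V} (hv : P.proj s v = v) :
    P.scale x v = (x s : k) • v := by
  rw [← hv, P.scale_proj x rfl, scale_apply, proj_sum_smul P fun s => (x s : k)]

end

theorem tmul_homogeneous {k : Type u} [Field k] {Γ : Type w} [Group Γ] [Fintype Γ]
    {P Q : GrVect k Γ} {a b : Γ} {v : P.V} {w : Q.V} (hv : P.proj a v = v) (hw : Q.proj b w = w) :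
    tensorProj P.proj Q.proj (a * b) (v ⊗ₜ w) = v ⊗ₜ[k] w := by
  rw [tensorProj_tmul, Finset.sum_eq_single a]
  · rw [inv_mul_cancel_left, hv, hw]
  · intro t _ ht
    rw [← hv, P.proj_ne _ _ _ ht, TensorProduct.zero_tmul]
  · simp

end GrVect

namespace CocyclePair

variable {k : Type u} [Field k] {G : Type v} {Γ : Type w} [Group G] [Group Γ] [Fintype Γ]
  {M : MatchedPair G Γ} (c : CocyclePair k M)

omit [Fintype Γ] in
theorem ract_inv_cancel (s : Γ) (g : G) : M.ract (M.ract s g) g⁻¹ = s := by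
  rw [← M.ract_mul, mul_inv_cancel, M.ract_one]

omit [Fintype Γ] in
theorem ract_inv_cancel' (s : Γ) (g : G) : M.ract (M.ract s g⁻¹) g = s := by
  rw [← M.ract_mul, inv_mul_cancel, M.ract_one]

theorem regrade_homogeneous (g : G) {P : GrVect k Γ} {s : Γ} {v : P.V} (hv : P.proj s v = v) :
    ((M.regrade k g).obj P).proj (M.ract s g) v = v := by
  change P.proj (M.ract (M.ract s g) g⁻¹) v = v
  rw [ract_inv_cancel, hv]

theorem cast_f {g g' : G} (h : g = g') (P : GrVect k Γ) (v : P.V) :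
    (c.crossedActionData.cast h P).f v = v := by
  subst h
  rfl

/-- The scalar `1` brings the identity into the form required by `comp_apply_smul`; the `id` fixes
`P.V` as the module in which the scalar acts, rather than a regraded copy of it. -/
theorem cast_f_smul {g g' : G} (h : g = g') (P : GrVect k Γ) (v : P.V) :
    (c.crossedActionData.cast h P).f v = ((1 : kˣ) : k) • (id v : P.V) := by
  rw [Units.val_one, one_smul]
  exact c.cast_f h P v

theorem ρ₂_app (g h : G) {P : GrVect k Γ} {s : Γ} {v : P.V} (hv : P.proj s v = v) :
    ((c.crossedActionData.ρ₂ g h).hom.app P).f v = (((c.σ h g s)⁻¹ : kˣ) : k) • (id v : P.V) :=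
  P.scale_homogeneous _ hv

theorem γ_hom_f (g : G) (t : Γ) {P Q : GrVect k Γ} (hQ : Q.proj t = LinearMap.id) {s : Γ} {u : P.V}
    (hu : P.proj s u = u) (v : Q.V) :
    (c.crossedActionData.γ g t P Q hQ).hom.f (u ⊗ₜ v) =
      (((c.τ s t g)⁻¹ : kˣ) : k) • (id (u ⊗ₜ v) : P.V ⊗[k] Q.V) := by
  have h : P.scale (fun s => (c.τ s t g)⁻¹) u ⊗ₜ[k] v = (((c.τ s t g)⁻¹ : kˣ) : k) • (u ⊗ₜ[k] v) := by
    rw [P.scale_homogeneous _ hu, TensorProduct.smul_tmul']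
  exact h

theorem eq_one_smul {V : Type*} [AddCommGroup V] [Module k V] (v : V) :
    v = ((1 : kˣ) : k) • v := by
  rw [Units.val_one, one_smul]

-- The summands are the components `X_s`, with the subspace inclusion and the corestricted
-- projection as structure maps.
omit [Group Γ] in
theorem decomp (X : GrVect k Γ) : ∃ (Y : Γ → GrVect k Γ) (ι : ∀ s, Y s ⟶ X) (π : ∀ s, X ⟶ Y s),
    (∀ s, (Y s).proj s = LinearMap.id) ∧ (∀ s, ι s ≫ π s = 𝟙 (Y s)) ∧
    (∀ s t, s ≠ t → ι s ≫ π t = 0) ∧ ∑ s, π s ≫ ι s = 𝟙 X := by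
  have hmem : ∀ s (v : X.component s), X.proj s v = v := by
    rintro s ⟨_, v, rfl⟩
    exact X.proj_self s v
  refine ⟨fun s => GrVect.concentrated (X.component s) s,
    fun s => GrVect.ofConcentrated (X.component s).subtype (hmem s),
    fun s => GrVect.toConcentrated (X.proj s).rangeRestrict
      fun v => Subtype.ext (X.proj_self s v),
    fun s => GrVect.concentratedProj_self _ s, fun s => ?_, fun s t hst => ?_, ?_⟩
  · exact GrVect.hom_ext (LinearMap.ext fun v => Subtype.ext (hmem s v))
  · refine GrVect.hom_ext (LinearMap.ext fun v => Subtype.ext ?_)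
    change X.proj t (Subtype.val v) = 0
    rw [← hmem s v, X.proj_ne _ _ _ hst.symm]
  · refine GrVect.hom_ext (LinearMap.ext fun v => ?_)
    rw [GrVect.sum_f_apply]
    exact X.sum_proj v

theorem map_homog (g : G) (s : Γ) :
    (c.crossedActionData.homog s).map (c.crossedActionData.ρ g) =
      c.crossedActionData.homog (M.ract s g) := by
  ext P
  constructor
  · rintro ⟨X, hX, ⟨φ⟩⟩
    refine LinearMap.ext fun v => ?_
    have hv : φ.hom.f (φ.inv.f v) = v := LinearMap.congr_fun (congrArg GrVect.Hom.f φ.inv_hom_id) v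
    have h := φ.hom.comm (M.ract s g) (φ.inv.f v)
    rw [hv] at h
    rw [← h]
    refine Eq.trans (congrArg φ.hom.f ?_) hv
    -- The image of an object property is closed under isomorphism, so the degree is transported
    -- along `φ`.
    exact regrade_homogeneous g (LinearMap.congr_fun hX _)
  · intro hP
    -- The preimage is `P` regraded by `g⁻¹`. The identity map is an isomorphism of graded spaces
    -- here, so no cocycle enters.
    refine ⟨(M.regrade k g⁻¹).obj P, ?_, ⟨GrVect.mkIso (P := (M.regrade k g).obj ((M.regrade k g⁻¹).obj P))
      (LinearEquiv.refl k P.V) fun t v => ?_⟩⟩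
    · change P.proj (M.ract s g⁻¹⁻¹) = _
      rw [inv_inv]
      exact hP
    · change P.proj (M.ract (M.ract t g⁻¹) g⁻¹⁻¹) v = P.proj t v
      rw [ract_inv_cancel]

/-- On homogeneous vectors both sides of each axiom are explicit scalars. Associativity of `ρ₂` is
the cocycle identity of `σ`, associativity of `γ` that of `τ`, and compatibility of `γ` with `ρ₂` is
`compat`. The unit axioms and the remaining compatibilities are the normalizations. -/
theorem isCrossedTensorCategory : IsCrossedTensorCategory k c.crossedActionData where
  tensorCategory := GrVect.isTensorCategory
  decomp := decomp
  hom_zero s t X Y hX hY hst f := by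
    refine GrVect.hom_ext (LinearMap.ext fun v => ?_)
    have h1 : X.proj s v = v := LinearMap.congr_fun hX v
    have h2 : Y.proj t (f.f v) = f.f v := LinearMap.congr_fun hY _
    rw [← h1, f.comm, ← h2, Y.proj_ne _ _ _ hst]
    rfl
  tensor_mem s t X Y hX hY := TensorProduct.ext' fun v w =>
    GrVect.tmul_homogeneous (LinearMap.congr_fun hX v) (LinearMap.congr_fun hY w)
  unit_mem := GrVect.unitProj_one
  additive g := ⟨rfl⟩
  linear g := ⟨fun _ _ => rfl⟩
  ρ₂_assoc a b d X := by
    refine GrVect.hom_ext (GrVect.ext_homogeneous X fun s v hv => ?_)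
    refine (LinearMap.comp_apply_smul (c.ρ₂_app a b (regrade_homogeneous d hv))
      (c.ρ₂_app (b * a) d hv)).trans (Eq.trans ?_ (LinearMap.comp_apply_smul (c.ρ₂_app b d hv)
        (LinearMap.comp_apply_smul (c.ρ₂_app a (d * b) hv) (c.cast_f_smul _ X v))).symm)
    rw [mul_one, ← mul_inv, ← mul_inv, c.σ_cocycle]
    rfl
  ρ₂_unit_right a X := by
    refine GrVect.hom_ext (GrVect.ext_homogeneous X fun s v hv => ?_)
    refine (LinearMap.comp_apply_smul (eq_one_smul v) (LinearMap.comp_apply_smul (c.ρ₂_app a 1 hv)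
      (c.cast_f_smul _ X v))).trans ?_
    rw [c.σ_one_left, inv_one, one_mul, one_mul]
    exact (eq_one_smul v).symm
  ρ₂_unit_left a X := by
    refine GrVect.hom_ext (GrVect.ext_homogeneous X fun s v hv => ?_)
    refine (LinearMap.comp_apply_smul (eq_one_smul v) (LinearMap.comp_apply_smul (c.ρ₂_app 1 a hv)
      (c.cast_f_smul _ X v))).trans ?_
    rw [c.σ_one_right, inv_one, one_mul, one_mul]
    exact (eq_one_smul v).symm
  map_homog := c.map_homog
  γ_natural g t X X' Y Y' hY hY' f f' := by
    refine GrVect.hom_ext (GrVect.ext_tmul_homogeneous X fun s u v hu => ?_)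
    have hu' : X'.proj s (f.f u) = f.f u := by rw [← f.comm, hu]
    refine (c.γ_hom_f g t hY' hu' (f'.f v)).trans ?_
    refine Eq.trans ?_ (congrArg (TensorProduct.map f.f f'.f) (c.γ_hom_f g t hY hu v)).symm
    exact (map_smul (TensorProduct.map f.f f'.f) (((c.τ s t g)⁻¹ : kˣ) : k) (u ⊗ₜ v)).symm
  γ_assoc g s t X Y Z hY hZ := by
    refine GrVect.hom_ext (GrVect.ext_tmul_tmul_homogeneous X fun a x y z hx => ?_)
    have hy : Y.proj s y = y := LinearMap.congr_fun hY y
    refine (LinearMap.comp_apply_smul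
      (c.γ_hom_f g t hZ (P := X ⊗ Y) (GrVect.tmul_homogeneous hx hy) z)
      (LinearMap.comp_apply_smul (TensorProduct.map_tmul_smul (c.γ_hom_f (M.lact t g) s hY hx y)
        (eq_one_smul z)) (eq_one_smul _))).trans (Eq.trans ?_ (LinearMap.comp_apply_smul
          (eq_one_smul _) (LinearMap.comp_apply_smul (c.γ_hom_f g (s * t) (Q := Y ⊗ Z) _ hx (y ⊗ₜ z))
            (TensorProduct.map_tmul_smul (c.cast_f_smul _ X x)
              (c.γ_hom_f g t hZ hy z)))).symm)
    refine congrArg (fun i : kˣ => (i : k) • (x ⊗ₜ[k] (y ⊗ₜ[k] z))) ?_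
    simp only [mul_one, one_mul, ← mul_inv]
    rw [c.τ_cocycle, mul_comm]
  γ_unit_right g X := by
    refine GrVect.hom_ext (GrVect.ext_tmul_homogeneous X fun s u x hu => ?_)
    refine (LinearMap.comp_apply_smul (c.γ_hom_f g 1 (Q := 𝟙_ (GrVect k Γ)) _ hu x)
      (LinearMap.comp_apply_smul (TensorProduct.map_tmul_smul (c.cast_f_smul _ X u)
        (eq_one_smul x)) (eq_one_smul _))).trans ?_
    rw [c.τ_one_right, inv_one, one_mul, one_mul, one_mul]
    exact (eq_one_smul _).symm
  γ_unit_left g s X hX := by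
    refine GrVect.hom_ext (TensorProduct.ext' fun x v => ?_)
    have hx : (𝟙_ (GrVect k Γ)).proj 1 x = x := 
      LinearMap.congr_fun (GrVect.unitProj_one (k := k) (Γ := Γ)) x
    refine (LinearMap.comp_apply_smul (c.γ_hom_f g s hX hx v)
      (LinearMap.comp_apply_smul (TensorProduct.map_tmul_smul (eq_one_smul x)
        (eq_one_smul v)) (eq_one_smul _))).trans ?_
    rw [c.τ_one_left, inv_one, one_mul, one_mul, one_mul]
    exact (eq_one_smul _).symm
  γ_ρ₂ g h s X Y hY hY' := by
    refine GrVect.hom_ext (GrVect.ext_tmul_homogeneous X fun a u v hu => ?_)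
    have hv : Y.proj s v = v := LinearMap.congr_fun hY v
    -- The vector `u ⊗ v` has degree `a * s`, so `ρ₂` on `X ⊗ Y` contributes `σ_{as}(h,g)⁻¹`; this
    -- matches the left side of `compat`.
    refine (LinearMap.comp_apply_smul (c.ρ₂_app g h (P := X ⊗ Y) (GrVect.tmul_homogeneous hu hv))
      (c.γ_hom_f (h * g) s hY hu v)).trans (Eq.trans ?_ (LinearMap.comp_apply_smul
        (c.γ_hom_f h s hY hu v) (LinearMap.comp_apply_smul
        (c.γ_hom_f g _ hY' (regrade_homogeneous _ hu) v) (TensorProduct.map_tmul_smul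
          (LinearMap.comp_apply_smul (c.ρ₂_app _ _ hu) (c.cast_f_smul _ X u))
          (c.ρ₂_app g h hv)))).symm)
    refine congrArg (fun i : kˣ => (i : k) • (u ⊗ₜ[k] v)) ?_
    rw [mul_one, ← mul_inv, c.compat]
    simp only [mul_inv]
    ac_rfl
  γ₀_ρ₂ g h := by
    refine GrVect.hom_ext (LinearMap.ext fun x => ?_)
    have hx : (𝟙_ (GrVect k Γ)).proj 1 x = x := 
      LinearMap.congr_fun (GrVect.unitProj_one (k := k) (Γ := Γ)) x
    refine (LinearMap.comp_apply_smul (c.ρ₂_app g h hx) (eq_one_smul _)).trans ?_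
    rw [c.σ_one, inv_one, one_mul]
    exact (eq_one_smul _).symm
  γ_ρ₀ s X Y hY := by
    refine GrVect.hom_ext (GrVect.ext_tmul_homogeneous X fun a u v hu => ?_)
    refine (LinearMap.comp_apply_smul (eq_one_smul _) (LinearMap.comp_apply_smul
      (c.γ_hom_f 1 s hY hu v) (TensorProduct.map_tmul_smul (c.cast_f_smul _ X u)
        (eq_one_smul v)))).trans ?_
    rw [c.τ_one, inv_one, one_mul, one_mul, one_mul]
    exact (eq_one_smul _).symm
  γ₀_ρ₀ := rfl

end CocyclePair

/-! ## Representations of abelian extensions -/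

namespace AbelianExtension

variable {k : Type u} [Field k] {G : Type v} {Γ : Type w} [Group G] [Group Γ] {M : MatchedPair G Γ}
  (c : CocyclePair k M)

/-- Obtained by letting `s⁻¹` act on `(s ▷ g)(s ▷ g)⁻¹ = 1`. Together with `inv_ract_inv` it says
that the index map of the antipode is an involution. -/
theorem lact_ract_inv (s : Γ) (g : G) : M.lact (M.ract s g)⁻¹ (M.lact s g)⁻¹ = g⁻¹ := by
  have h := M.lact_mul s⁻¹ (M.lact s g) (M.lact s g)⁻¹
  rw [mul_inv_cancel, M.lact_one, ← M.mul_lact, inv_mul_cancel, M.one_lact, inv_ract] at h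
  exact eq_inv_of_mul_eq_one_right h.symm

section

variable [Fintype Γ]

/-- The square of the antipode sends each basis element to a unit multiple of itself, so it is
invertible; therefore so is the antipode. -/
theorem bijective_antipode :
    Function.Bijective (HopfAlgebra.antipode k (A := AbelianExtension c)) := by
  let S := HopfAlgebra.antipode k (A := AbelianExtension c)
  have hS : S = antipodeLin c := rfl
  obtain ⟨x, hx⟩ : ∃ x : Γ → G → kˣ, ∀ s g, S (S (e c s g)) = (x s g : k) • e c s g := by
    let y : Γ → G → kˣ := fun s g =>
      (c.τ s⁻¹ s g * c.σ (M.lact s g) (M.lact s g)⁻¹ s⁻¹)⁻¹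
    have hy : ∀ s g, S (e c s g) = (y s g : k) • e c (M.ract s g)⁻¹ (M.lact s g)⁻¹ :=
      antipodeLin_e c
    refine ⟨fun s g => y s g * y (M.ract s g)⁻¹ (M.lact s g)⁻¹, fun s g => ?_⟩
    rw [hy, map_smul, hy, inv_ract_inv, lact_ract_inv, inv_inv, inv_inv, smul_smul, Units.val_mul]
  -- The inverse of `S²`, diagonal with the inverse scalars.
  let D : AbelianExtension c →ₗ[k] AbelianExtension c :=
    (basis c).constr k fun p => ((x p.1 p.2)⁻¹ : kˣ).val • e c p.1 p.2
  have hD : ∀ s g, D (e c s g) = ((x s g)⁻¹ : kˣ).val • e c s g := fun s g =>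
    (basis c).constr_basis _ _ _
  have h1 : D ∘ₗ S ∘ₗ S = LinearMap.id := lin_ext c fun s g => by
    rw [LinearMap.comp_apply, LinearMap.comp_apply, hx, map_smul, hD, smul_smul, Units.mul_inv,
      one_smul, LinearMap.id_apply]
  have h2 : S ∘ₗ S ∘ₗ D = LinearMap.id := lin_ext c fun s g => by
    rw [LinearMap.comp_apply, LinearMap.comp_apply, hD, map_smul, map_smul, hx, smul_smul,
      Units.inv_mul, one_smul, LinearMap.id_apply]
  exact ⟨Function.LeftInverse.injective (g := D ∘ₗ S) (LinearMap.congr_fun h1),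
    Function.RightInverse.surjective (g := S ∘ₗ D) (LinearMap.congr_fun h2)⟩

variable {c}

theorem algHom_ext {A : Type*} [Semiring A] [Algebra k A] {f f' : AbelianExtension c →ₐ[k] A}
    (h : ∀ s g, f (e c s g) = f' (e c s g)) : f = f' :=
  AlgHom.toLinearMap_injective (lin_ext c h)

variable (c)

/-- The algebra homomorphism given by operators satisfying the relations of the `e_s # g`. -/
def lift {A : Type*} [Semiring A] [Algebra k A] (T : Γ → G → A)
    (hmul : ∀ s g h, T s g * T (M.ract s g) h = (c.σ g h s : k) • T s (g * h))
    (hne : ∀ s t g h, M.ract s g ≠ t → T s g * T t h = 0) (hone : ∑ s, T s 1 = 1) :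
    AbelianExtension c →ₐ[k] A :=
  have he : ∀ s g, (basis c).constr k (fun p => T p.1 p.2) (e c s g) = T s g := fun s g =>
    (basis c).constr_basis _ _ _
  AlgHom.ofLinearMap ((basis c).constr k fun p => T p.1 p.2)
    (by
      rw [one_def, map_sum]
      simp only [he, hone])
    (fun a b => by
      induction a using ind with
      | h0 => simp
      | hadd a a' h h' => rw [add_mul, map_add, map_add, add_mul, h, h']
      | hsmul x a h => rw [smul_mul_assoc, map_smul, map_smul, smul_mul_assoc, h]
      | he s g =>
      induction b using ind with
      | h0 => simp
      | hadd a a' h h' => rw [mul_add, map_add, map_add, mul_add, h, h']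
      | hsmul x a h => rw [mul_smul_comm, map_smul, map_smul, mul_smul_comm, h]
      | he t h =>
      rw [he, he]
      by_cases ht : M.ract s g = t
      · subst ht
        rw [e_mul_e_self, map_smul, he, hmul]
      · rw [e_mul_e_ne c h ht, map_zero, hne _ _ _ _ ht])

theorem lift_e {A : Type*} [Semiring A] [Algebra k A] (T : Γ → G → A)
    (hmul : ∀ s g h, T s g * T (M.ract s g) h = (c.σ g h s : k) • T s (g * h))
    (hne : ∀ s t g h, M.ract s g ≠ t → T s g * T t h = 0) (hone : ∑ s, T s 1 = 1) (s : Γ) (g : G) :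
    lift c T hmul hne hone (e c s g) = T s g :=
  (basis c).constr_basis k (fun p => T p.1 p.2) (s, g)

/-! ### The units `∑ e_s # g` -/

theorem e_one_mul_e (s : Γ) (h : G) : e c s 1 * e c s h = e c s h := by
  have := e_mul_e_self c s 1 h
  rwa [M.ract_one, c.σ_one_left, one_mul, Units.val_one, one_smul] at this

theorem e_one_mul_e_ne {s t : Γ} (hst : s ≠ t) (h : G) : e c s 1 * e c t h = 0 :=
  e_mul_e_ne c h (by rwa [M.ract_one])

theorem e_mul_e_one (s : Γ) (g : G) : e c s g * e c (M.ract s g) 1 = e c s g := by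
  rw [e_mul_e_self, c.σ_one_right, mul_one, Units.val_one, one_smul]

/-- The element `∑ e_s # g`. -/
def groupUnit (g : G) : AbelianExtension c := ∑ s, e c s g

/-- The inverse of `∑ e_s # g`. -/
def groupUnitInv (g : G) : AbelianExtension c :=
  ∑ s, (((c.σ g g⁻¹ s)⁻¹ : kˣ) : k) • e c (M.ract s g) g⁻¹

/-- This factorization reduces a representation to its grading idempotents and the operators of the
`groupUnit c g`. -/
theorem e_one_mul_groupUnit (s : Γ) (g : G) : e c s 1 * groupUnit c g = e c s g := by
  rw [groupUnit, Finset.mul_sum, Finset.sum_eq_single s, e_one_mul_e]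
  · exact fun t _ ht => e_one_mul_e_ne c ht.symm g
  · simp

theorem groupUnit_mul_e_one (s : Γ) (g : G) : groupUnit c g * e c (M.ract s g) 1 = e c s g := by
  rw [groupUnit, Finset.sum_mul, Finset.sum_eq_single s, e_mul_e_one]
  · exact fun t _ ht => e_mul_e_ne c 1 fun h => ht ((M.ractEquiv g).injective h)
  · simp

theorem groupUnit_mul_inv (g : G) : groupUnit c g * groupUnitInv c g = 1 := by
  rw [groupUnit, Finset.sum_mul, one_def]
  refine Finset.sum_congr rfl fun s _ => ?_
  rw [groupUnitInv, Finset.mul_sum, Finset.sum_eq_single s]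
  · rw [mul_smul_comm, e_mul_e_self, smul_smul, Units.inv_mul, one_smul, mul_inv_cancel]
  · intro t _ ht
    have hne : M.ract s g ≠ M.ract t g := fun h => ht ((M.ractEquiv g).injective h).symm
    rw [mul_smul_comm, e_mul_e_ne c _ hne, smul_zero]
  · simp

theorem groupUnitInv_mul (g : G) : groupUnitInv c g * groupUnit c g = 1 := by
  -- The product yields idempotents indexed by `s ◁ g`, so the sum defining `1` is reindexed by this
  -- permutation.
  rw [groupUnitInv, Finset.sum_mul, one_def,
    ← Equiv.sum_comp (M.ractEquiv g) fun s => e c s 1]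
  refine Finset.sum_congr rfl fun s _ => ?_
  have hs : M.ract (M.ract s g) g⁻¹ = s := by rw [← M.ract_mul, mul_inv_cancel, M.ract_one]
  rw [groupUnit, Finset.mul_sum, Finset.sum_eq_single s]
  · have := e_mul_e_self c (M.ract s g) g⁻¹ g
    rw [hs, inv_mul_cancel, σ_inv] at this
    rw [smul_mul_assoc, this, smul_smul, Units.inv_mul, one_smul]
    rfl
  · intro t _ ht
    rw [smul_mul_assoc, e_mul_e_ne c _ (by rwa [hs, ne_comm]), smul_zero]
  · simp

/-- The unit intertwines the grading idempotents; in a representation its inverse therefore moves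
degree `s` to degree `s ◁ g`, as `r^g` must. -/
theorem groupUnitInv_mul_e_one (s : Γ) (g : G) :
    groupUnitInv c g * e c s 1 = e c (M.ract s g) 1 * groupUnitInv c g := by
  have h : e c s 1 * groupUnit c g = groupUnit c g * e c (M.ract s g) 1 := by
    rw [e_one_mul_groupUnit, groupUnit_mul_e_one]
  calc _ = groupUnitInv c g * (e c s 1 * groupUnit c g) * groupUnitInv c g := by
        rw [mul_assoc, mul_assoc, groupUnit_mul_inv, mul_one]
    _ = _ := by rw [h, ← mul_assoc, groupUnitInv_mul, one_mul]

theorem e_one_mul_groupUnit_mul_groupUnit (s : Γ) (g h : G) :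
    e c s 1 * (groupUnit c g * groupUnit c h) = (c.σ g h s : k) • (e c s 1 * groupUnit c (g * h)) := by
  rw [← mul_assoc, e_one_mul_groupUnit, e_one_mul_groupUnit, ← e_mul_e_self]
  conv_lhs => rw [← e_mul_e_one, mul_assoc, e_one_mul_groupUnit]

/-- The algebraic form of the equivariance relation: the scalar is that of `ρ₂` on vectors of degree
`s`. -/
theorem groupUnitInv_mul_groupUnitInv_mul_e_one (s : Γ) (g h : G) :
    groupUnitInv c h * groupUnitInv c g * e c s 1 =
      (((c.σ g h s)⁻¹ : kˣ) : k) • (groupUnitInv c (g * h) * e c s 1) := by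
  -- Left multiplication by the unit for `g * h` is injective, so the relation is proved after it,
  -- where the product rule for the `groupUnit`s applies.
  have key : groupUnit c (g * h) * (groupUnitInv c h * groupUnitInv c g * e c s 1) =
      (((c.σ g h s)⁻¹ : kˣ) : k) • (groupUnit c (g * h) * (groupUnitInv c (g * h) * e c s 1)) := by
    have h1 : groupUnitInv c h * groupUnitInv c g * e c s 1 =
        e c (M.ract s (g * h)) 1 * (groupUnitInv c h * groupUnitInv c g) := by
      rw [mul_assoc, groupUnitInv_mul_e_one, ← mul_assoc, groupUnitInv_mul_e_one, M.ract_mul,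
        mul_assoc]
    have h2 : groupUnit c g * groupUnit c h * (groupUnitInv c h * groupUnitInv c g) = 1 := by
      rw [mul_assoc, ← mul_assoc (groupUnit c h), groupUnit_mul_inv, one_mul, groupUnit_mul_inv]
    have h3 : groupUnit c (g * h) * e c (M.ract s (g * h)) 1 =
        e c s 1 * groupUnit c (g * h) := by
      rw [e_one_mul_groupUnit, groupUnit_mul_e_one]
    have h4 : e c s 1 * groupUnit c (g * h) = (((c.σ g h s)⁻¹ : kˣ) : k) •
        (e c s 1 * (groupUnit c g * groupUnit c h)) := by
      rw [e_one_mul_groupUnit_mul_groupUnit, smul_smul, Units.inv_mul, one_smul]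
    rw [h1, ← mul_assoc, h3, h4, smul_mul_assoc, mul_assoc, h2, mul_one, ← mul_assoc (groupUnit c _),
      groupUnit_mul_inv, one_mul]
  have := congrArg (groupUnitInv c (g * h) * ·) key
  simpa only [mul_smul_comm, ← mul_assoc, groupUnitInv_mul, one_mul] using this

theorem groupUnitInv_one : groupUnitInv c 1 = 1 := by
  rw [groupUnitInv, one_def]
  refine Finset.sum_congr rfl fun s _ => ?_
  rw [c.σ_one_left, M.ract_one, inv_one, inv_one, Units.val_one, one_smul]

end

end AbelianExtension

/-! ## Equivariant graded vector spaces as representations -/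

namespace CocyclePair

open AbelianExtension

variable {k : Type u} [Field k] {G : Type v} {Γ : Type w} [Group G] [Group Γ] [Fintype Γ]
  {M : MatchedPair G Γ} {c : CocyclePair k M} {h : IsCrossedTensorCategory k c.crossedActionData}

/-- The linear map underlying `r^g`. -/
def equivariantMap (P : Equivariantization h) (g : G) : P.X.V →ₗ[k] P.X.V := (P.r g).f

/-- The inverse of the linear map underlying `r^g`. -/
def equivariantInv (P : Equivariantization h) (g : G) : P.X.V →ₗ[k] P.X.V :=
  have := P.isIso g
  (inv (P.r g)).f

section

variable (P : Equivariantization h)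

theorem equivariantMap_inv (g : G) (v : P.X.V) :
    equivariantMap P g (equivariantInv P g v) = v :=
  have := P.isIso g
  LinearMap.congr_fun (congrArg GrVect.Hom.f (IsIso.inv_hom_id (P.r g))) v

theorem equivariantInv_map (g : G) (v : P.X.V) :
    equivariantInv P g (equivariantMap P g v) = v :=
  have := P.isIso g
  LinearMap.congr_fun (congrArg GrVect.Hom.f (IsIso.hom_inv_id (P.r g))) v

/-- The source of `r^g` is `P.X` with degree `s` relabelled as `s ◁ g`; read on the original
grading, `r^g` moves degrees accordingly. -/
theorem equivariantMap_proj (g : G) (s : Γ) (v : P.X.V) :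
    equivariantMap P g (P.X.proj s v) = P.X.proj (M.ract s g) (equivariantMap P g v) := by
  have h1 : equivariantMap P g (P.X.proj (M.ract (M.ract s g) g⁻¹) v) =
      P.X.proj (M.ract s g) (equivariantMap P g v) := (P.r g).comm (M.ract s g) v
  rwa [ract_inv_cancel] at h1

theorem equivariantInv_proj (g : G) (s : Γ) (v : P.X.V) :
    equivariantInv P g (P.X.proj (M.ract s g) v) = P.X.proj s (equivariantInv P g v) := by
  rw [← equivariantInv_map P g (P.X.proj s _), equivariantMap_proj, equivariantMap_inv]

theorem equivariantMap_equivariantMap (g g' : G) {s : Γ} {v : P.X.V} (hv : P.X.proj s v = v) :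
    equivariantMap P g (equivariantMap P g' v) =
      (((c.σ g' g s)⁻¹ : kˣ) : k) • equivariantMap P (g' * g) v := by
  have h1 := LinearMap.congr_fun (congrArg GrVect.Hom.f (P.r_mul g g')) v
  refine h1.trans (Eq.trans ?_ (map_smul (equivariantMap P (g' * g)) _ v))
  exact congrArg (equivariantMap P (g' * g)) (c.ρ₂_app g g' hv)

theorem equivariantMap_one (v : P.X.V) : equivariantMap P 1 v = v :=
  LinearMap.congr_fun (congrArg GrVect.Hom.f P.r_one) v

theorem equivariantInv_one (v : P.X.V) : equivariantInv P 1 v = v := by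
  rw [← equivariantMap_one P (equivariantInv P 1 v), equivariantMap_inv]

/-- The operator by which `e_s # g` acts on an equivariant graded vector space. -/
def operator (s : Γ) (g : G) : Module.End k P.X.V := P.X.proj s ∘ₗ equivariantInv P g

theorem operator_apply (s : Γ) (g : G) (v : P.X.V) :
    operator P s g v = P.X.proj s (equivariantInv P g v) := rfl

theorem operator_equivariantMap (s : Γ) (g : G) (v : P.X.V) :
    operator P s g (equivariantMap P g v) = P.X.proj s v := by
  rw [operator_apply, equivariantInv_map]

theorem operator_one (s : Γ) : operator P s 1 = P.X.proj s :=
  LinearMap.ext fun v => by rw [operator_apply, equivariantInv_one]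

theorem operator_mul (s : Γ) (g g' : G) : operator P s g * operator P (M.ract s g) g' =
    (c.σ g g' s : k) • operator P s (g * g') := by
  refine LinearMap.ext fun v => ?_
  rw [Module.End.mul_apply, LinearMap.smul_apply, operator_apply, operator_apply, operator_apply,
    equivariantInv_proj, P.X.proj_self]
  -- The equivariance relation is applied to the degree `s` part of the doubly inverted vector. The
  -- left side telescopes to a projection of `v`, and inverting `r^{g g'}` gives the relation
  -- between the inverses.
  have h1 := equivariantMap_equivariantMap P g' g
    (P.X.proj_self s (equivariantInv P g (equivariantInv P g' v)))
  rw [equivariantMap_proj, equivariantMap_inv, equivariantMap_proj, equivariantMap_inv,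
    ← M.ract_mul] at h1
  have h2 := congrArg (equivariantInv P (g * g')) h1
  rw [equivariantInv_proj, map_smul, equivariantInv_map] at h2
  rw [h2, smul_smul, Units.mul_inv, one_smul]

theorem operator_mul_ne (s t : Γ) (g g' : G) (hst : M.ract s g ≠ t) :
    operator P s g * operator P t g' = 0 := by
  refine LinearMap.ext fun v => ?_
  rw [Module.End.mul_apply, operator_apply, operator_apply, ← equivariantInv_proj,
    P.X.proj_ne _ _ _ hst, map_zero, LinearMap.zero_apply]

theorem sum_operator_one : ∑ s, operator P s 1 = 1 := by
  refine LinearMap.ext fun v => ?_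
  simp only [operator_one, LinearMap.sum_apply]
  exact P.X.sum_proj v

/-- The representation of the abelian extension on an equivariant graded vector space. -/
def repAct : AbelianExtension c →ₐ[k] Module.End k P.X.V :=
  AbelianExtension.lift c (operator P) (operator_mul P) (operator_mul_ne P) (sum_operator_one P)

theorem repAct_e (s : Γ) (g : G) : repAct P (e c s g) = operator P s g :=
  AbelianExtension.lift_e c ..

/-- Summing the projections shows that `groupUnit c g` acts by the inverse of `r^g`. This recovers
`r^g` itself from the module. -/
theorem repAct_groupUnitInv (g : G) : repAct P (groupUnitInv c g) = equivariantMap P g := by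
  have h1 : repAct P (groupUnit c g) = equivariantInv P g := by
    refine LinearMap.ext fun v => ?_
    rw [groupUnit, map_sum, LinearMap.sum_apply]
    simp only [repAct_e, operator_apply]
    exact P.X.sum_proj _
  refine LinearMap.ext fun v => ?_
  have h2 : repAct P (groupUnitInv c g) (repAct P (groupUnit c g) (equivariantMap P g v)) =
      equivariantMap P g v := by
    rw [← Module.End.mul_apply, ← map_mul, groupUnitInv_mul, map_one, Module.End.one_apply]
  rwa [h1, equivariantInv_map] at h2

end

/-- A linear map commuting with the action of the basis of the abelian extension is a morphism
of representations. -/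
theorem act_comm_of_basis {P Q : FinDimRep k (AbelianExtension c)} (f : P.V →ₗ[k] Q.V)
    (hf : ∀ s g v, f (P.act (e c s g) v) = Q.act (e c s g) (f v)) (a : AbelianExtension c)
    (v : P.V) : f (P.act a v) = Q.act a (f v) := by
  induction a using ind with
  | h0 => simp
  | hadd a b ha hb => simp [ha, hb]
  | hsmul x a ha => simp [ha]
  | he s g => exact hf s g v

theorem equivariantMap_natural {P Q : Equivariantization h} (f : P ⟶ Q) (g : G) (v : P.X.V) :
    f.f.f (equivariantMap P g v) = equivariantMap Q g (f.f.f v) :=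
  LinearMap.congr_fun (congrArg GrVect.Hom.f (f.comm g)) v

theorem operator_natural {P Q : Equivariantization h} (f : P ⟶ Q) (s : Γ) (g : G) (v : P.X.V) :
    f.f.f (operator P s g v) = operator Q s g (f.f.f v) := by
  rw [operator_apply, f.f.comm, operator_apply, ← equivariantInv_map Q g (f.f.f _),
    ← equivariantMap_natural, equivariantMap_inv]

variable (h) in
/-- The functor from equivariant graded vector spaces to representations. -/
def toRep : Equivariantization h ⥤ FinDimRep k (AbelianExtension c) where
  obj P := ⟨P.X.V, repAct P⟩
  map {P Q} f := ⟨f.f.f, act_comm_of_basis (P := ⟨P.X.V, repAct P⟩) (Q := ⟨Q.X.V, repAct Q⟩) f.f.f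
    fun s g v => by
      change f.f.f (repAct P _ v) = repAct Q _ (f.f.f v)
      rw [repAct_e, repAct_e, operator_natural]⟩

/-- The graded vector space underlying a representation. -/
def gradedOfRep (W : FinDimRep k (AbelianExtension c)) : GrVect k Γ where
  V := W.V
  proj s := W.act (e c s 1)
  proj_self s v := by rw [← Module.End.mul_apply, ← map_mul, e_one_mul_e]
  proj_ne s t v hst := by
    rw [← Module.End.mul_apply, ← map_mul, e_one_mul_e_ne c hst, map_zero, LinearMap.zero_apply]
  sum_proj v := by
    rw [← LinearMap.sum_apply, ← map_sum, ← one_def, map_one, Module.End.one_apply]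

theorem act_mul_apply (W : FinDimRep k (AbelianExtension c)) (a b : AbelianExtension c) (v : W.V) :
    W.act a (W.act b v) = W.act (a * b) v := by
  rw [map_mul, Module.End.mul_apply]

theorem act_one_apply (W : FinDimRep k (AbelianExtension c)) (v : W.V) : W.act 1 v = v := by
  rw [map_one, Module.End.one_apply]

theorem act_groupUnitInv_comm (W : FinDimRep k (AbelianExtension c)) (g : G) (s : Γ) (v : W.V) :
    W.act (groupUnitInv c g) (W.act (e c (M.ract s g⁻¹) 1) v) =
      W.act (e c s 1) (W.act (groupUnitInv c g) v) := by
  rw [act_mul_apply, groupUnitInv_mul_e_one, ract_inv_cancel', act_mul_apply]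

/-- The morphism `r^g` of a representation. -/
def gradedOfRepMap (W : FinDimRep k (AbelianExtension c)) (g : G) :
    (M.regrade k g).obj (gradedOfRep W) ⟶ gradedOfRep W where
  f := W.act (groupUnitInv c g)
  comm := act_groupUnitInv_comm W g

theorem act_groupUnitInv_groupUnitInv (W : FinDimRep k (AbelianExtension c)) (g g' : G) {s : Γ}
    {v : W.V} (hv : W.act (e c s 1) v = v) :
    W.act (groupUnitInv c g) (W.act (groupUnitInv c g') v) =
      (((c.σ g' g s)⁻¹ : kˣ) : k) • W.act (groupUnitInv c (g' * g)) v := by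
  have key := congrArg (fun a => W.act a v) (groupUnitInv_mul_groupUnitInv_mul_e_one c s g' g)
  simp only [map_smul, LinearMap.smul_apply] at key
  rwa [← act_mul_apply, ← act_mul_apply, ← act_mul_apply, hv] at key

theorem gradedOfRepMap_mul (W : FinDimRep k (AbelianExtension c)) (g g' : G) :
    (c.crossedActionData.ρ g).map (gradedOfRepMap W g') ≫ gradedOfRepMap W g =
      (c.crossedActionData.ρ₂ g g').hom.app (gradedOfRep W) ≫ gradedOfRepMap W (g' * g) := by
  refine GrVect.hom_ext (GrVect.ext_homogeneous (gradedOfRep W) fun s v hv => ?_)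
  refine Eq.trans ?_ (congrArg (W.act (groupUnitInv c (g' * g))) (c.ρ₂_app g g' hv)).symm
  refine Eq.trans ?_ (map_smul (W.act (groupUnitInv c (g' * g))) _ v).symm
  exact act_groupUnitInv_groupUnitInv W g g' hv

theorem gradedOfRepMap_one (W : FinDimRep k (AbelianExtension c)) :
    c.crossedActionData.ρ₀.hom.app (gradedOfRep W) ≫ gradedOfRepMap W 1 = 𝟙 (gradedOfRep W) := by
  refine GrVect.hom_ext (LinearMap.ext fun v => ?_)
  exact (DFunLike.congr_arg W.act (groupUnitInv_one c) ▸ act_one_apply W v :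
    W.act (groupUnitInv c 1) v = v)

variable (h) in
/-- The functor from representations to equivariant graded vector spaces. -/
def ofRep : FinDimRep k (AbelianExtension c) ⥤ Equivariantization h where
  obj W :=
    { X := gradedOfRep W
      r := gradedOfRepMap W
      isIso := CrossedActionData.isIso_of_relations _ _ (gradedOfRepMap_mul W) (gradedOfRepMap_one W)
      r_mul := gradedOfRepMap_mul W
      r_one := gradedOfRepMap_one W }
  map f := ⟨⟨f.f, fun s => f.comm (e c s 1)⟩,
    fun g => GrVect.hom_ext (LinearMap.ext fun v => f.comm (groupUnitInv c g) v)⟩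

/-- The inverse of the reconstructed `r^g` is the action of `groupUnit c g`, and `e_s # 1` times
that unit is `e_s # g`. -/
theorem toRep_ofRep_act (W : FinDimRep k (AbelianExtension c)) :
    repAct ((ofRep h).obj W) = W.act := by
  refine algHom_ext fun s g => LinearMap.ext fun (v : W.V) => ?_
  have hm : W.act (groupUnitInv c g) (W.act (groupUnit c g) v) = v := by
    rw [act_mul_apply, groupUnitInv_mul, act_one_apply]
  have hi : equivariantInv ((ofRep h).obj W) g (W.act (groupUnitInv c g) (W.act (groupUnit c g) v)) =
      W.act (groupUnit c g) v := equivariantInv_map ((ofRep h).obj W) g (W.act (groupUnit c g) v)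
  rw [hm] at hi
  rw [repAct_e]
  refine (congrArg (W.act (e c s 1)) hi).trans ?_
  rw [act_mul_apply, e_one_mul_groupUnit]
  rfl

theorem toRep_ofRep_obj (W : FinDimRep k (AbelianExtension c)) :
    (toRep h).obj ((ofRep h).obj W) = W :=
  congrArg (fun a => (⟨W.V, a⟩ : FinDimRep k (AbelianExtension c))) (toRep_ofRep_act (h := h) W)

/-- Two equivariant structures on a vector space agree if the projections and the underlying
linear maps do. -/
theorem equivariantization_ext : ∀ P Q : Equivariantization h, P.X = Q.X →
    (∀ g v v', HEq v v' → HEq (equivariantMap P g v) (equivariantMap Q g v')) → P = Q := by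
  rintro ⟨X, r, _, _, _⟩ ⟨Y, r', _, _, _⟩ hX hr
  obtain rfl : X = Y := hX
  have : r = r' := funext fun g => GrVect.hom_ext (LinearMap.ext fun v => eq_of_heq (hr g v v HEq.rfl))
  subst this
  rfl

theorem ofRep_toRep_proj (P : Equivariantization h) (s : Γ) :
    repAct P (e c s 1) = P.X.proj s := by
  rw [repAct_e, operator_one]

theorem gradedOfRep_toRep (P : Equivariantization h) :
    gradedOfRep ((toRep h).obj P) = P.X := by
  -- Abstracting the projections as variables allows their equality to be substituted; the remaining
  -- fields are proofs.
  have key : ∀ (V : Type u) [AddCommGroup V] [Module k V] [FiniteDimensional k V]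
      (p q : Γ → V →ₗ[k] V) (_ : p = q) h1 h2 h3 h1' h2' h3',
      (⟨V, p, h1, h2, h3⟩ : GrVect k Γ) = ⟨V, q, h1', h2', h3'⟩ := by
    rintro V _ _ _ p q rfl _ _ _ _ _ _
    rfl
  exact key P.X.V _ _ (funext (ofRep_toRep_proj P)) _ _ _ _ _ _

theorem ofRep_toRep_obj (P : Equivariantization h) : (ofRep h).obj ((toRep h).obj P) = P := by
  refine equivariantization_ext _ _ (gradedOfRep_toRep P) fun g v v' hv => ?_
  obtain rfl : v = v' := eq_of_heq hv
  exact heq_of_eq (LinearMap.congr_fun (repAct_groupUnitInv P g) v)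

variable (h) in
/-- The equivalence of equivariant graded vector spaces and representations. -/
def equivRep : Equivariantization h ≌ FinDimRep k (AbelianExtension c) :=
  CategoryTheory.Equivalence.mk (toRep h) (ofRep h)
    -- Unit and counit are identity maps on the underlying spaces, so naturality holds by
    -- definition.
    (NatIso.ofComponents (fun P => Equivariantization.mkIso
        (GrVect.mkIso (P := P.X) (Q := gradedOfRep ((toRep h).obj P)) (LinearEquiv.refl k P.X.V)
          fun s v => (LinearMap.congr_fun (ofRep_toRep_proj P s) v).symm)
        fun g => GrVect.hom_ext (LinearMap.ext fun v =>
          (LinearMap.congr_fun (repAct_groupUnitInv P g) v).symm))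
      fun _ => rfl)
    (NatIso.ofComponents (fun W => FinDimRep.mkIso (P := (toRep h).obj ((ofRep h).obj W)) (Q := W)
        (LinearEquiv.refl k W.V)
        fun a v => LinearMap.congr_fun (DFunLike.congr_fun (toRep_ofRep_act (h := h) W) a) v)
      fun _ => rfl)

end CocyclePair

/-! ## Strictness of the equivalence -/

/-- The isomorphism of representations underlying an equality of objects. -/
def FinDimRep.isoOfEq {k : Type u} [Field k] {H : Type v₁} [Ring H] [Bialgebra k H]
    {P Q : FinDimRep k H} (h : P = Q) (f : P.V ≃ₗ[k] Q.V) (hf : ∀ v, HEq (f v) v) : P ≅ Q :=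
  FinDimRep.mkIso f fun a v => by
    subst h
    rw [eq_of_heq (hf _), eq_of_heq (hf _)]

/-- Strictness is stated with `eqToHom`, which is opaque on vectors. The coherence laws are checked
with explicit identity maps instead, and this lemma identifies the two. -/
theorem FinDimRep.isoOfEq_hom {k : Type u} [Field k] {H : Type v₁} [Ring H] [Bialgebra k H]
    {P Q : FinDimRep k H} (h : P = Q) (f : P.V ≃ₗ[k] Q.V) (hf : ∀ v, HEq (f v) v) :
    (FinDimRep.isoOfEq h f hf).hom = eqToHom h := by
  subst h
  exact FinDimRep.hom_ext (LinearMap.ext fun v => eq_of_heq (hf v))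

namespace CocyclePair

open AbelianExtension

variable {k : Type u} [Field k] {G : Type v} {Γ : Type w} [Group G] [Group Γ] [Fintype Γ]
  {M : MatchedPair G Γ} {c : CocyclePair k M} {h : IsCrossedTensorCategory k c.crossedActionData}

/-- The structure on a tensor product is a sum over a chosen decomposition of `Q.X`. Restricting it
along the map from a line in degree `b` that hits `v` removes the choice. -/
theorem equivariantMap_tensor (P Q : Equivariantization h) (g : G) {a b : Γ} {u : P.X.V} {v : Q.X.V}
    (hu : P.X.proj a u = u) (hv : Q.X.proj b v = v) :
    equivariantMap (Equivariantization.tensor P Q) g (u ⊗ₜ[k] v : P.X.V ⊗[k] Q.X.V) =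
      (((c.τ a b g)⁻¹ : kˣ) : k) •
        (equivariantMap P (M.lact b g) u ⊗ₜ[k] equivariantMap Q g v : P.X.V ⊗[k] Q.X.V) := by
  let f : GrVect.concentrated k b ⟶ Q.X :=
    GrVect.ofConcentrated (LinearMap.toSpanSingleton k Q.X.V v) fun x => by simp [hv]
  have hf : ∀ x : k, f.f x = x • v := fun _ => rfl
  have hZ : c.crossedActionData.homog b (GrVect.concentrated k b) :=
    GrVect.concentratedProj_self _ b
  have key := LinearMap.congr_fun (congrArg GrVect.Hom.f
    (Equivariantization.map_whisker_tensorR h P.r Q.r g hZ f)) (u ⊗ₜ[k] (1 : k))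
  have e1 : equivariantMap (Equivariantization.tensor P Q) g
      (u ⊗ₜ[k] ((1 : k) • v) : P.X.V ⊗[k] Q.X.V) = _ := key
  rw [one_smul] at e1
  refine e1.trans ?_
  refine (congrArg (TensorProduct.map (equivariantMap P (M.lact b g))
    (equivariantMap Q g ∘ₗ f.f)) (c.γ_hom_f g b hZ hu (1 : k))).trans ?_
  refine (map_smul (TensorProduct.map (equivariantMap P (M.lact b g))
    (equivariantMap Q g ∘ₗ f.f)) _ (u ⊗ₜ[k] (1 : k))).trans ?_
  refine congrArg (fun z : P.X.V ⊗[k] Q.X.V => (((c.τ a b g)⁻¹ : kˣ) : k) • z) ?_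
  refine congrArg (fun z => equivariantMap P (M.lact b g) u ⊗ₜ[k] equivariantMap Q g z) ?_
  exact one_smul k v

theorem tensorAct_repAct_e (P Q : Equivariantization h) (s : Γ) (g : G) :
    FinDimRep.tensorAct (repAct P) (repAct Q) (e c s g) =
      ∑ t, (c.τ t (t⁻¹ * s) g : k) •
        TensorProduct.map (operator P t (M.lact (t⁻¹ * s) g)) (operator Q (t⁻¹ * s) g) := by
  rw [FinDimRep.tensorAct_apply, comul_e, map_sum]
  refine Finset.sum_congr rfl fun t _ => ?_
  rw [map_smul, FinDimRep.act₂_tmul, repAct_e, repAct_e]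

/-- In the comultiplication only the term of degrees `(a, b)` can survive, and there the group
element `b ▷ g` matches the map applied to `u`. The scalar `τ_g(a,b)` is inverse to the one in
`equivariantMap_tensor`. -/
theorem tensorAct_equivariantMap (P Q : Equivariantization h) (s : Γ) (g : G) {a b : Γ} {u : P.X.V}
    {v : Q.X.V} (hu : P.X.proj a u = u) (hv : Q.X.proj b v = v) :
    FinDimRep.tensorAct (repAct P) (repAct Q) (e c s g)
        (equivariantMap P (M.lact b g) u ⊗ₜ[k] equivariantMap Q g v) =
      (c.τ a b g : k) • GrVect.tensorProj P.X.proj Q.X.proj s (u ⊗ₜ[k] v) := by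
  rw [tensorAct_repAct_e, LinearMap.sum_apply, GrVect.tensorProj_tmul, Finset.smul_sum]
  refine Finset.sum_congr rfl fun t _ => ?_
  rw [LinearMap.smul_apply, TensorProduct.map_tmul, operator_equivariantMap]
  by_cases hb : t⁻¹ * s = b
  · rw [hb, operator_equivariantMap]
    by_cases ha : t = a
    · rw [ha]
    · rw [← hu, P.X.proj_ne _ _ _ ha, TensorProduct.zero_tmul, smul_zero, smul_zero]
  · rw [← hv, Q.X.proj_ne _ _ _ hb, TensorProduct.tmul_zero, TensorProduct.tmul_zero, smul_zero,
      smul_zero]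

theorem repAct_tensor (P Q : Equivariantization h) :
    (FinDimRep.tensorAct (repAct P) (repAct Q) :
      AbelianExtension c →ₐ[k] Module.End k (P.X.V ⊗[k] Q.X.V)) =
    repAct (Equivariantization.tensor P Q) := by
  refine algHom_ext fun s g => Eq.trans ?_ (repAct_e (Equivariantization.tensor P Q) s g).symm
  -- Both actions are compared after precomposition with the invertible structure map of the tensor
  -- product; each then becomes the projection to degree `s`.
  have key : FinDimRep.tensorAct (repAct P) (repAct Q) (e c s g) ∘ₗ
      (equivariantMap (Equivariantization.tensor P Q) g : P.X.V ⊗[k] Q.X.V →ₗ[k] P.X.V ⊗[k] Q.X.V) =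
      GrVect.tensorProj P.X.proj Q.X.proj s := by
    refine GrVect.ext_tmul_homogeneous P.X fun a u v hu => ?_
    refine LinearMap.congr_fun (GrVect.ext_homogeneous Q.X
      (f := (FinDimRep.tensorAct (repAct P) (repAct Q) (e c s g) ∘ₗ
        (equivariantMap (Equivariantization.tensor P Q) g :
          P.X.V ⊗[k] Q.X.V →ₗ[k] P.X.V ⊗[k] Q.X.V)) ∘ₗ TensorProduct.mk k P.X.V Q.X.V u)
      (g := GrVect.tensorProj P.X.proj Q.X.proj s ∘ₗ TensorProduct.mk k P.X.V Q.X.V u)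
      fun b v hv => ?_) v
    refine (congrArg (FinDimRep.tensorAct (repAct P) (repAct Q) (e c s g))
      (equivariantMap_tensor P Q g hu hv)).trans ?_
    rw [map_smul, tensorAct_equivariantMap P Q s g hu hv, smul_smul, Units.inv_mul, one_smul]
    rfl
  refine LinearMap.ext fun v => ?_
  have h1 := equivariantMap_inv (Equivariantization.tensor P Q) g v
  refine (congrArg (FinDimRep.tensorAct (repAct P) (repAct Q) (e c s g)) h1).symm.trans ?_
  exact LinearMap.congr_fun key _

/-- Since `γ₀` is the identity, `e_s # g` acts on `k` as the projection to degree `s`, that is, by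
the counit. -/
theorem repAct_unit :
    (FinDimRep.unitAct k (AbelianExtension c) : AbelianExtension c →ₐ[k] Module.End k k) =
    repAct (Equivariantization.unit h) := by
  refine algHom_ext fun s g => LinearMap.ext fun x => ?_
  have hm : equivariantMap (Equivariantization.unit h) g x = x := rfl
  have hx := operator_equivariantMap (Equivariantization.unit h) s g x
  rw [hm] at hx
  refine Eq.trans ?_ (LinearMap.congr_fun (repAct_e (Equivariantization.unit h) s g) x).symm
  refine Eq.trans ?_ hx.symm
  refine Eq.trans ?_ (GrVect.unitProj_apply s x).symm
  rw [FinDimRep.unitAct_apply, counit_e]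
  by_cases hs : s = 1
  · subst hs
    rw [if_pos rfl, GrVect.unitProj_one, LinearMap.id_apply]
  · rw [if_neg hs, GrVect.unitProj_ne hs, LinearMap.zero_apply]

theorem toRep_tensor (P Q : Equivariantization h) :
    (toRep h).obj P ⊗ (toRep h).obj Q = (toRep h).obj (P ⊗ Q) :=
  congrArg (fun a => (⟨P.X.V ⊗[k] Q.X.V, a⟩ : FinDimRep k (AbelianExtension c))) (repAct_tensor P Q)

theorem toRep_unit : 𝟙_ (FinDimRep k (AbelianExtension c)) =
    (toRep h).obj (𝟙_ (Equivariantization h)) :=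
  congrArg (fun a => (⟨k, a⟩ : FinDimRep k (AbelianExtension c))) (repAct_unit (h := h))

variable (h) in
/-- The monoidal structure of `toRep` given by identities. -/
def toRepCoreMonoidal : (toRep h).CoreMonoidal where
  εIso := FinDimRep.isoOfEq toRep_unit (LinearEquiv.refl k k) fun _ => HEq.rfl
  μIso P Q := FinDimRep.isoOfEq (toRep_tensor P Q) (LinearEquiv.refl k (P.X.V ⊗[k] Q.X.V))
    fun _ => HEq.rfl
  μIso_hom_natural_left _ _ := FinDimRep.hom_ext (TensorProduct.ext' fun _ _ => rfl)
  μIso_hom_natural_right _ _ := FinDimRep.hom_ext (TensorProduct.ext' fun _ _ => rfl)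
  associativity _ _ _ := FinDimRep.hom_ext (TensorProduct.ext_threefold fun _ _ _ => rfl)
  left_unitality _ := FinDimRep.hom_ext (TensorProduct.ext' fun _ _ => rfl)
  right_unitality _ := FinDimRep.hom_ext (TensorProduct.ext' fun _ _ => rfl)

theorem isStrictTensorFunctor_toRep : IsStrictTensorFunctor k (toRep h) where
  additive := ⟨rfl⟩
  linear := ⟨fun _ _ => rfl⟩
  -- Exactness is automatic for an equivalence.
  preservesFiniteLimits :=
    have := (equivRep h).isEquivalence_functor
    (inferInstance : PreservesFiniteLimits (equivRep h).functor)
  preservesFiniteColimits :=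
    have := (equivRep h).isEquivalence_functor
    (inferInstance : PreservesFiniteColimits (equivRep h).functor)
  obj_tensor := toRep_tensor
  obj_unit := toRep_unit
  strict_monoidal := ⟨(toRepCoreMonoidal h).toMonoidal, fun _ _ => FinDimRep.isoOfEq_hom _ _ fun _ => HEq.rfl,
    FinDimRep.isoOfEq_hom _ _ fun _ => HEq.rfl⟩

/-- The isomorphism of equivariant graded vector spaces underlying an equality of objects. -/
def isoOfEq {P Q : Equivariantization h} (e : P = Q) (f : P.X.V ≃ₗ[k] Q.X.V)
    (hf : ∀ v, HEq (f v) v) : P ≅ Q :=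
  Equivariantization.mkIso
    (GrVect.mkIso f fun s v => by
      subst e
      rw [eq_of_heq (hf _), eq_of_heq (hf _)])
    fun g => by
      subst e
      have : f = LinearEquiv.refl k _ := LinearEquiv.ext fun v => eq_of_heq (hf v)
      subst this
      exact (Category.comp_id _).trans (((c.crossedActionData.ρ g).map_id P.X ▸ Category.id_comp _).symm)

theorem isoOfEq_hom {P Q : Equivariantization h} (e : P = Q) (f : P.X.V ≃ₗ[k] Q.X.V)
    (hf : ∀ v, HEq (f v) v) : (isoOfEq e f hf).hom = eqToHom e := by
  subst e
  exact Equivariantization.hom_ext (GrVect.hom_ext (LinearMap.ext fun v => eq_of_heq (hf v)))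

/-- Strictness passes from `toRep` to `ofRep`, since they are mutually inverse on objects. -/
theorem ofRep_tensor (V W : FinDimRep k (AbelianExtension c)) :
    (ofRep h).obj V ⊗ (ofRep h).obj W = (ofRep h).obj (V ⊗ W) := by
  rw [← ofRep_toRep_obj ((ofRep h).obj V ⊗ (ofRep h).obj W), ← toRep_tensor, toRep_ofRep_obj,
    toRep_ofRep_obj]

theorem ofRep_unit : 𝟙_ (Equivariantization h) =
    (ofRep h).obj (𝟙_ (FinDimRep k (AbelianExtension c))) := by
  rw [toRep_unit (h := h), ofRep_toRep_obj]

variable (h) in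
/-- The monoidal structure of `ofRep` given by identities. -/
def ofRepCoreMonoidal : (ofRep h).CoreMonoidal where
  εIso := isoOfEq ofRep_unit (LinearEquiv.refl k k) fun _ => HEq.rfl
  μIso V W := isoOfEq (ofRep_tensor V W) (LinearEquiv.refl k (V.V ⊗[k] W.V)) fun _ => HEq.rfl
  μIso_hom_natural_left _ _ :=
    Equivariantization.hom_ext (GrVect.hom_ext (TensorProduct.ext' fun _ _ => rfl))
  μIso_hom_natural_right _ _ :=
    Equivariantization.hom_ext (GrVect.hom_ext (TensorProduct.ext' fun _ _ => rfl))
  associativity _ _ _ :=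
    Equivariantization.hom_ext (GrVect.hom_ext (TensorProduct.ext_threefold fun _ _ _ => rfl))
  left_unitality _ :=
    Equivariantization.hom_ext (GrVect.hom_ext (TensorProduct.ext' fun _ _ => rfl))
  right_unitality _ :=
    Equivariantization.hom_ext (GrVect.hom_ext (TensorProduct.ext' fun _ _ => rfl))

theorem isStrictTensorFunctor_ofRep : IsStrictTensorFunctor k (ofRep h) where
  additive := ⟨rfl⟩
  linear := ⟨fun _ _ => rfl⟩
  preservesFiniteLimits :=
    have := (equivRep h).isEquivalence_inverse
    (inferInstance : PreservesFiniteLimits (equivRep h).inverse)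
  preservesFiniteColimits :=
    have := (equivRep h).isEquivalence_inverse
    (inferInstance : PreservesFiniteColimits (equivRep h).inverse)
  obj_tensor := ofRep_tensor
  obj_unit := ofRep_unit
  strict_monoidal := ⟨(ofRepCoreMonoidal h).toMonoidal, fun _ _ => isoOfEq_hom _ _ fun _ => HEq.rfl,
    isoOfEq_hom _ _ fun _ => HEq.rfl⟩

variable (h) in
theorem strictlyTensorEquivalent :
    StrictlyTensorEquivalent k (Equivariantization h) (FinDimRep k (AbelianExtension c)) :=
  ⟨equivRep h, isStrictTensorFunctor_toRep, isStrictTensorFunctor_ofRep⟩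

/-! ### Tensor category structure on both sides of the equivalence. -/

variable (c) in
theorem isTensorCategory_rep : IsTensorCategory k (FinDimRep k (AbelianExtension c)) :=
  FinDimRep.isTensorCategory (bijective_antipode c)

theorem monoidalPreadditive : MonoidalPreadditive (Equivariantization h) :=
  have := GrVect.monoidalPreadditive (k := k) (Γ := Γ)
  { whiskerLeft_zero := Equivariantization.hom_ext MonoidalPreadditive.whiskerLeft_zero
    zero_whiskerRight := Equivariantization.hom_ext MonoidalPreadditive.zero_whiskerRight
    whiskerLeft_add := fun _ _ =>
      Equivariantization.hom_ext (MonoidalPreadditive.whiskerLeft_add _ _)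
    add_whiskerRight := fun _ _ =>
      Equivariantization.hom_ext (MonoidalPreadditive.add_whiskerRight _ _) }

theorem monoidalLinear :
    letI := monoidalPreadditive (h := h); MonoidalLinear k (Equivariantization h) :=
  letI := monoidalPreadditive (h := h)
  have := GrVect.monoidalPreadditive (k := k) (Γ := Γ)
  have := GrVect.monoidalLinear (k := k) (Γ := Γ)
  { whiskerLeft_smul := fun _ _ _ _ _ =>
      Equivariantization.hom_ext (MonoidalLinear.whiskerLeft_smul _ _ _)
    smul_whiskerRight := fun _ _ _ _ _ =>
      Equivariantization.hom_ext (MonoidalLinear.smul_whiskerRight _ _ _) }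

/-- The abelian structure comes from the vectorial functor `toRep` followed by the forgetful
functor. Duals are pulled back along the monoidal equivalence with representations, rather than
constructed equivariantly. -/
theorem isTensorCategory_equivariantization : IsTensorCategory k (Equivariantization h) := by
  have hF := isStrictTensorFunctor_toRep (h := h)
  have hT := isTensorCategory_rep c
  have := (equivRep h).isEquivalence_functor
  have : (equivRep h).functor.Additive := hF.additive
  have : (equivRep h).functor.Linear k := hF.linear
  let : (equivRep h).functor.Monoidal := (toRepCoreMonoidal h).toMonoidal
  refine (FinDimRep.isVectorialFunctor_forget.comp_equivalence
    (equivRep h).functor).isTensorCategory monoidalPreadditive monoidalLinear (fun P => ?_)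
    (fun P => ?_) (Module.finrank_self k)
  · obtain ⟨_⟩ := hT.leftDual ((equivRep h).functor.obj P)
    exact ⟨hasLeftDualOfEquivalence (equivRep h).toAdjunction P⟩
  · obtain ⟨_⟩ := hT.rightDual ((equivRep h).functor.obj P)
    exact ⟨hasRightDualOfEquivalence (equivRep h).toAdjunction P⟩

end CocyclePair

end

theorem mainTheorem5 {k : Type u} [Field k] [IsAlgClosed k] {G : Type v} {Γ : Type w}
    [Group G] [Finite G] [Group Γ] [Fintype Γ] (M : MatchedPair G Γ) (c : CocyclePair k M) :
    IsFusionCategory k (GrVect k Γ) ∧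
    ∃ h : IsCrossedTensorCategory k c.crossedActionData,
      IsTensorCategory k (Equivariantization h) ∧
      IsTensorCategory k (FinDimRep k (AbelianExtension c)) ∧
      StrictlyTensorEquivalent k (Equivariantization h) (FinDimRep k (AbelianExtension c)) :=
  ⟨GrVect.isFusionCategory, c.isCrossedTensorCategory, c.isTensorCategory_equivariantization,
    c.isTensorCategory_rep, CocyclePair.strictlyTensorEquivalent _⟩
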